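/- Let $k_1,\dots,k_5>0$ and $\gamma\in\mathbb{R}\setminus\{0\}$. Consider the two laminated Timoshenko systems on $\mathbb{R}$ with heat conduction of type III acting on the rotation angle, $$\begin{cases}\varphi_{tt}-k_1(\varphi_x+\psi+w)_x=0,\\ \psi_{tt}-k_2\psi_{xx}+k_1(\varphi_x+\psi+w)+\gamma q_{xt}=0,\\ w_{tt}-k_3w_{xx}+k_1(\varphi_x+\psi+w)=0,\\ q_{tt}-k_4q_{xx}+\mathcal{D}q_t+\gamma\psi_{xt}=0,\end{cases}$$ where $\mathcal{D}q_t=-k_5q_{xxt}$ (System I) or $\mathcal{D}q_t=k_5q_t$ (System II). In the variables $U=(v,u,z,y,\phi,\theta,\sigma,\eta)=(\varphi_x+\psi+w,\varphi_t,\psi_x,\psi_t,w_x,w_t,q_x,q_t)$ they become the first-order Cauchy problem $$\begin{cases} v_t-u_x-y-\theta=0,\quad u_t-k_1v_x=0,\quad z_t-y_x=0,\quad y_t-k_2z_x+k_1v+\gamma\eta_x=0,\\ \phi_t-\theta_x=0,\quad \theta_t-k_3\phi_x+k_1v=0,\quad \sigma_t-\eta_x=0,\quad \eta_t-k_4\sigma_x+\mathcal{D}\eta+\gamma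 y_x=0,\end{cases}\qquad U(\cdot,0)=U_0, \tag{P}$$ with $\mathcal{D}\eta=-k_5\eta_{xx}$ for System I and $\mathcal{D}\eta=k_5\eta$ for System II. Let $N,\ell\ge 1$ be integers with $\ell\le N$ and let $j\in\{0,\dots,N-\ell\}$. Then there are constants $c_0,\tilde c_0>0$, depending only on $k_1,\dots,k_5,\gamma,N,\ell,j$, such that for every $U_0\in H^N(\mathbb{R})\cap L^1(\mathbb{R})$ (with values in $\mathbb{C}^8$), the solution $U\in C([0,\infty);L^2(\mathbb{R}))$ of (P) in the sense of distributions satisfies $\partial_x^jU(\cdot,t)\in L^2(\mathbb{R})$ for all $t\ge0$, and, for all $t\ge 0$: System I: $$\|\partial_x^jU\|_{L^2}\le c_0(1+t)^{-1/12-j/6}\|U_0\|_{L^1}+c_0e^{-\tilde c_0t}\|\partial_x^{j+\ell}U_0\|_{L^2}\quad\text{if }k_1=k_2=k_3,$$ $$\|\partial_x^jU\|_{L^2}\le c_0(1+t)^{-1/12-j/6}\|U_0\|_{L^1}+c_0(1+t)^{-\ell/4}\|\partial_x^{j+\ell}U_0\|_{L^2}\quad\text{otherwise};$$ System II: $$\|\partial_x^jU\|_{L^2}\le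 c_0(1+t)^{-1/8-j/4}\|U_0\|_{L^1}+c_0(1+t)^{-\ell/2}\|\partial_x^{j+\ell}U_0\|_{L^2}\quad\text{if }k_1=k_2=k_3,$$ $$\|\partial_x^jU\|_{L^2}\le c_0(1+t)^{-1/8-j/4}\|U_0\|_{L^1}+c_0(1+t)^{-\ell/4}\|\partial_x^{j+\ell}U_0\|_{L^2}\quad\text{otherwise}.$$ -/

import Mathlib

open MeasureTheory Set LineDeriv TemperedDistribution
open scoped SchwartzMap Matrix

noncomputable section

namespace LaminatedBeam

/-- The two laminated Timoshenko systems with type III heat conduction: thermal dissipation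
`- k₅ q_xxt` (`strong`) or `+ k₅ q_t` (`weak`). -/
inductive Dissipation : Type
  | strong : Dissipation
  | weak : Dissipation

/-- The parameter `ε₀`: `1` for the dissipation `- k₅ q_xxt`, `0` for `+ k₅ q_t`. -/
def Dissipation.eps : Dissipation → ℝ
  | .strong => 1
  | .weak => 0

/-- Coefficients of the systems: `k₁, …, k₅ > 0` and `γ ≠ 0`. -/
structure Coeffs where
  k₁ : ℝ
  k₂ : ℝ
  k₃ : ℝ
  k₄ : ℝ
  k₅ : ℝ
  γ : ℝ
  k₁_pos : 0 < k₁
  k₂_pos : 0 < k₂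
  k₃_pos : 0 < k₃
  k₄_pos : 0 < k₄
  k₅_pos : 0 < k₅
  γ_ne : γ ≠ 0

/-- Values of the state `U = (v, u, z, y, φ, θ, σ, η)`, with the Euclidean norm. -/
abbrev State : Type := EuclideanSpace ℂ (Fin 8)

/-- Square integrable states on the real line. -/
abbrev L2State : Type := Lp State 2 (volume : Measure ℝ)

variable (p : Coeffs) (d : Dissipation) (τ : Fin 3 → ℝ)

/-- `A₂ U = (0, 0, 0, 0, 0, 0, 0, - ε₀ k₅ η)`. -/
def A₂ : Matrix (Fin 8) (Fin 8) ℝ :=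
  !![0, 0, 0, 0, 0, 0, 0, 0;
     0, 0, 0, 0, 0, 0, 0, 0;
     0, 0, 0, 0, 0, 0, 0, 0;
     0, 0, 0, 0, 0, 0, 0, 0;
     0, 0, 0, 0, 0, 0, 0, 0;
     0, 0, 0, 0, 0, 0, 0, 0;
     0, 0, 0, 0, 0, 0, 0, 0;
     0, 0, 0, 0, 0, 0, 0, -(d.eps * p.k₅)]

/-- `A₁ U = (-u, -k₁ v + τ₁ γ η, -y, -k₂ z + τ₂ γ η, -θ, -k₃ φ + τ₃ γ η, -η,
-k₄ σ + γ (τ₁ u + τ₂ y + τ₃ θ))`. -/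
def A₁ : Matrix (Fin 8) (Fin 8) ℝ :=
  !![0, -1, 0, 0, 0, 0, 0, 0;
     -p.k₁, 0, 0, 0, 0, 0, 0, τ 0 * p.γ;
     0, 0, 0, -1, 0, 0, 0, 0;
     0, 0, -p.k₂, 0, 0, 0, 0, τ 1 * p.γ;
     0, 0, 0, 0, 0, -1, 0, 0;
     0, 0, 0, 0, -p.k₃, 0, 0, τ 2 * p.γ;
     0, 0, 0, 0, 0, 0, 0, -1;
     0, p.γ * τ 0, 0, p.γ * τ 1, 0, p.γ * τ 2, -p.k₄, 0]

/-- `A₀ U = (-y - θ, 0, 0, k₁ v, 0, k₁ v, 0, (1 - ε₀) k₅ η)`. -/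
def A₀ : Matrix (Fin 8) (Fin 8) ℝ :=
  !![0, 0, 0, -1, 0, -1, 0, 0;
     0, 0, 0, 0, 0, 0, 0, 0;
     0, 0, 0, 0, 0, 0, 0, 0;
     p.k₁, 0, 0, 0, 0, 0, 0, 0;
     0, 0, 0, 0, 0, 0, 0, 0;
     p.k₁, 0, 0, 0, 0, 0, 0, 0;
     0, 0, 0, 0, 0, 0, 0, 0;
     0, 0, 0, 0, 0, 0, 0, (1 - d.eps) * p.k₅]

/-- A real matrix acting on states. -/
def act (A : Matrix (Fin 8) (Fin 8) ℝ) (x : State) : State :=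
  WithLp.toLp 2 ((A.map Complex.ofReal) *ᵥ WithLp.ofLp x)

/-- `U ∈ C([0,∞); L²(ℝ))` solves the Cauchy problem
`U_t + A₂ U_xx + A₁ U_x + A₀ U = 0`, `U(·, 0) = U₀`,
where the `x`-derivatives are those of tempered distributions and the equation is tested with
Schwartz functions of `x`. -/
structure IsSolution (U₀ : L2State) (U : ℝ → L2State) : Prop where
  continuousOn : ContinuousOn U (Ici 0)
  initial : U 0 = U₀
  equation : ∀ f : 𝓢(ℝ, ℂ), ∀ t : ℝ, 0 < t →
    HasDerivAt (fun s => (U s : 𝓢'(ℝ, State)) f)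
      (-(act (A₂ p d) ((∂_{(1 : ℝ)} (∂_{(1 : ℝ)} (U t : 𝓢'(ℝ, State)))) f)
        + act (A₁ p τ) ((∂_{(1 : ℝ)} (U t : 𝓢'(ℝ, State))) f)
        + act (A₀ p d) ((U t : 𝓢'(ℝ, State)) f))) t

/-- `V ∈ L²(ℝ)` is the `j`-th distributional derivative `∂ₓʲ W` of `W ∈ L²(ℝ)`. -/
def IsDeriv (j : ℕ) (W V : L2State) : Prop :=
  (V : 𝓢'(ℝ, State)) = ∂^{fun _ : Fin j => (1 : ℝ)} (W : 𝓢'(ℝ, State))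

/-- `‖∂ₓʲ U(t)‖_{L²} ≤ c₀ a(t) ‖U₀‖_{L¹} + c₀ b(t) ‖∂ₓ^{j+ℓ} U₀‖_{L²}` for all `t ≥ 0`, for every
`U₀ ∈ H^N ∩ L¹` and the solution `U` with initial value `U₀`; in particular both derivatives
exist in `L²`. -/
def DecayEstimate (N ℓ j : ℕ) (c₀ : ℝ) (a b : ℝ → ℝ) : Prop :=
  ∀ U₀ : L2State, MemSobolev (N : ℝ) 2 (U₀ : 𝓢'(ℝ, State)) →
    Integrable (U₀ : ℝ → State) volume →
    ∀ U : ℝ → L2State, IsSolution p d τ U₀ U →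
      ∃ D₀ : L2State, IsDeriv (j + ℓ) U₀ D₀ ∧
        ∀ t : ℝ, 0 ≤ t → ∃ D : L2State, IsDeriv j (U t) D ∧
          ‖D‖ ≤ c₀ * a t * (∫ x, ‖U₀ x‖) + c₀ * b t * ‖D₀‖

end LaminatedBeam

end

/-! On the Fourier side, with `∂ₓ` replaced by `iκ`, the system is a family of linear ODEs in `ℂ⁸`.
A weighted energy is nonincreasing along each of them and is dissipated only through the last
component `η`. The theorem follows from pointwise decay of the flow like `exp (-c ρ(κ) t)`, where
`ρ(κ)` is `|κ| ^ m` for `|κ| ≤ 1` and `|κ| ^ (-n)` for `|κ| > 1`: `(m, n) = (6, 0)` or `(6, 4)` for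
System I, and `(4, 2)` or `(4, 4)` for System II, the first pair being that of equal speeds.

The rate comes from a resolvent bound on the imaginary axis. For `(iω - Â) x = f` with all `|fᵢ| ≤
F`, the coupling passes from `η` to `σ, y, z, v, u, θ, φ` through the equations one after another,
giving `|x| ≤ C (m' |η| + n' F)` with explicit powers `m', n'` of `|κ|`. The energy identity `D |η|²
≤ K F |x|` then removes `η` (`le_of_observability`). Each passage costs powers of `|κ|`. For equal
speeds the resonant factors `ω² - kᵢ κ²` coincide, and a case distinction on their common size saves
one power of `|κ|` in `θ` and, when the damping controls `|κ| |η|`, one more in `v`. The outcome is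
`exists_resolvent_bound`.

A quantitative Gearhart–Prüss argument (`exists_decay_of_resolvent`) turns a resolvent bound `M`
into decay at a rate proportional to `1 / M`, with constants that do not depend on the operator and
hence not on `κ` (`exists_flow_decay`).

An arbitrary distributional solution is identified with this flow by a uniqueness argument on
bounded frequency sets (`fourier_solution`). Plancherel and a splitting at `|κ| = 1` conclude: small
frequencies see only the sup norm of the Fourier transform of the data, bounded by the `L¹` norm,
while large frequencies pay `ℓ` derivatives for decay in time (`decayEstimate_of_flow_decay`). -/

open scoped FourierTransform

noncomputable section

namespace LaminatedBeam

/-! ### Resolvent inequalities in the separate ranges of `(ξ, ω)` -/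

/-- Inequalities between the moduli of the components of a solution of the resolvent equation
`(iω - Â(ξ)) x = f` with `a = |ξ|`, `w = |ω|`, `|f| ≤ F` and thermal damping `D`. -/
structure NormBounds (K a w D F v u z y φ θ σ η : ℝ) : Prop where
  hK : 1 ≤ K
  ha : 0 < a
  hw : 0 ≤ w
  hD : 0 ≤ D
  hF : 0 ≤ F
  hv : 0 ≤ v
  hu : 0 ≤ u
  hz : 0 ≤ z
  hy : 0 ≤ y
  hφ : 0 ≤ φ
  hθ : 0 ≤ θ
  hσ : 0 ≤ σ
  hη : 0 ≤ η
  v_le : w * v ≤ a * u + y + θ + F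
  u_le : a * u ≤ w * v + y + θ + F
  θ_le : θ ≤ w * v + a * u + y + F
  u_le' : w * u ≤ K * (a * v) + F
  v_le' : a * v ≤ K * (w * u + F)
  z_le : w * z ≤ a * y + F
  y_le : a * y ≤ w * z + F
  y_le' : w * y ≤ K * (a * z) + K * v + K * (a * η) + F
  v_le'' : v ≤ K * (w * y + K * (a * z) + K * (a * η) + F)
  z_le' : a * z ≤ K * (w * y + K * v + K * (a * η) + F)
  φ_le : w * φ ≤ a * θ + F
  θ_le' : a * θ ≤ w * φ + F
  θ_le'' : w * θ ≤ K * (a * φ) + K * v + F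
  φ_le' : a * φ ≤ K * (w * θ + K * v + F)
  σ_le : w * σ ≤ a * η + F
  y_le'' : a * y ≤ K * (K * (a * σ) + (w + D) * η + F)
  σ_le' : a * σ ≤ K * (K * (a * y) + (w + D) * η + F)

namespace NormBounds

variable {K a w D F v u z y φ θ σ η : ℝ}

/-- Above the spectrum of the undamped part no propagation is needed. Adding the seven equations
that carry `ω` in front of a component other than `η`, the coupling terms are at most `w / 2` times
the left-hand sum and are absorbed. -/
theorem of_large (h : NormBounds K a w D F v u z y φ θ σ η) (hw : 6 * K * (1 + a) ≤ w) :
    v + u + z + y + φ + θ + σ ≤ η + 3 * F := by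
  obtain ⟨hK, ha, hw0, hD, hF, hv, hu, hz, hy, hφ, hθ, hσ, hη, h1, -, -, h2, -, h3, -, h4, -, -,
    h5, -, h6, -, h7, -, -⟩ := h
  set S := v + u + z + y + φ + θ + σ with hS
  have hS0 : 0 ≤ S := by positivity
  have hKa : 0 ≤ K * a := by positivity
  have e : w * S = w * v + w * u + w * z + w * y + w * φ + w * θ + w * σ := by rw [hS]; ring
  have hKz : 0 ≤ (K - 1) := by linarith
  have b1 : a * u + y + θ + K * (a * v) + a * y + K * (a * z) + K * v + a * θ + K * (a * φ)
      + K * v ≤ 3 * K * (1 + a) * S := by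
    rw [hS]
    nlinarith [mul_nonneg hKa hv, mul_nonneg hKa hu, mul_nonneg hKa hz, mul_nonneg hKa hy,
      mul_nonneg hKa hφ, mul_nonneg hKa hθ, mul_nonneg hKa hσ, mul_nonneg hKz hy,
      mul_nonneg hKz hv, mul_nonneg hKz hθ, mul_nonneg hKz hu, mul_nonneg hKz hz,
      mul_nonneg hKz hσ, mul_nonneg hKz hφ,
      mul_nonneg hKz (mul_nonneg ha.le hu), mul_nonneg hKz (mul_nonneg ha.le hy),
      mul_nonneg hKz (mul_nonneg ha.le hθ)]
  have b2 : K * (a * η) + a * η ≤ 2 * K * (1 + a) * η := by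
    nlinarith [mul_nonneg hKz (mul_nonneg ha.le hη), mul_nonneg hKz hη]
  have b3 : w * S ≤ 3 * K * (1 + a) * S + 2 * K * (1 + a) * η + 7 * F := by
    rw [e]; linarith
  have hw6 : 6 ≤ w := by nlinarith
  have b4 : 6 * K * (1 + a) * S ≤ w * S := mul_le_mul_of_nonneg_right hw hS0
  have b5 : 6 * K * (1 + a) * η ≤ w * η := mul_le_mul_of_nonneg_right hw hη
  have b6 : 6 * F ≤ w * F := mul_le_mul_of_nonneg_right hw6 hF
  have b7 : w * S ≤ w * (η + 3 * F) := by nlinarith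
  exact le_of_mul_le_mul_left b7 (by linarith)

-- For `ω` close to zero the equations are read as elliptic ones, solved for their `ξ`-terms. The
-- `ω`-terms are small perturbations. The parameter `b` serves both ranges of `ξ`: it is used with
-- `b = a` for `a ≤ 1` and with `b = 1` for `a ≥ 1`. The component `σ` is left out because its bound
-- involves the damping `D`.
set_option maxHeartbeats 2000000 in
theorem of_small (h : NormBounds K a w D F v u z y φ θ σ η) {b f : ℝ} (hb : 0 < b) (hba : b ≤ a)
    (hb1 : b ≤ 1) (hf : F = b ^ 2 * f) (hw : w ≤ 1 / (24 * K ^ 3) * b * a) :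
    y + θ + v + u + z + φ ≤ 24 * K ^ 3 * (η + f) := by
  obtain ⟨hK, ha, hw0, hD, hF, hv, hu, hz, hy, hφ, hθ, hσ, hη, -, h1, -, -, h2, -, h3, -, -, h4,
    -, h5, -, h6, -, -, -⟩ := h
  have hf0 : 0 ≤ f := by
    rw [hf] at hF
    exact nonneg_of_mul_nonneg_right hF (by positivity)
  -- The value of `c` makes every feedback coefficient among the six unknowns at most `1 / 24`, even
  -- after three factors `K`. The final sum is then diagonally dominant.
  set c : ℝ := 1 / (24 * K ^ 3) with hc
  have hK0 : 0 < K := by linarith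
  have hc0 : 0 < c := by positivity
  have hcK : c * K ^ 3 = 1 / 24 := by rw [hc]; field_simp
  have hFab : F ≤ a * (b * f) := by
    rw [hf]; nlinarith [mul_le_mul_of_nonneg_right hba (mul_nonneg hb.le hf0)]
  have hwX : ∀ X : ℝ, 0 ≤ X → w * X ≤ a * (b * (c * X)) := fun X hX => by
    calc w * X ≤ c * b * a * X := mul_le_mul_of_nonneg_right hw hX
      _ = _ := by ring
  have hbX : ∀ X : ℝ, 0 ≤ X → b * X ≤ X := fun X hX => by nlinarith
  have hbaX : ∀ X : ℝ, 0 ≤ X → b * X ≤ a * X := fun X hX => mul_le_mul_of_nonneg_right hba hX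
  have yb : y ≤ b * (c * z + f) :=
    le_of_mul_le_mul_left (by linarith [hwX z hz] : a * y ≤ a * (b * (c * z + f))) ha
  have θb : θ ≤ b * (c * φ + f) :=
    le_of_mul_le_mul_left (by linarith [hwX φ hφ] : a * θ ≤ a * (b * (c * φ + f))) ha
  have vb : v ≤ b * (K * (c * u + f)) :=
    le_of_mul_le_mul_left (by nlinarith [hwX u hu] : a * v ≤ a * (b * (K * (c * u + f)))) ha
  have ub : u ≤ c * v + c * z + c * φ + 3 * f := by
    refine le_of_mul_le_mul_left (?_ : a * u ≤ a * (c * v + c * z + c * φ + 3 * f)) ha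
    have := hbaX (c * z + f) (by positivity)
    have := hbaX (c * φ + f) (by positivity)
    have := mul_le_mul_of_nonneg_left (hbX (c * v) (by positivity)) ha.le
    have := mul_le_mul_of_nonneg_left (hbX f hf0) ha.le
    linarith [hwX v hv]
  -- The term `K v` carries no factor `a` in the equations for `z` and `φ`, so dividing those by `a`
  -- is harmless only because `v` is itself of size `b ≤ a`. This is why the range is `w ≤ c b a`
  -- and not merely `w ≤ c a`.
  have vb' : K * v ≤ a * (K ^ 2 * (c * u + f)) := by
    have := hbaX (K * (c * u + f)) (by positivity)
    have := mul_le_mul_of_nonneg_left (vb.trans this) hK0.le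
    linarith
  have zb : z ≤ K * (c * y + K ^ 2 * (c * u + f) + K * η + f) := by
    refine le_of_mul_le_mul_left (?_ : a * z ≤ a * _) ha
    have h8 := mul_le_mul_of_nonneg_left (hbX (c * y) (by positivity)) ha.le
    have h9 := mul_le_mul_of_nonneg_left (hbX f hf0) ha.le
    refine h4.trans ?_
    rw [mul_left_comm a K]
    refine mul_le_mul_of_nonneg_left ?_ hK0.le
    linarith [hwX y hy]
  have φb : φ ≤ K * (c * θ + K ^ 2 * (c * u + f) + f) := by
    refine le_of_mul_le_mul_left (?_ : a * φ ≤ a * _) ha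
    have h8 := mul_le_mul_of_nonneg_left (hbX (c * θ) (by positivity)) ha.le
    have h9 := mul_le_mul_of_nonneg_left (hbX f hf0) ha.le
    refine h6.trans ?_
    rw [mul_left_comm a K]
    refine mul_le_mul_of_nonneg_left ?_ hK0.le
    linarith [hwX θ hθ]
  have yb' := yb.trans (hbX _ (by positivity))
  have θb' := θb.trans (hbX _ (by positivity))
  have vb3 := vb.trans (hbX _ (by positivity))
  have hK2 : K ≤ K ^ 3 := le_self_pow₀ hK (by norm_num)
  have hK3 : K ^ 2 ≤ K ^ 3 := pow_le_pow_right₀ hK (by norm_num)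
  have k1 : ∀ X : ℝ, 0 ≤ X → K * (c * X) ≤ X / 24 := fun X hX => by
    have : c * K ≤ 1 / 24 := by rw [← hcK]; exact mul_le_mul_of_nonneg_left hK2 hc0.le
    nlinarith
  have k0 : ∀ X : ℝ, 0 ≤ X → c * X ≤ X / 24 := fun X hX => by
    have : c * 1 ≤ 1 / 24 := by
      rw [← hcK]; exact mul_le_mul_of_nonneg_left (hK.trans hK2) hc0.le
    nlinarith
  have k3 : K ^ 3 * (c * u) = u / 24 := by rw [← mul_assoc, mul_comm (K ^ 3), hcK]; ring
  have e1 : K * f ≤ K ^ 3 * f := mul_le_mul_of_nonneg_right hK2 hf0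
  have e2 : f ≤ K ^ 3 * f := by nlinarith
  have e3 : K ^ 2 * η ≤ K ^ 3 * η := mul_le_mul_of_nonneg_right hK3 hη
  have zb2 : z ≤ y / 24 + u / 24 + K ^ 3 * f + K ^ 2 * η + K * f := by
    linarith [k1 y hy, k3]
  have φb2 : φ ≤ θ / 24 + u / 24 + K ^ 3 * f + K * f := by linarith [k1 θ hθ, k3]
  have vb4 : v ≤ u / 24 + K * f := by linarith [k1 u hu]
  linarith [k0 z hz, k0 φ hφ, k0 v hv, mul_nonneg (pow_pos hK0 3).le hη]

/-- The coupling chain from `η` is followed in the order `σ, y, z, v, u, θ, φ`, each component being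
read off from one equation. Dividing by `a` or by `w ≥ c a ^ 2` costs powers of `a`, which the scale
`E` is set up to count. The components `z, u, φ` come out of size `E / a`, hence the factor `a` in
the conclusion. -/
theorem of_low_mid (h : NormBounds K a w D F v u z y φ θ σ η) (ha1 : a ≤ 1) (hDK : D ≤ K)
    {c : ℝ} (hc : 0 < c) (hwc : c * a ^ 2 ≤ w) (hw' : w ≤ 12 * K) {E : ℝ}
    (hηE : η ≤ a * E) (hFE : F ≤ a ^ 2 * E) {Cσ Cy Cz Cv Cu Cθ : ℝ}
    (hCσ : Cσ = 2 / c) (hCy : Cy = K * (K * Cσ + 14 * K)) (hCz : Cz = (Cy + 1) / c)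
    (hCv : Cv = K * (12 * K * Cy + K * Cz + 2 * K)) (hCu : Cu = (K * Cv + 1) / c)
    (hCθ : Cθ = 12 * K * Cv + Cu + Cy + 1) :
    a * (v + u + z + y + φ + θ + σ) ≤ (Cv + Cu + Cz + Cy + (Cθ + 1) / c + Cθ + Cσ) * E := by
  obtain ⟨hK, ha, hw0, hD, hF, hv, hu, hz, hy, hφ, hθ, hσ, hη, -, -, t1, u1, -, z1, -, -, v1,
    -, p1, -, -, -, s1, y1, -⟩ := h
  have hE : 0 ≤ E := by
    have := hη.trans hηE
    exact nonneg_of_mul_nonneg_right this ha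
  have hK0 : 0 < K := by linarith
  have ha2 : 0 < a ^ 2 := by positivity
  have ha2' : a ^ 2 ≤ a := by nlinarith
  have hwX : ∀ X, 0 ≤ X → c * (a ^ 2 * X) ≤ w * X := fun X hX => by
    rw [← mul_assoc]; exact mul_le_mul_of_nonneg_right hwc hX
  have hwX' : ∀ X, 0 ≤ X → w * X ≤ 12 * K * X := fun X hX => mul_le_mul_of_nonneg_right hw' hX
  have haX : ∀ X, 0 ≤ X → a * X ≤ X := fun X hX => by nlinarith
  have hFE' : F ≤ a * E := hFE.trans (mul_le_mul_of_nonneg_right ha2' hE)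
  have hFE1 : F ≤ E := hFE'.trans (haX E hE)
  have hηE' : a * η ≤ a ^ 2 * E := by nlinarith
  have hσ1 : σ ≤ Cσ * E := by
    rw [hCσ, div_mul_eq_mul_div, le_div_iff₀ hc]
    refine le_of_mul_le_mul_left (?_ : a ^ 2 * (σ * c) ≤ a ^ 2 * (2 * E)) ha2
    linarith [hwX σ hσ]
  have hCσ0 : 0 ≤ Cσ := by rw [hCσ]; positivity
  have hCy0 : 0 ≤ Cy := by rw [hCy]; positivity
  have hCz0 : 0 ≤ Cz := by rw [hCz]; positivity
  have hCv0 : 0 ≤ Cv := by rw [hCv]; positivity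
  have hCu0 : 0 ≤ Cu := by rw [hCu]; positivity
  have hCθ0 : 0 ≤ Cθ := by rw [hCθ]; positivity
  have hy1 : y ≤ Cy * E := by
    refine le_of_mul_le_mul_left (y1.trans ?_ : a * y ≤ a * _) ha
    rw [hCy, mul_assoc, mul_left_comm a]
    refine mul_le_mul_of_nonneg_left ?_ hK0.le
    have e1 : K * (a * σ) ≤ K * (a * (Cσ * E)) := by gcongr
    have e2 : (w + D) * η ≤ 13 * K * (a * E) :=
      mul_le_mul (by linarith) hηE hη (by positivity)
    have e3 : a * E ≤ K * (a * E) := le_mul_of_one_le_left (by positivity) hK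
    linarith
  have hz1 : a * z ≤ Cz * E := by
    rw [hCz, div_mul_eq_mul_div, le_div_iff₀ hc]
    refine le_of_mul_le_mul_left (?_ : a * (a * z * c) ≤ a * ((Cy + 1) * E)) ha
    have := mul_le_mul_of_nonneg_left hy1 ha.le
    linarith [hwX z hz]
  have hv1 : v ≤ Cv * E := by
    refine v1.trans ?_
    rw [hCv, mul_assoc]
    refine mul_le_mul_of_nonneg_left ?_ hK0.le
    have e1 : w * y ≤ 12 * K * (Cy * E) := mul_le_mul hw' hy1 hy (by positivity)
    have e2 : K * (a * z) ≤ K * (Cz * E) := by gcongr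
    have e3 : K * (a * η) ≤ K * E := by
      refine mul_le_mul_of_nonneg_left ?_ hK0.le
      exact (haX η hη).trans (hηE.trans (haX E hE))
    have e4 : E ≤ K * E := le_mul_of_one_le_left hE hK
    linarith
  have hu1 : a * u ≤ Cu * E := by
    rw [hCu, div_mul_eq_mul_div, le_div_iff₀ hc]
    refine le_of_mul_le_mul_left (?_ : a * (a * u * c) ≤ a * ((K * Cv + 1) * E)) ha
    have : K * (a * v) ≤ K * (a * (Cv * E)) := by gcongr
    linarith [hwX u hu]
  have hθ1 : θ ≤ Cθ * E := by
    have e1 : w * v ≤ 12 * K * (Cv * E) := mul_le_mul hw' hv1 hv (by positivity)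
    rw [hCθ]
    linarith
  have hφ1 : a * φ ≤ (Cθ + 1) / c * E := by
    rw [div_mul_eq_mul_div, le_div_iff₀ hc]
    refine le_of_mul_le_mul_left (?_ : a * (a * φ * c) ≤ a * ((Cθ + 1) * E)) ha
    have := mul_le_mul_of_nonneg_left hθ1 ha.le
    linarith [hwX φ hφ]
  linarith [haX v hv, haX y hy, haX θ hθ, haX σ hσ]

/-- The bounds in the range `c a ≤ w ≤ 12 K a`, `a ≥ 1`. -/
theorem of_high_mid (h : NormBounds K a w D F v u z y φ θ σ η) (ha1 : 1 ≤ a)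
    {c : ℝ} (hc : 0 < c) (hwc : c * a ≤ w) (hw' : w ≤ 12 * K * a) {E : ℝ}
    (hηE : η ≤ E) (hDE : D * η ≤ K * (a * E)) (hFE : F ≤ E) {Cσ Cy Cz Cv Cu Cθ : ℝ}
    (hCσ : Cσ = 2 / c) (hCy : Cy = K * (K * Cσ + 14 * K)) (hCz : Cz = (Cy + 1) / c)
    (hCv : Cv = K * (12 * K * Cy + K * Cz + 2 * K)) (hCu : Cu = (K * Cv + 1) / c)
    (hCθ : Cθ = 12 * K * Cv + Cu + Cy + 1) :
    σ ≤ Cσ * E ∧ y ≤ Cy * E ∧ z ≤ Cz * E ∧ v ≤ Cv * (a * E) ∧ u ≤ (K * v + F) / c ∧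
      φ ≤ (θ + F) / c ∧ θ ≤ Cθ * (a ^ 2 * E) := by
  obtain ⟨hK, ha, hw0, hD, hF, hv, hu, hz, hy, hφ, hθ, hσ, hη, -, -, t1, u1, -, z1, -, -, v1,
    -, p1, -, -, -, s1, y1, -⟩ := h
  have hE : 0 ≤ E := hη.trans hηE
  have hK0 : 0 < K := by linarith
  have hwX : ∀ X, 0 ≤ X → c * (a * X) ≤ w * X := fun X hX => by
    rw [← mul_assoc]; exact mul_le_mul_of_nonneg_right hwc hX
  have haX : ∀ X, 0 ≤ X → X ≤ a * X := fun X hX => le_mul_of_one_le_left hX ha1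
  have hηE' : a * η ≤ a * E := mul_le_mul_of_nonneg_left hηE ha.le
  have hσ1 : σ ≤ Cσ * E := by
    rw [hCσ, div_mul_eq_mul_div, le_div_iff₀ hc]
    refine le_of_mul_le_mul_left (?_ : a * (σ * c) ≤ a * (2 * E)) ha
    linarith [hwX σ hσ, haX E hE]
  have hCσ0 : 0 ≤ Cσ := by rw [hCσ]; positivity
  have hCy0 : 0 ≤ Cy := by rw [hCy]; positivity
  have hCz0 : 0 ≤ Cz := by rw [hCz]; positivity
  have hCv0 : 0 ≤ Cv := by rw [hCv]; positivity
  have hCu0 : 0 ≤ Cu := by rw [hCu]; positivity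
  have e3 : a * E ≤ K * (a * E) := le_mul_of_one_le_left (by positivity) hK
  have hy1 : y ≤ Cy * E := by
    refine le_of_mul_le_mul_left (y1.trans ?_ : a * y ≤ a * _) ha
    rw [hCy, mul_assoc, mul_left_comm a]
    refine mul_le_mul_of_nonneg_left ?_ hK0.le
    have e1 : K * (a * σ) ≤ K * (a * (Cσ * E)) := by gcongr
    have e2 : w * η ≤ 12 * K * a * E := mul_le_mul hw' hηE hη (by positivity)
    linarith [haX E hE]
  have hz1 : z ≤ Cz * E := by
    rw [hCz, div_mul_eq_mul_div, le_div_iff₀ hc]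
    refine le_of_mul_le_mul_left (?_ : a * (z * c) ≤ a * ((Cy + 1) * E)) ha
    have := mul_le_mul_of_nonneg_left hy1 ha.le
    linarith [hwX z hz, haX E hE]
  have hv1 : v ≤ Cv * (a * E) := by
    refine v1.trans ?_
    rw [hCv, mul_assoc]
    refine mul_le_mul_of_nonneg_left ?_ hK0.le
    have e1 : w * y ≤ 12 * K * a * (Cy * E) := mul_le_mul hw' hy1 hy (by positivity)
    have e2 : K * (a * z) ≤ K * (a * (Cz * E)) := by gcongr
    have e4 : K * (a * η) ≤ K * (a * E) := by gcongr
    linarith [haX E hE]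
  have hu1 : u ≤ (K * v + F) / c := by
    rw [le_div_iff₀ hc]
    refine le_of_mul_le_mul_left (?_ : a * (u * c) ≤ a * (K * v + F)) ha
    linarith [hwX u hu, haX F hF]
  have hφ1 : φ ≤ (θ + F) / c := by
    rw [le_div_iff₀ hc]
    refine le_of_mul_le_mul_left (?_ : a * (φ * c) ≤ a * (θ + F)) ha
    linarith [hwX φ hφ, haX F hF]
  have hu2 : u ≤ Cu * (a * E) := by
    refine hu1.trans ?_
    rw [hCu, div_mul_eq_mul_div]
    gcongr
    have : K * v ≤ K * (Cv * (a * E)) := by gcongr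
    linarith [haX E hE]
  have hθ1 : θ ≤ Cθ * (a ^ 2 * E) := by
    have e1 : w * v ≤ 12 * K * a * (Cv * (a * E)) := mul_le_mul hw' hv1 hv (by positivity)
    have e2 : a * u ≤ a * (Cu * (a * E)) := by gcongr
    have e4 : E ≤ a ^ 2 * E := le_mul_of_one_le_left hE (by nlinarith)
    have e5 : Cy * E ≤ Cy * (a ^ 2 * E) := by gcongr
    rw [hCθ]
    linarith
  exact ⟨hσ1, hy1, hz1, hv1, hu1, hφ1, hθ1⟩

set_option maxHeartbeats 1000000 in
/-- Equal speeds of the `(v, u)` and `(φ, θ)` waves: here `Λ = |ω² - k₁ ξ²|`. -/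
theorem θ_le_of_eq (h : NormBounds K a w D F v u z y φ θ σ η) {c Λ : ℝ} (hc : 0 < c)
    (hc1 : c ≤ 1) (hwc : c * a ≤ w) (hw' : w ≤ 12 * K * a)
    (h1 : Λ * θ ≤ K * (w * v) + (w + K * a) * F)
    (h3 : w * θ ≤ Λ * v + w * y + (w + a) * F) :
    θ ≤ 13 * K ^ 2 / c * (v + y + F) := by
  obtain ⟨hK, ha, hw0, hD, hF, hv, hu, hz, hy, hφ, hθ, hσ, hη⟩ := h
  have hK0 : 0 < K := by linarith
  have hK2 : K ≤ K ^ 2 := by nlinarith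
  have e1 : w * v ≤ 12 * K * a * v := mul_le_mul_of_nonneg_right hw' hv
  have e2 : w * F ≤ 12 * K * a * F := mul_le_mul_of_nonneg_right hw' hF
  have e3 : w * y ≤ 12 * K * a * y := mul_le_mul_of_nonneg_right hw' hy
  have f1 : ∀ X, 0 ≤ X → K * X ≤ K ^ 2 * X := fun X hX => mul_le_mul_of_nonneg_right hK2 hX
  have f2 : ∀ X, 0 ≤ X → X ≤ K * X := fun X hX => le_mul_of_one_le_left hX hK
  have haF : 0 ≤ a * F := by positivity
  have hay : 0 ≤ a * y := by positivity
  have hav : 0 ≤ a * v := by positivity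
  rw [div_mul_eq_mul_div, le_div_iff₀ hc]
  refine le_of_mul_le_mul_left (?_ : a * (θ * c) ≤ a * (13 * K ^ 2 * (v + y + F))) ha
  -- Away from resonance `θ` is a forced oscillation and `Λ θ` bounds it by `v`. Near resonance `Λ
  -- v` is small, and the equation for `v` bounds `θ` by `v` and `y`.
  rcases le_total a Λ with hΛ | hΛ
  · have e4 : a * θ ≤ Λ * θ := mul_le_mul_of_nonneg_right hΛ hθ
    have e5 : a * θ * c ≤ a * θ := mul_le_of_le_one_right (by positivity) hc1
    have e6 : K * (w * v) ≤ K * (12 * K * a * v) := by gcongr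
    linarith [f1 _ haF, f1 _ hay, f2 _ hay, f1 _ hav, f2 _ hav]
  · have e4 : Λ * v ≤ a * v := mul_le_mul_of_nonneg_right hΛ hv
    have e5 : c * a * θ ≤ w * θ := mul_le_mul_of_nonneg_right hwc hθ
    linarith [f1 _ haF, f2 _ haF, f1 _ hay, f2 _ hay, f1 _ hav, f2 _ hav]

set_option maxHeartbeats 1000000 in
/-- Equal speeds of all three waves: here `Λ = |ω² - k₁ ξ²|`. -/
theorem v_le_of_eq (h : NormBounds K a w D F v u z y φ θ σ η) {c Λ E Cy : ℝ} (hc : 0 < c)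
    (hc1 : c ≤ 1) (hwc : c * a ≤ w) (hw' : w ≤ 12 * K * a) (hCy : 1 ≤ Cy)
    (hηE : a * η ≤ E) (hFE : F ≤ E) (hyE : y ≤ Cy * E)
    (h1 : Λ * θ ≤ K * (w * v) + (w + K * a) * F)
    (h2 : Λ * v ≤ w * (y + θ) + (w + a) * F)
    (h4 : w * v ≤ K * (Λ * y + K * (a * (w * η)) + (w + K * a) * F)) :
    v ≤ 100 * K ^ 3 * Cy / c * E := by
  obtain ⟨hK, ha, hw0, hF, hv, hy, hη⟩ : 1 ≤ K ∧ 0 < a ∧ 0 ≤ w ∧ 0 ≤ F ∧ 0 ≤ v ∧ 0 ≤ y ∧ 0 ≤ η :=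
    ⟨h.hK, h.ha, h.hw, h.hF, h.hv, h.hy, h.hη⟩
  clear h
  have hK0 : 0 < K := by linarith
  have hE : 0 ≤ E := hF.trans hFE
  have hK12 : K ≤ K ^ 2 := by nlinarith
  have hK23 : K ^ 2 ≤ K ^ 3 := by nlinarith [sq_nonneg K]
  have hCE : 0 ≤ Cy * E := by positivity
  have hCE1 : E ≤ Cy * E := le_mul_of_one_le_left hE hCy
  have f1 : ∀ X, 0 ≤ X → K * X ≤ K ^ 2 * X := fun X hX => mul_le_mul_of_nonneg_right hK12 hX
  have f2 : ∀ X, 0 ≤ X → K ^ 2 * X ≤ K ^ 3 * X := fun X hX => mul_le_mul_of_nonneg_right hK23 hX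
  -- Near resonance the equation for `y` bounds `v` by `y` and `a η`. Away from it the inequalities
  -- for `θ` and `v` are inserted into each other, and the returning term `K w ^ 2 v` is absorbed by
  -- half of `Λ ^ 2 v`. The threshold works since `17 ^ 2 = 289` exceeds `2 * 12 ^ 2 = 288`.
  rcases le_total Λ (17 * K ^ 2 * a) with hΛ | hΛ
  · rw [div_mul_eq_mul_div, le_div_iff₀ hc]
    refine le_of_mul_le_mul_left (?_ : a * (v * c) ≤ a * (100 * K ^ 3 * Cy * E)) ha
    have e1 : c * a * v ≤ w * v := mul_le_mul_of_nonneg_right hwc hv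
    have e2 : Λ * y ≤ 17 * K ^ 2 * a * (Cy * E) :=
      (mul_le_mul_of_nonneg_right hΛ hy).trans (by gcongr)
    have e3 : w * (a * η) ≤ 12 * K * a * (Cy * E) :=
      mul_le_mul hw' (hηE.trans hCE1) (by positivity) (by positivity)
    have e4 : (w + K * a) * F ≤ 13 * K * a * (Cy * E) :=
      mul_le_mul (by linarith) (hFE.trans hCE1) hF (by positivity)
    have e5 : K * (Λ * y + K * (a * (w * η)) + (w + K * a) * F) ≤
        K * (17 * K ^ 2 * a * (Cy * E) + K * (12 * K * a * (Cy * E)) +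
          13 * K * a * (Cy * E)) := by
      refine mul_le_mul_of_nonneg_left ?_ hK0.le
      have := mul_le_mul_of_nonneg_left e3 hK0.le
      linarith
    have haC : 0 ≤ a * (Cy * E) := by positivity
    have haC3 : 0 ≤ K ^ 3 * (a * (Cy * E)) := by positivity
    linarith [f2 _ haC]
  · have hΛ0 : 0 < Λ := lt_of_lt_of_le (by positivity) hΛ
    have hwΛ : w ≤ Λ := by nlinarith [mul_nonneg ha.le (sub_nonneg.2 hK12)]
    have haF : 0 ≤ a * F := by positivity
    have hKaF : a * F ≤ K * (a * F) := le_mul_of_one_le_left haF hK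
    have g1 : Λ * θ ≤ K * (w * v) + 13 * (K * (a * F)) := by
      have := mul_le_mul_of_nonneg_right hw' hF
      linarith
    have g2 : Λ * v ≤ w * y + w * θ + 13 * (K * (a * F)) := by
      have := mul_le_mul_of_nonneg_right hw' hF
      linarith
    have g3 : Λ * (Λ * v) ≤ Λ * (w * y + 26 * (K * (a * F))) + K * w ^ 2 * v := by
      have e1 := mul_le_mul_of_nonneg_left g2 hΛ0.le
      have e2 := mul_le_mul_of_nonneg_left g1 hw0
      have e3 := mul_le_mul_of_nonneg_right hwΛ (by positivity : 0 ≤ K * (a * F))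
      linarith
    have g4 : 2 * (K * w ^ 2 * v) ≤ Λ * (Λ * v) := by
      have e1 : w ^ 2 ≤ (12 * K * a) ^ 2 := pow_le_pow_left₀ hw0 hw' 2
      have e2 : (17 * K ^ 2 * a) ^ 2 ≤ Λ ^ 2 := pow_le_pow_left₀ (by positivity) hΛ 2
      have e3 : K ^ 3 * a ^ 2 ≤ K ^ 4 * a ^ 2 := by
        gcongr ?_ * _
        exact pow_le_pow_right₀ hK (by norm_num)
      have e4 : 2 * (K * w ^ 2) ≤ Λ ^ 2 := by
        have := mul_le_mul_of_nonneg_left e1 hK0.le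
        have : 0 ≤ K ^ 4 * a ^ 2 := by positivity
        linarith
      have := mul_le_mul_of_nonneg_right e4 hv
      linarith
    have g5 : v * Λ ≤ (24 * K * y + 52 * K * F) * Λ := by
      have e1 : Λ * v ≤ 2 * (w * y + 26 * (K * (a * F))) :=
        le_of_mul_le_mul_left (by linarith : Λ * (Λ * v) ≤ Λ * _) hΛ0
      have e2 : w * y ≤ 12 * K * a * y := mul_le_mul_of_nonneg_right hw' hy
      have e3 : a ≤ Λ := by nlinarith [mul_nonneg ha.le (sub_nonneg.2 hK12)]
      have e4 : a * (24 * K * y + 52 * K * F) ≤ Λ * (24 * K * y + 52 * K * F) := by gcongr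
      linarith
    have g6 : v ≤ 24 * K * y + 52 * K * F := le_of_mul_le_mul_right g5 hΛ0
    rw [div_mul_eq_mul_div, le_div_iff₀ hc]
    have g7 : v * c ≤ v := mul_le_of_le_one_right hv hc1
    have g8 : K * y ≤ K * (Cy * E) := by gcongr
    have g9 : K * F ≤ K * (Cy * E) := by gcongr; exact hFE.trans hCE1
    linarith [f1 _ hCE, f2 _ hCE, mul_nonneg (pow_pos hK0 3).le hCE]

end NormBounds

/-! ### Observability of the whole state from `η` and `F` -/

/-- Combining an observability bound `X ≤ C (m η + n F)` with the energy identity. -/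
theorem le_of_observability {C K R D X F m n η : ℝ} (hC : 1 ≤ C) (hK : 0 < K) (hR : 0 < R)
    (hX : 0 ≤ X) (hF : 0 ≤ F) (hn : 0 ≤ n) (h : X ≤ C * (m * η + n * F))
    (hD : D * η ^ 2 ≤ K * (F * X)) (hm : K * m ^ 2 ≤ R * D) (hnR : n ≤ R) :
    X ≤ 4 * C ^ 2 * (R * F) := by
  have h1 : X ^ 2 ≤ 2 * C ^ 2 * ((m * η) ^ 2 + (n * F) ^ 2) := by
    have := pow_le_pow_left₀ hX h 2
    have h0 : (C * (m * η + n * F)) ^ 2 ≤ 2 * C ^ 2 * ((m * η) ^ 2 + (n * F) ^ 2) := by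
      have e := mul_nonneg (sq_nonneg C) (sq_nonneg (m * η - n * F))
      linarith
    exact this.trans h0
  -- The condition `K m ^ 2 ≤ R D` is exactly what lets the dissipated energy pay for `(m η) ^ 2`.
  have h2 : (m * η) ^ 2 ≤ R * F * X := by
    refine le_of_mul_le_mul_left (?_ : K * (m * η) ^ 2 ≤ K * (R * F * X)) hK
    have e1 := mul_le_mul_of_nonneg_right hm (sq_nonneg η)
    have e2 := mul_le_mul_of_nonneg_left hD hR.le
    linarith
  have h3 : (n * F) ^ 2 ≤ (R * F) ^ 2 :=
    pow_le_pow_left₀ (by positivity) (mul_le_mul_of_nonneg_right hnR hF) 2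
  have hRF : 0 ≤ R * F := by positivity
  have hC2 : 1 ≤ C ^ 2 := one_le_pow₀ hC
  -- The bounds combine to `X ^ 2 ≤ 2 C ^ 2 (R F X + (R F) ^ 2)`. If `X` exceeded `4 C ^ 2 R F`,
  -- then also `R F ≤ X`, and the right side would be smaller than `X ^ 2`.
  by_contra! hlt
  have hX0 : 0 < X := lt_of_le_of_lt (by positivity) hlt
  have h4 : X ^ 2 ≤ 2 * C ^ 2 * (R * F * X + (R * F) ^ 2) :=
    h1.trans (mul_le_mul_of_nonneg_left (add_le_add h2 h3) (by positivity))
  have h5 : 4 * C ^ 2 * (R * F) * X < X ^ 2 := by nlinarith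
  have h6 : R * F ≤ X := by nlinarith
  have h7 : C ^ 2 * (R * F) * (R * F) ≤ C ^ 2 * (R * F) * X :=
    mul_le_mul_of_nonneg_left h6 (by positivity)
  linarith

namespace NormBounds

/-- The three ranges of `w` are joined for `a ≤ 1`. The losses `1 / a ^ 2` and `1 / a ^ 3` come from
the middle range and determine the low-frequency rate. -/
theorem exists_low (K : ℝ) (hK : 1 ≤ K) : ∃ C : ℝ, 1 ≤ C ∧ ∀ a w D F v u z y φ θ σ η : ℝ,
    NormBounds K a w D F v u z y φ θ σ η → a ≤ 1 → D ≤ K →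
      v + u + z + y + φ + θ + σ + η ≤ C * (1 / a ^ 2 * η + 1 / a ^ 3 * F) := by
  have hK0 : 0 < K := by linarith
  obtain ⟨c, hc⟩ : ∃ c, c = 1 / (24 * K ^ 3) := ⟨_, rfl⟩
  have hc0 : 0 < c := by rw [hc]; positivity
  obtain ⟨Cσ, hCσ⟩ : ∃ x, x = 2 / c := ⟨_, rfl⟩
  obtain ⟨Cy, hCy⟩ : ∃ x, x = K * (K * Cσ + 14 * K) := ⟨_, rfl⟩
  obtain ⟨Cz, hCz⟩ : ∃ x, x = (Cy + 1) / c := ⟨_, rfl⟩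
  obtain ⟨Cv, hCv⟩ : ∃ x, x = K * (12 * K * Cy + K * Cz + 2 * K) := ⟨_, rfl⟩
  obtain ⟨Cu, hCu⟩ : ∃ x, x = (K * Cv + 1) / c := ⟨_, rfl⟩
  obtain ⟨Cθ, hCθ⟩ : ∃ x, x = 12 * K * Cv + Cu + Cy + 1 := ⟨_, rfl⟩
  obtain ⟨C1, hC1⟩ : ∃ x, x = Cv + Cu + Cz + Cy + (Cθ + 1) / c + Cθ + Cσ := ⟨_, rfl⟩
  have hCσ0 : 0 ≤ Cσ := by rw [hCσ]; positivity
  have hCy0 : 0 ≤ Cy := by rw [hCy]; positivity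
  have hCz0 : 0 ≤ Cz := by rw [hCz]; positivity
  have hCv0 : 0 ≤ Cv := by rw [hCv]; positivity
  have hCu0 : 0 ≤ Cu := by rw [hCu]; positivity
  have hCθ0 : 0 ≤ Cθ := by rw [hCθ]; positivity
  have hC10 : 0 ≤ C1 := by rw [hC1]; positivity
  refine ⟨C1 + (24 * K ^ 3 + K ^ 2 * (24 * K ^ 3) + 15 * K ^ 2) + 5,
    by linarith [show (0 : ℝ) ≤ 24 * K ^ 3 + K ^ 2 * (24 * K ^ 3) + 15 * K ^ 2 by positivity],
    fun a w D F v u z y φ θ σ η h ha1 hD => ?_⟩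
  obtain ⟨ha, hF, hη, hy⟩ : 0 < a ∧ 0 ≤ F ∧ 0 ≤ η ∧ 0 ≤ y := ⟨h.ha, h.hF, h.hη, h.hy⟩
  -- This is the smallest natural scale with both `η ≤ a E` and `F ≤ a ^ 2 E`, as the middle range
  -- requires.
  obtain ⟨E, hE⟩ : ∃ E, E = 1 / a * η + 1 / a ^ 2 * F := ⟨_, rfl⟩
  have hE0 : 0 ≤ E := by rw [hE]; positivity
  have hηE : η ≤ a * E := by
    have : a * E = η + 1 / a * F := by rw [hE]; field_simp
    rw [this]
    have : 0 ≤ 1 / a * F := by positivity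
    linarith
  have hFE : F ≤ a ^ 2 * E := by
    have : a ^ 2 * E = a * η + F := by rw [hE]; field_simp
    rw [this]
    have : 0 ≤ a * η := by positivity
    linarith
  have ha2' : a ^ 2 ≤ a := by nlinarith
  have haX : ∀ X, 0 ≤ X → a * X ≤ X := fun X hX => by nlinarith
  have hFE' : F ≤ a * E := hFE.trans (mul_le_mul_of_nonneg_right ha2' hE0)
  have hFE1 : F ≤ E := hFE'.trans (haX E hE0)
  have hηE1 : η ≤ E := hηE.trans (haX E hE0)
  set S := v + u + z + y + φ + θ + σ with hS
  have key : a * S ≤ (C1 + (24 * K ^ 3 + K ^ 2 * (24 * K ^ 3) + 15 * K ^ 2) + 4) * E := by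
    have p1 : 0 ≤ C1 * E := by positivity
    have p2 : 0 ≤ (24 * K ^ 3 + K ^ 2 * (24 * K ^ 3) + 15 * K ^ 2) * E := by positivity
    rcases le_total (6 * K * (1 + a)) w with hw | hw
    · have := mul_le_mul_of_nonneg_left (h.of_large hw) ha.le
      linarith [haX η hη, mul_le_mul_of_nonneg_left hFE1 ha.le, haX E hE0]
    have hw12 : w ≤ 12 * K := by nlinarith
    rcases le_total w (c * a * a) with hw' | hw'
    · have hf : F = a ^ 2 * (1 / a ^ 2 * F) := by field_simp
      have h1 := h.of_small ha le_rfl ha1 hf (by rw [← hc]; exact hw')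
      obtain ⟨hv, hu, hz, hφ, hθ, hσ⟩ : 0 ≤ v ∧ 0 ≤ u ∧ 0 ≤ z ∧ 0 ≤ φ ∧ 0 ≤ θ ∧ 0 ≤ σ :=
        ⟨h.hv, h.hu, h.hz, h.hφ, h.hθ, h.hσ⟩
      have h2 : η + 1 / a ^ 2 * F ≤ E := by
        rw [hE]
        have : 1 * η ≤ 1 / a * η := mul_le_mul_of_nonneg_right ((one_le_div ha).2 ha1) hη
        linarith
      have h3 : y + θ + v + u + z + φ ≤ 24 * K ^ 3 * E :=
        h1.trans (mul_le_mul_of_nonneg_left h2 (by positivity))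
      have h4 : a * σ ≤ K ^ 2 * (24 * K ^ 3 * E) + 15 * K ^ 2 * E := by
        have e1 : (w + D) * η ≤ 13 * K * (a * E) :=
          mul_le_mul (by linarith) hηE hη (by positivity)
        have e2 : a * y ≤ 24 * K ^ 3 * E := (haX y hy).trans (by linarith)
        have e3 : F ≤ K * E := hFE1.trans (le_mul_of_one_le_left hE0 hK)
        have e4 : K * (a * E) ≤ K * E := mul_le_mul_of_nonneg_left (haX E hE0) hK0.le
        have e5 : K * (K * (a * y) + (w + D) * η + F) ≤
            K * (K * (24 * K ^ 3 * E) + 13 * (K * E) + K * E) := by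
          refine mul_le_mul_of_nonneg_left ?_ hK0.le
          have := mul_le_mul_of_nonneg_left e2 hK0.le
          linarith
        have p3 : 0 ≤ K ^ 2 * E := by positivity
        linarith [h.σ_le']
      have h5 : a * (v + u + z + y + φ + θ) ≤ v + u + z + y + φ + θ := haX _ (by positivity)
      have : a * S = a * (v + u + z + y + φ + θ) + a * σ := by rw [hS]; ring
      linarith
    · have := h.of_low_mid ha1 hD hc0 (by linarith) hw12 hηE hFE hCσ hCy hCz hCv hCu hCθ
      rw [← hC1] at this
      linarith
  have key2 : a * (S + η) ≤ (C1 + (24 * K ^ 3 + K ^ 2 * (24 * K ^ 3) + 15 * K ^ 2) + 5) * E := by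
    linarith [haX η hη]
  refine le_of_mul_le_mul_left (key2.trans (le_of_eq ?_)) ha
  rw [hE]
  field_simp

/-- For `a ≥ 1` the conclusions are nested by how much resonance information is supplied. Without
any, the chain loses `a ^ 2`. The first two inequalities in `Λ`, available for equal speeds, improve
`θ` and leave a loss `a`. The last two, together with control of `a η`, improve `v` as well and
leave no loss. The scale `E` stays free because the two dampings call for different choices. -/
theorem exists_high (K : ℝ) (hK : 1 ≤ K) : ∃ C : ℝ, 1 ≤ C ∧
    ∀ a w D F v u z y φ θ σ η E : ℝ, NormBounds K a w D F v u z y φ θ σ η → 1 ≤ a →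
      η ≤ E → D * η ≤ K * (a * E) → F ≤ E →
      v + u + z + y + φ + θ + σ + η ≤ C * (a ^ 2 * E) ∧
      ∀ Λ : ℝ, Λ * θ ≤ K * (w * v) + (w + K * a) * F → w * θ ≤ Λ * v + w * y + (w + a) * F →
        v + u + z + y + φ + θ + σ + η ≤ C * (a * E) ∧
        (Λ * v ≤ w * (y + θ) + (w + a) * F →
          w * v ≤ K * (Λ * y + K * (a * (w * η)) + (w + K * a) * F) → a * η ≤ E →
          v + u + z + y + φ + θ + σ + η ≤ C * E) := by
  have hK0 : 0 < K := by linarith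
  obtain ⟨c, hc⟩ : ∃ c, c = 1 / (24 * K ^ 3) := ⟨_, rfl⟩
  have hc0 : 0 < c := by rw [hc]; positivity
  have hc1 : c ≤ 1 := by
    rw [hc, div_le_one (by positivity)]
    linarith [one_le_pow₀ (n := 3) hK]
  obtain ⟨Cσ, hCσ⟩ : ∃ x, x = 2 / c := ⟨_, rfl⟩
  obtain ⟨Cy, hCy⟩ : ∃ x, x = K * (K * Cσ + 14 * K) := ⟨_, rfl⟩
  obtain ⟨Cz, hCz⟩ : ∃ x, x = (Cy + 1) / c := ⟨_, rfl⟩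
  obtain ⟨Cv, hCv⟩ : ∃ x, x = K * (12 * K * Cy + K * Cz + 2 * K) := ⟨_, rfl⟩
  obtain ⟨Cu, hCu⟩ : ∃ x, x = (K * Cv + 1) / c := ⟨_, rfl⟩
  obtain ⟨Cθ, hCθ⟩ : ∃ x, x = 12 * K * Cv + Cu + Cy + 1 := ⟨_, rfl⟩
  obtain ⟨Ct, hCt⟩ : ∃ x, x = 13 * K ^ 2 / c := ⟨_, rfl⟩
  obtain ⟨Cv', hCv'⟩ : ∃ x, x = 100 * K ^ 3 * Cy / c := ⟨_, rfl⟩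
  have hCσ0 : 0 ≤ Cσ := by rw [hCσ]; positivity
  have hCy0 : 0 ≤ Cy := by rw [hCy]; positivity
  have hCy1 : 1 ≤ Cy := by rw [hCy]; nlinarith [mul_nonneg (mul_nonneg hK0.le hK0.le) hCσ0]
  have hCz0 : 0 ≤ Cz := by rw [hCz]; positivity
  have hCv0 : 0 ≤ Cv := by rw [hCv]; positivity
  have hCu0 : 0 ≤ Cu := by rw [hCu]; positivity
  have hCθ0 : 0 ≤ Cθ := by rw [hCθ]; positivity
  have hCt0 : 0 ≤ Ct := by rw [hCt]; positivity
  have hCv'0 : 0 ≤ Cv' := by rw [hCv']; positivity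
  -- `V` and `Q` dominate the constants for `v` and `θ` in all three conclusions at once, so that a
  -- single `C` suffices.
  obtain ⟨V, hV⟩ : ∃ V, V = Cv + Cv' := ⟨_, rfl⟩
  have hV0 : 0 ≤ V := by rw [hV]; positivity
  obtain ⟨Q, hQ⟩ : ∃ Q, Q = Cθ + Ct * (V + Cy + 1) := ⟨_, rfl⟩
  have hQ0 : 0 ≤ Q := by rw [hQ]; positivity
  obtain ⟨C1, hC1⟩ : ∃ x, x = V + (K * V + 1) / c + Cz + Cy + (Q + 1) / c + Q + Cσ := ⟨_, rfl⟩
  have hC10 : 0 ≤ C1 := by rw [hC1]; positivity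
  obtain ⟨C2, hC2⟩ : ∃ x, x = 24 * K ^ 3 * 2 + K * (K * (24 * K ^ 3 * 2) + K + 2) := ⟨_, rfl⟩
  have hC20 : 0 ≤ C2 := by rw [hC2]; positivity
  refine ⟨C1 + C2 + 5, by linarith, fun a w D F v u z y φ θ σ η E h ha1 hηE hDE hFE => ?_⟩
  obtain ⟨hw0, ha, hF, hη, hy⟩ : 0 ≤ w ∧ 0 < a ∧ 0 ≤ F ∧ 0 ≤ η ∧ 0 ≤ y :=
    ⟨h.hw, h.ha, h.hF, h.hη, h.hy⟩
  obtain ⟨hv, hu, hz, hφ, hθ, hσ⟩ : 0 ≤ v ∧ 0 ≤ u ∧ 0 ≤ z ∧ 0 ≤ φ ∧ 0 ≤ θ ∧ 0 ≤ σ :=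
    ⟨h.hv, h.hu, h.hz, h.hφ, h.hθ, h.hσ⟩
  have hE0 : 0 ≤ E := hη.trans hηE
  have haX : ∀ X, 0 ≤ X → X ≤ a * X := fun X hX => le_mul_of_one_le_left hX ha1
  set S := v + u + z + y + φ + θ + σ with hS
  have aux : S + η ≤ (C1 + C2 + 5) * E → S + η ≤ (C1 + C2 + 5) * (a ^ 2 * E) ∧
      S + η ≤ (C1 + C2 + 5) * (a * E) := fun H => by
    have h1 : E ≤ a * E := haX E hE0
    have h2 : a * E ≤ a ^ 2 * E := by have := haX _ (mul_nonneg ha.le hE0); linarith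
    exact ⟨H.trans (mul_le_mul_of_nonneg_left (h1.trans h2) (by linarith)),
      H.trans (mul_le_mul_of_nonneg_left h1 (by linarith))⟩
  have p1 : 0 ≤ C1 * E := by positivity
  have p2 : 0 ≤ C2 * E := by positivity
  rcases le_total (6 * K * (1 + a)) w with hw | hw
  · have H : S + η ≤ (C1 + C2 + 5) * E := by linarith [h.of_large hw]
    exact ⟨(aux H).1, fun _ _ _ => ⟨(aux H).2, fun _ _ _ => H⟩⟩
  have hw12 : w ≤ 12 * K * a := by nlinarith
  rcases le_total w (c * a) with hw' | hw'
  · have h1 := h.of_small (b := 1) (f := F) one_pos ha1 le_rfl (by ring)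
      (by rw [← hc]; linarith)
    have h3 : y + θ + v + u + z + φ ≤ 24 * K ^ 3 * 2 * E := by
      refine h1.trans ?_
      rw [mul_assoc (24 * K ^ 3)]
      exact mul_le_mul_of_nonneg_left (by linarith) (by positivity)
    have h4 : σ ≤ K * (K * (24 * K ^ 3 * 2) + K + 2) * E := by
      refine le_of_mul_le_mul_left (h.σ_le'.trans ?_ : a * σ ≤ a * _) ha
      rw [mul_assoc K, mul_left_comm a]
      refine mul_le_mul_of_nonneg_left ?_ hK0.le
      have e1 : K * (a * y) ≤ K * (a * (24 * K ^ 3 * 2 * E)) := by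
        gcongr; linarith
      have e2 : w * η ≤ a * E :=
        mul_le_mul (hw'.trans (mul_le_of_le_one_left ha.le hc1)) hηE hη ha.le
      linarith [haX E hE0]
    have H : S + η ≤ (C1 + C2 + 5) * E := by rw [hC2] at p2 ⊢; linarith
    exact ⟨(aux H).1, fun _ _ _ => ⟨(aux H).2, fun _ _ _ => H⟩⟩
  · obtain ⟨bσ, b_y, bz, bv, bu, bφ, bθ⟩ :=
      h.of_high_mid ha1 hc0 hw' hw12 hηE hDE hFE hCσ hCy hCz hCv hCu hCθ
    -- Only `v` and `θ` distinguish the three conclusions: `u` follows `v`, `φ` follows `θ`, and the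
    -- remaining components are of size `E`. This is used with `G` equal to `a ^ 2 * E`, `a * E` and
    -- `E`.
    have fin : ∀ G, E ≤ G → v ≤ V * G → θ ≤ Q * G → S + η ≤ (C1 + C2 + 5) * G := by
      intro G hG hvG hθG
      have hG0 : 0 ≤ G := hE0.trans hG
      have hu' : u ≤ (K * V + 1) / c * G := by
        refine bu.trans ?_
        rw [div_mul_eq_mul_div]
        gcongr
        have : K * v ≤ K * (V * G) := by gcongr
        linarith
      have hφ' : φ ≤ (Q + 1) / c * G := by
        refine bφ.trans ?_
        rw [div_mul_eq_mul_div]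
        gcongr
        linarith
      have e1 := mul_le_mul_of_nonneg_left hG hCσ0
      have e2 := mul_le_mul_of_nonneg_left hG hCy0
      have e3 := mul_le_mul_of_nonneg_left hG hCz0
      have : S ≤ C1 * G := by rw [hC1]; linarith
      have : 0 ≤ C2 * G := by positivity
      linarith
    have haE : E ≤ a * E := haX E hE0
    have haE2 : a * E ≤ a ^ 2 * E := by have := haX _ (mul_nonneg ha.le hE0); linarith
    have vV : ∀ G, 0 ≤ G → Cv * G ≤ V * G := fun G hG => by
      gcongr; rw [hV]; linarith
    have haE0 : 0 ≤ a * E := by positivity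
    have htQ : ∀ G, E ≤ G → v ≤ V * G → θ ≤ Ct * (v + y + F) → θ ≤ Q * G := by
      intro G hG hvG H
      have hG0 : 0 ≤ G := hE0.trans hG
      have e2 := mul_le_mul_of_nonneg_left hG hCy0
      have e3 : Ct * (v + y + F) ≤ Ct * ((V + Cy + 1) * G) := by gcongr; linarith
      have : 0 ≤ Cθ * G := by positivity
      rw [hQ]; linarith
    refine ⟨fin _ (haE.trans haE2) ?_ ?_, fun Λ g1 g3 => ?_⟩
    · exact (bv.trans (vV _ haE0)).trans (by gcongr)
    · refine bθ.trans ?_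
      gcongr
      rw [hQ]
      have : 0 ≤ Ct * (V + Cy + 1) := by positivity
      linarith
    have ht := h.θ_le_of_eq hc0 hc1 hw' hw12 g1 g3
    rw [← hCt] at ht
    refine ⟨fin _ haE (bv.trans (vV _ haE0)) (htQ _ haE (bv.trans (vV _ haE0)) ht),
      fun g2 g4 haη => ?_⟩
    have hv2 := h.v_le_of_eq hc0 hc1 hw' hw12 hCy1 haη hFE b_y g1 g2 g4
    rw [← hCv'] at hv2
    have hv3 : v ≤ V * E := hv2.trans (by gcongr; rw [hV]; linarith)
    exact fin _ le_rfl hv3 (htQ _ le_rfl hv3 ht)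

end NormBounds

/-! ### The resolvent equation, its energy identity and its resonances -/

/-- A number that dominates all coefficients and their inverses. -/
def Coeffs.bound (p : Coeffs) : ℝ :=
  1 + (p.k₁ + 1 / p.k₁) + (p.k₂ + 1 / p.k₂) + (p.k₃ + 1 / p.k₃) + (p.k₄ + 1 / p.k₄)
    + (p.k₅ + 1 / p.k₅) + (|p.γ| + 1 / |p.γ|)

theorem Coeffs.bound_spec (p : Coeffs) : 1 ≤ p.bound ∧ (p.k₁ ≤ p.bound ∧ 1 / p.k₁ ≤ p.bound) ∧
    (p.k₂ ≤ p.bound ∧ 1 / p.k₂ ≤ p.bound) ∧ (p.k₃ ≤ p.bound ∧ 1 / p.k₃ ≤ p.bound) ∧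
    (p.k₄ ≤ p.bound ∧ 1 / p.k₄ ≤ p.bound) ∧ (p.k₅ ≤ p.bound ∧ 1 / p.k₅ ≤ p.bound) ∧
    (|p.γ| ≤ p.bound ∧ 1 / |p.γ| ≤ p.bound) := by
  have h1 := p.k₁_pos
  have h2 := p.k₂_pos
  have h3 := p.k₃_pos
  have h4 := p.k₄_pos
  have h5 := p.k₅_pos
  have h6 : 0 < |p.γ| := abs_pos.2 p.γ_ne
  have g1 : 0 < 1 / p.k₁ := by positivity
  have g2 : 0 < 1 / p.k₂ := by positivity
  have g3 : 0 < 1 / p.k₃ := by positivity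
  have g4 : 0 < 1 / p.k₄ := by positivity
  have g5 : 0 < 1 / p.k₅ := by positivity
  have g6 : 0 < 1 / |p.γ| := by positivity
  unfold Coeffs.bound
  refine ⟨?_, ⟨?_, ?_⟩, ⟨?_, ?_⟩, ⟨?_, ?_⟩, ⟨?_, ?_⟩, ⟨?_, ?_⟩, ⟨?_, ?_⟩⟩ <;> linarith

/-- `(iω - Â(ξ)) (v, u, z, y, φ, θ, σ, η) = (f₁, …, f₈)`, with thermal damping `D`. -/
structure ResolventEq (p : Coeffs) (D ξ ω : ℝ) (v u z y φ θ σ η f₁ f₂ f₃ f₄ f₅ f₆ f₇ f₈ : ℂ) :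
    Prop where
  e₁ : Complex.I * ω * v = Complex.I * ξ * u + y + θ + f₁
  e₂ : Complex.I * ω * u = p.k₁ * (Complex.I * ξ * v) + f₂
  e₃ : Complex.I * ω * z = Complex.I * ξ * y + f₃
  e₄ : Complex.I * ω * y = p.k₂ * (Complex.I * ξ * z) - p.k₁ * v - p.γ * (Complex.I * ξ * η) + f₄
  e₅ : Complex.I * ω * φ = Complex.I * ξ * θ + f₅
  e₆ : Complex.I * ω * θ = p.k₃ * (Complex.I * ξ * φ) - p.k₁ * v + f₆
  e₇ : Complex.I * ω * σ = Complex.I * ξ * η + f₇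
  e₈ : Complex.I * ω * η = p.k₄ * (Complex.I * ξ * σ) - p.γ * (Complex.I * ξ * y) - D * η + f₈

theorem norm_le_three {A B C E : ℂ} (h : A = B + C + E) : ‖A‖ ≤ ‖B‖ + ‖C‖ + ‖E‖ :=
  h ▸ norm_add₃_le

theorem norm_le_four {A B C E G : ℂ} (h : A = B + C + E + G) : ‖A‖ ≤ ‖B‖ + ‖C‖ + ‖E‖ + ‖G‖ :=
  h ▸ norm_add₄_le

theorem le_mul_of_mul_le {k K X B : ℝ} (hk : 0 < k) (hK : 1 / k ≤ K) (hB : 0 ≤ B)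
    (h : k * X ≤ B) : X ≤ K * B := by
  have : X ≤ 1 / k * B := by
    rw [one_div, ← div_eq_inv_mul, le_div_iff₀ hk]; linarith
  exact this.trans (mul_le_mul_of_nonneg_right hK hB)

namespace ResolventEq

variable {p : Coeffs} {D ξ ω : ℝ} {v u z y φ θ σ η f₁ f₂ f₃ f₄ f₅ f₆ f₇ f₈ : ℂ} {F : ℝ}

/-- Each inequality is one of the eight equations solved for one of its terms and estimated by the
triangle inequality. Division by a coefficient costs a factor `p.bound`. -/
theorem normBounds (h : ResolventEq p D ξ ω v u z y φ θ σ η f₁ f₂ f₃ f₄ f₅ f₆ f₇ f₈)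
    (hξ : ξ ≠ 0) (hD : 0 ≤ D)
    (h₁ : ‖f₁‖ ≤ F) (h₂ : ‖f₂‖ ≤ F) (h₃ : ‖f₃‖ ≤ F) (h₄ : ‖f₄‖ ≤ F) (h₅ : ‖f₅‖ ≤ F)
    (h₆ : ‖f₆‖ ≤ F) (h₇ : ‖f₇‖ ≤ F) (h₈ : ‖f₈‖ ≤ F) :
    NormBounds p.bound |ξ| |ω| D F ‖v‖ ‖u‖ ‖z‖ ‖y‖ ‖φ‖ ‖θ‖ ‖σ‖ ‖η‖ := by
  obtain ⟨hK, ⟨a1, b1⟩, ⟨a2, b2⟩, ⟨a3, b3⟩, ⟨a4, b4⟩, -, ⟨a6, b6⟩⟩ := p.bound_spec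
  have n (r : ℝ) (x : ℂ) : ‖(r : ℂ) * x‖ = |r| * ‖x‖ := by simp
  have nI (r : ℝ) (x : ℂ) : ‖Complex.I * r * x‖ = |r| * ‖x‖ := by simp
  have k1 : |p.k₁| = p.k₁ := abs_of_pos p.k₁_pos
  have k2 : |p.k₂| = p.k₂ := abs_of_pos p.k₂_pos
  have k3 : |p.k₃| = p.k₃ := abs_of_pos p.k₃_pos
  have k4 : |p.k₄| = p.k₄ := abs_of_pos p.k₄_pos
  have kD : |D| = D := abs_of_nonneg hD
  have hF := (norm_nonneg _).trans h₁
  obtain ⟨e1, e2, e3, e4, e5, e6, e7, e8⟩ := h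
  have m1 : ∀ X : ℝ, 0 ≤ X → p.k₁ * X ≤ p.bound * X := fun X hX =>
    mul_le_mul_of_nonneg_right a1 hX
  have m2 : ∀ X : ℝ, 0 ≤ X → p.k₂ * X ≤ p.bound * X := fun X hX =>
    mul_le_mul_of_nonneg_right a2 hX
  have m3 : ∀ X : ℝ, 0 ≤ X → p.k₃ * X ≤ p.bound * X := fun X hX =>
    mul_le_mul_of_nonneg_right a3 hX
  have m4 : ∀ X : ℝ, 0 ≤ X → p.k₄ * X ≤ p.bound * X := fun X hX =>
    mul_le_mul_of_nonneg_right a4 hX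
  have m6 : ∀ X : ℝ, 0 ≤ X → |p.γ| * X ≤ p.bound * X := fun X hX =>
    mul_le_mul_of_nonneg_right a6 hX
  have hK0 : 0 ≤ p.bound := by linarith
  have nξ (X : ℂ) : 0 ≤ |ξ| * ‖X‖ := by positivity
  have nω (X : ℂ) : 0 ≤ |ω| * ‖X‖ := by positivity
  constructor
  · exact hK
  · exact abs_pos.2 hξ
  · exact abs_nonneg _
  · exact hD
  · exact hF
  iterate 8 exact norm_nonneg _
  · have := norm_le_four e1
    rw [nI, nI] at this; linarith
  · have := norm_le_four
      (show Complex.I * ξ * u = Complex.I * ω * v + -y + -θ + -f₁ by rw [e1]; ring)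
    rw [nI, nI, norm_neg, norm_neg, norm_neg] at this; linarith
  · have := norm_le_four
      (show θ = Complex.I * ω * v + -(Complex.I * ξ * u) + -y + -f₁ by rw [e1]; ring)
    rw [norm_neg, nI, nI, norm_neg, norm_neg] at this; linarith
  · have := norm_le_three (show Complex.I * ω * u = p.k₁ * (Complex.I * ξ * v) + 0 + f₂ by
      rw [e2]; ring)
    rw [nI, n, nI, k1, norm_zero] at this; linarith [m1 _ (nξ v)]
  · have := norm_le_three (show (p.k₁ : ℂ) * (Complex.I * ξ * v) = Complex.I * ω * u + 0 + -f₂ by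
      rw [e2]; ring)
    rw [nI, n, nI, k1, norm_zero, norm_neg] at this
    exact le_mul_of_mul_le p.k₁_pos b1 (by positivity) (by linarith)
  · have := norm_le_three (show Complex.I * ω * z = Complex.I * ξ * y + 0 + f₃ by rw [e3]; ring)
    rw [nI, nI, norm_zero] at this; linarith
  · have := norm_le_three (show Complex.I * ξ * y = Complex.I * ω * z + 0 + -f₃ by rw [e3]; ring)
    rw [nI, nI, norm_zero, norm_neg] at this; linarith
  · have := norm_le_four (show Complex.I * ω * y = p.k₂ * (Complex.I * ξ * z) + -(p.k₁ * v)
      + -(p.γ * (Complex.I * ξ * η)) + f₄ by rw [e4]; ring)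
    rw [nI, n, nI, norm_neg, norm_neg, n, n, nI, k1, k2] at this
    linarith [m1 _ (norm_nonneg v), m2 _ (nξ z), m6 _ (nξ η)]
  · have := norm_le_four (show (p.k₁ : ℂ) * v = p.k₂ * (Complex.I * ξ * z) + -(Complex.I * ω * y)
      + -(p.γ * (Complex.I * ξ * η)) + f₄ by rw [e4]; ring)
    rw [n, n, nI, norm_neg, nI, norm_neg, n, nI, k1, k2] at this
    refine le_mul_of_mul_le p.k₁_pos b1 (by positivity) ?_
    linarith [m2 _ (nξ z), m6 _ (nξ η)]
  · have := norm_le_four (show (p.k₂ : ℂ) * (Complex.I * ξ * z) = Complex.I * ω * y + p.k₁ * v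
      + p.γ * (Complex.I * ξ * η) + -f₄ by rw [e4]; ring)
    rw [nI, n, nI, n, n, nI, k1, k2, norm_neg] at this
    refine le_mul_of_mul_le p.k₂_pos b2 (by positivity) ?_
    linarith [m1 _ (norm_nonneg v), m6 _ (nξ η)]
  · have := norm_le_three (show Complex.I * ω * φ = Complex.I * ξ * θ + 0 + f₅ by rw [e5]; ring)
    rw [nI, nI, norm_zero] at this; linarith
  · have := norm_le_three (show Complex.I * ξ * θ = Complex.I * ω * φ + 0 + -f₅ by rw [e5]; ring)
    rw [nI, nI, norm_zero, norm_neg] at this; linarith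
  · have := norm_le_three (show Complex.I * ω * θ = p.k₃ * (Complex.I * ξ * φ) + -(p.k₁ * v)
      + f₆ by rw [e6]; ring)
    rw [nI, n, nI, norm_neg, n, k1, k3] at this
    linarith [m1 _ (norm_nonneg v), m3 _ (nξ φ)]
  · have := norm_le_three (show (p.k₃ : ℂ) * (Complex.I * ξ * φ) = Complex.I * ω * θ + p.k₁ * v
      + -f₆ by rw [e6]; ring)
    rw [nI, n, nI, norm_neg, n, k1, k3] at this
    refine le_mul_of_mul_le p.k₃_pos b3 (by positivity) ?_
    linarith [m1 _ (norm_nonneg v)]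
  · have := norm_le_three (show Complex.I * ω * σ = Complex.I * ξ * η + 0 + f₇ by rw [e7]; ring)
    rw [nI, nI, norm_zero] at this; linarith
  · have := norm_le_four (show (p.γ : ℂ) * (Complex.I * ξ * y) = p.k₄ * (Complex.I * ξ * σ)
      + -(Complex.I * ω * η) + -(D * η) + f₈ by rw [e8]; ring)
    rw [n, nI, n, nI, norm_neg, nI, norm_neg, n, k4, kD] at this
    refine le_mul_of_mul_le (abs_pos.2 p.γ_ne) b6 (by positivity) ?_
    linarith [m4 _ (nξ σ)]
  · have := norm_le_four (show (p.k₄ : ℂ) * (Complex.I * ξ * σ) = p.γ * (Complex.I * ξ * y)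
      + Complex.I * ω * η + D * η + -f₈ by rw [e8]; ring)
    rw [n, nI, n, nI, norm_neg, nI, n, k4, kD] at this
    refine le_mul_of_mul_le p.k₄_pos b4 (by positivity) ?_
    linarith [m6 _ (nξ y)]

/-- The energy identity. -/
theorem energy_identity (h : ResolventEq p D ξ ω v u z y φ θ σ η f₁ f₂ f₃ f₄ f₅ f₆ f₇ f₈) :
    D * ‖η‖ ^ 2 = p.k₁ * (f₁.re * v.re + f₁.im * v.im)
      + 1 * (f₂.re * u.re + f₂.im * u.im) + p.k₂ * (f₃.re * z.re + f₃.im * z.im)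
      + 1 * (f₄.re * y.re + f₄.im * y.im) + p.k₃ * (f₅.re * φ.re + f₅.im * φ.im)
      + 1 * (f₆.re * θ.re + f₆.im * θ.im) + p.k₄ * (f₇.re * σ.re + f₇.im * σ.im)
      + 1 * (f₈.re * η.re + f₈.im * η.im) := by
  obtain ⟨e1, e2, e3, e4, e5, e6, e7, e8⟩ := h
  rw [← Complex.normSq_eq_norm_sq, Complex.normSq_apply]
  rw [Complex.ext_iff] at e1 e2 e3 e4 e5 e6 e7 e8
  simp only [Complex.mul_re, Complex.mul_im, Complex.I_re, Complex.I_im, Complex.ofReal_re,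
    Complex.ofReal_im, Complex.add_re, Complex.add_im, Complex.sub_re, Complex.sub_im, zero_mul,
    one_mul, mul_zero, sub_zero, zero_sub, zero_add, add_zero,
    mul_neg] at e1 e2 e3 e4 e5 e6 e7 e8
  -- This is the real part of the inner product with the state, with weights `k₁, 1, k₂, 1, k₃, 1,
  -- k₄, 1`. In this inner product the undamped part of the symbol is skew-adjoint and drops out.
  linear_combination p.k₁ * (v.re * e1.1 + v.im * e1.2) + (u.re * e2.1 + u.im * e2.2)
    + p.k₂ * (z.re * e3.1 + z.im * e3.2) + (y.re * e4.1 + y.im * e4.2)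
    + p.k₃ * (φ.re * e5.1 + φ.im * e5.2) + (θ.re * e6.1 + θ.im * e6.2)
    + p.k₄ * (σ.re * e7.1 + σ.im * e7.2) + (η.re * e8.1 + η.im * e8.2)

theorem energy (h : ResolventEq p D ξ ω v u z y φ θ σ η f₁ f₂ f₃ f₄ f₅ f₆ f₇ f₈)
    (h₁ : ‖f₁‖ ≤ F) (h₂ : ‖f₂‖ ≤ F) (h₃ : ‖f₃‖ ≤ F) (h₄ : ‖f₄‖ ≤ F) (h₅ : ‖f₅‖ ≤ F)
    (h₆ : ‖f₆‖ ≤ F) (h₇ : ‖f₇‖ ≤ F) (h₈ : ‖f₈‖ ≤ F) :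
    D * ‖η‖ ^ 2 ≤ p.bound * (F * (‖v‖ + ‖u‖ + ‖z‖ + ‖y‖ + ‖φ‖ + ‖θ‖ + ‖σ‖ + ‖η‖)) := by
  obtain ⟨hK, ⟨a1, -⟩, ⟨a2, -⟩, ⟨a3, -⟩, ⟨a4, -⟩, -⟩ := p.bound_spec
  have hF := (norm_nonneg _).trans h₁
  have r : ∀ {k : ℝ} {f x : ℂ}, 0 ≤ k → k ≤ p.bound → ‖f‖ ≤ F →
      k * (f.re * x.re + f.im * x.im) ≤ p.bound * (F * ‖x‖) := by
    intro k f x hk hkK hf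
    have h1 : f.re * x.re + f.im * x.im ≤ ‖f‖ * ‖x‖ := by
      have := Complex.re_le_norm (f * (starRingEnd ℂ) x)
      simpa using this
    have h2 : ‖f‖ * ‖x‖ ≤ F * ‖x‖ := mul_le_mul_of_nonneg_right hf (norm_nonneg _)
    exact (mul_le_mul_of_nonneg_left (h1.trans h2) hk).trans
      (mul_le_mul_of_nonneg_right hkK (by positivity))
  rw [h.energy_identity]
  have := r (x := v) p.k₁_pos.le a1 h₁
  have := r (x := u) zero_le_one hK h₂
  have := r (x := z) p.k₂_pos.le a2 h₃
  have := r (x := y) zero_le_one hK h₄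
  have := r (x := φ) p.k₃_pos.le a3 h₅
  have := r (x := θ) zero_le_one hK h₆
  have := r (x := σ) p.k₄_pos.le a4 h₇
  have := r (x := η) zero_le_one hK h₈
  linarith

/-- Eliminating `φ` between the fifth and sixth equations gives a second-order equation for `θ` with
resonant factor `ω² - k₃ ξ²`. The next two lemmas treat the pairs `(v, u)` and `(z, y)` in the same
way. For equal speeds the three factors agree. -/
theorem resonance_θ (h : ResolventEq p D ξ ω v u z y φ θ σ η f₁ f₂ f₃ f₄ f₅ f₆ f₇ f₈)
    (h₅ : ‖f₅‖ ≤ F) (h₆ : ‖f₆‖ ≤ F) :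
    |ω ^ 2 - p.k₃ * ξ ^ 2| * ‖θ‖ ≤
      p.bound * (|ω| * ‖v‖) + (|ω| + p.bound * |ξ|) * F := by
  obtain ⟨hK, ⟨a1, b1⟩, ⟨a2, b2⟩, ⟨a3, b3⟩, -⟩ := p.bound_spec
  have key : Complex.I * (ω ^ 2 - p.k₃ * ξ ^ 2 : ℝ) * θ
      = p.k₃ * (ξ * f₅) + -(p.k₁ * (ω * v)) + ω * f₆ := by
    push_cast
    linear_combination (ω : ℂ) * h.e₆ + (p.k₃ * ξ : ℂ) * h.e₅
  have := norm_le_three key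
  simp only [norm_mul, Complex.norm_I, norm_neg, Complex.norm_real, Real.norm_eq_abs, one_mul,
    abs_of_pos p.k₁_pos, abs_of_pos p.k₃_pos] at this
  have g1 : p.k₃ * (|ξ| * ‖f₅‖) ≤ p.bound * (|ξ| * F) := by gcongr
  have g2 : p.k₁ * (|ω| * ‖v‖) ≤ p.bound * (|ω| * ‖v‖) := by gcongr
  have g3 : |ω| * ‖f₆‖ ≤ |ω| * F := by gcongr
  linarith

theorem resonance_v (h : ResolventEq p D ξ ω v u z y φ θ σ η f₁ f₂ f₃ f₄ f₅ f₆ f₇ f₈)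
    (h₁ : ‖f₁‖ ≤ F) (h₂ : ‖f₂‖ ≤ F) :
    |ω ^ 2 - p.k₁ * ξ ^ 2| * ‖v‖ ≤ |ω| * (‖y‖ + ‖θ‖) + (|ω| + |ξ|) * F ∧
    |ω| * ‖θ‖ ≤ |ω ^ 2 - p.k₁ * ξ ^ 2| * ‖v‖ + |ω| * ‖y‖ + (|ω| + |ξ|) * F := by
  have key : Complex.I * (ω ^ 2 - p.k₁ * ξ ^ 2 : ℝ) * v
      = ω * y + ω * θ + ξ * f₂ + ω * f₁ := by
    push_cast
    linear_combination (ω : ℂ) * h.e₁ + (ξ : ℂ) * h.e₂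
  have h1 := norm_le_four key
  have h2 := norm_le_four (show (ω * θ : ℂ) = Complex.I * (ω ^ 2 - p.k₁ * ξ ^ 2 : ℝ) * v
    + -(ω * y) + -(ξ * f₂) + -(ω * f₁) by rw [key]; ring)
  simp only [norm_mul, Complex.norm_I, norm_neg, Complex.norm_real, Real.norm_eq_abs, one_mul]
    at h1 h2
  have g1 : |ξ| * ‖f₂‖ ≤ |ξ| * F := by gcongr
  have g3 : |ω| * ‖f₁‖ ≤ |ω| * F := by gcongr
  constructor <;> linarith

theorem resonance_y (h : ResolventEq p D ξ ω v u z y φ θ σ η f₁ f₂ f₃ f₄ f₅ f₆ f₇ f₈)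
    (h₃ : ‖f₃‖ ≤ F) (h₄ : ‖f₄‖ ≤ F) :
    |ω| * ‖v‖ ≤ p.bound * (|ω ^ 2 - p.k₂ * ξ ^ 2| * ‖y‖ + p.bound * (|ξ| * (|ω| * ‖η‖))
      + (|ω| + p.bound * |ξ|) * F) := by
  obtain ⟨hK, ⟨a1, b1⟩, ⟨a2, b2⟩, -, -, -, ⟨a6, -⟩⟩ := p.bound_spec
  have hF := (norm_nonneg _).trans h₃
  have key : (p.k₁ * (ω * v) : ℂ) = -(Complex.I * (ω ^ 2 - p.k₂ * ξ ^ 2 : ℝ) * y)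
      + -(p.γ * (Complex.I * ξ * (ω * η))) + p.k₂ * (ξ * f₃) + ω * f₄ := by
    push_cast
    linear_combination (ω : ℂ) * h.e₄ + (p.k₂ * ξ : ℂ) * h.e₃
  have := norm_le_four key
  simp only [norm_mul, Complex.norm_I, norm_neg, Complex.norm_real, Real.norm_eq_abs, one_mul,
    abs_of_pos p.k₁_pos, abs_of_pos p.k₂_pos] at this
  refine le_mul_of_mul_le p.k₁_pos b1 (by positivity) ?_
  have g1 : p.k₂ * (|ξ| * ‖f₃‖) ≤ p.bound * (|ξ| * F) := by gcongr
  have g2 : |p.γ| * (|ξ| * (|ω| * ‖η‖)) ≤ p.bound * (|ξ| * (|ω| * ‖η‖)) := by gcongr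
  have g3 : |ω| * ‖f₄‖ ≤ |ω| * F := by gcongr
  linarith

end ResolventEq

/-! ### The resolvent bound with its rate -/

/-- The decay rate `a ^ m` for `a ≤ 1`, `a ^ (-n)` for `a > 1`. -/
def rate (m n : ℕ) (a : ℝ) : ℝ := if a ≤ 1 then a ^ m else (a ^ n)⁻¹

theorem rate_pos (m n : ℕ) {a : ℝ} (ha : 0 < a) : 0 < rate m n a := by
  unfold rate; split_ifs <;> positivity

/-- Thermal damping of the frequency `ξ`. -/
def damping (p : Coeffs) (d : Dissipation) (ξ : ℝ) : ℝ :=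
  d.eps * p.k₅ * ξ ^ 2 + (1 - d.eps) * p.k₅

/-- The decay rates in the four cases: `(m, n)` such that the rate is `|ξ| ^ m` for small `ξ` and
`|ξ| ^ (-n)` for large `ξ`. -/
inductive RateExponents (p : Coeffs) : Dissipation → ℕ → ℕ → Prop
  | strong_eq (h : p.k₁ = p.k₂ ∧ p.k₂ = p.k₃) : RateExponents p .strong 6 0
  | strong : RateExponents p .strong 6 4
  | weak_eq (h : p.k₁ = p.k₂ ∧ p.k₂ = p.k₃) : RateExponents p .weak 4 2
  | weak : RateExponents p .weak 4 4

-- In each case the observability loss `m'` in front of `|η|` is weighed against the damping `D`: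
-- the bound is of order `m' ^ 2 / D`, and this order is the inverse of the rate.
set_option maxHeartbeats 1000000 in
theorem exists_resolvent_bound (p : Coeffs) {d : Dissipation} {m n : ℕ}
    (hr : RateExponents p d m n) :
    ∃ C : ℝ, 0 < C ∧ ∀ (ξ ω F : ℝ) (v u z y φ θ σ η f₁ f₂ f₃ f₄ f₅ f₆ f₇ f₈ : ℂ), ξ ≠ 0 →
      ResolventEq p (damping p d ξ) ξ ω v u z y φ θ σ η f₁ f₂ f₃ f₄ f₅ f₆ f₇ f₈ →
      ‖f₁‖ ≤ F → ‖f₂‖ ≤ F → ‖f₃‖ ≤ F → ‖f₄‖ ≤ F → ‖f₅‖ ≤ F → ‖f₆‖ ≤ F → ‖f₇‖ ≤ F → ‖f₈‖ ≤ F →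
      ‖v‖ + ‖u‖ + ‖z‖ + ‖y‖ + ‖φ‖ + ‖θ‖ + ‖σ‖ + ‖η‖ ≤ C / rate m n |ξ| * F := by
  obtain ⟨hK, ⟨a1, b1⟩, ⟨a2, b2⟩, ⟨a3, b3⟩, ⟨a4, b4⟩, ⟨a5, b5⟩, ⟨a6, b6⟩⟩ := p.bound_spec
  set K := p.bound with hKdef
  have hK0 : 0 < K := by linarith
  obtain ⟨C₁, hC₁, H₁⟩ := NormBounds.exists_low K hK
  obtain ⟨C₂, hC₂, H₂⟩ := NormBounds.exists_high K hK
  have k5 := p.k₅_pos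
  have hKk : 1 ≤ K * p.k₅ := by rwa [div_le_iff₀ k5] at b5
  refine ⟨4 * C₁ ^ 2 * K ^ 2 + 4 * C₂ ^ 2 * K ^ 2, by positivity,
    fun ξ ω F v u z y φ θ σ η f₁ f₂ f₃ f₄ f₅ f₆ f₇ f₈ hξ h h₁ h₂ h₃ h₄ h₅ h₆ h₇ h₈ => ?_⟩
  have hF : 0 ≤ F := (norm_nonneg _).trans h₁
  have ha : 0 < |ξ| := abs_pos.2 hξ
  have hD0 : 0 ≤ damping p d ξ := by cases d <;> simp [damping, Dissipation.eps] <;> positivity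
  have hN := h.normBounds hξ hD0 h₁ h₂ h₃ h₄ h₅ h₆ h₇ h₈
  have hE := h.energy h₁ h₂ h₃ h₄ h₅ h₆ h₇ h₈
  have hθ := h.resonance_θ h₅ h₆
  have hv := h.resonance_v h₁ h₂
  have hy := h.resonance_y h₃ h₄
  have hX : 0 ≤ ‖v‖ + ‖u‖ + ‖z‖ + ‖y‖ + ‖φ‖ + ‖θ‖ + ‖σ‖ + ‖η‖ := by positivity
  set X := ‖v‖ + ‖u‖ + ‖z‖ + ‖y‖ + ‖φ‖ + ‖θ‖ + ‖σ‖ + ‖η‖ with hXdef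
  have hη := norm_nonneg η
  set a := |ξ| with hadef
  have hξ2 : ξ ^ 2 = a ^ 2 := (sq_abs ξ).symm
  have fin : ∀ {C R : ℝ}, 0 ≤ R → 1 ≤ C → (C = C₁ ∨ C = C₂) → X ≤ 4 * C ^ 2 * (K ^ 2 * R * F) →
      X ≤ (4 * C₁ ^ 2 * K ^ 2 + 4 * C₂ ^ 2 * K ^ 2) * R * F := by
    intro C R hR hC hCC hh
    have q1 : 0 ≤ C₁ ^ 2 * K ^ 2 * (R * F) := by positivity
    have q2 : 0 ≤ C₂ ^ 2 * K ^ 2 * (R * F) := by positivity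
    rcases hCC with rfl | rfl <;> linarith
  have hK2 : K ≤ K ^ 2 := by nlinarith
  have hK21 : 1 ≤ K ^ 2 := hK.trans hK2
  have hKKk : ∀ q : ℝ, 0 ≤ q → K * q ≤ K ^ 2 * q * p.k₅ := fun q hq => by
    have := mul_le_mul_of_nonneg_left hKk (mul_nonneg hK0.le hq)
    linarith
  rw [div_eq_mul_inv]
  rcases le_or_gt a 1 with ha1 | ha1
  · have hrate : (rate m n a)⁻¹ = 1 / a ^ m := by rw [rate, if_pos ha1, one_div]
    rw [hrate]
    have hR0 : 0 < 1 / a ^ m := by positivity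
    refine fin hR0.le hC₁ (.inl rfl) ?_
    have hDK : damping p d ξ ≤ K := by
      cases d
      · simp only [damping, Dissipation.eps, hξ2]
        have : p.k₅ * a ^ 2 ≤ p.k₅ := mul_le_of_le_one_right k5.le (pow_le_one₀ ha.le ha1)
        linarith
      · simp only [damping, Dissipation.eps]; linarith
    have hobs := H₁ a |ω| _ F _ _ _ _ _ _ _ _ hN ha1 hDK
    have hn : 1 / a ^ 3 ≤ K ^ 2 * (1 / a ^ m) := by
      have : 1 / a ^ 3 ≤ 1 / a ^ m := by
        apply one_div_le_one_div_of_le (by positivity)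
        apply pow_le_pow_of_le_one ha.le ha1
        cases hr <;> norm_num
      exact this.trans (le_mul_of_one_le_left hR0.le hK21)
    refine le_of_observability hC₁ hK0 (by positivity) hX hF (by positivity) hobs hE ?_ hn
    have e : (1 / a ^ 2) ^ 2 = 1 / a ^ 4 := by field_simp
    rw [e]
    -- The loss is `1 / a ^ 2` in front of `η` for both systems. The damping `k₅ a ^ 2` of System I
    -- is weaker at low frequency than the damping `k₅` of System II, whence `m = 6` against `m =
    -- 4`.
    have h4 : damping p d ξ * (1 / a ^ m) = 1 / a ^ 4 * p.k₅ := by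
      cases hr <;> simp only [damping, Dissipation.eps, hξ2] <;> field_simp <;> ring
    calc K * (1 / a ^ 4) ≤ K ^ 2 * (1 / a ^ 4) * p.k₅ := hKKk _ (by positivity)
      _ = K ^ 2 * (1 / a ^ m) * damping p d ξ := by
        rw [mul_assoc (K ^ 2), mul_assoc (K ^ 2), mul_comm (1 / a ^ m), h4]
  · have hrate : (rate m n a)⁻¹ = a ^ n := by rw [rate, if_neg ha1.not_ge, inv_inv]
    rw [hrate]
    refine fin (by positivity) hC₂ (.inr rfl) ?_
    have haη : ‖η‖ ≤ a * ‖η‖ := le_mul_of_one_le_left hη ha1.le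
    have ha2 : 1 ≤ a ^ 2 := one_le_pow₀ ha1.le
    have hR0 : 0 < K ^ 2 * a ^ n := by positivity
    have hkη : ∀ q : ℝ, 0 ≤ q → p.k₅ * q ≤ K * q := fun q hq => mul_le_mul_of_nonneg_right a5 hq
    -- For strong damping the scale must be `E = a ‖η‖ + F`, because `D η` is of size `a ^ 2 ‖η‖`.
    -- For weak damping `E = ‖η‖ + F` is enough.
    have hS : damping p .strong ξ * ‖η‖ ≤ K * (a * (a * ‖η‖ + F)) := by
      simp only [damping, Dissipation.eps, hξ2]
      have : 0 ≤ K * (a * F) := by positivity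
      linarith [hkη (a ^ 2 * ‖η‖) (by positivity)]
    have hW : damping p .weak ξ * ‖η‖ ≤ K * (a * (‖η‖ + F)) := by
      simp only [damping, Dissipation.eps]
      have : 0 ≤ K * (a * F) := by positivity
      linarith [hkη ‖η‖ hη, mul_le_mul_of_nonneg_left haη hK0.le]
    cases hr with
    | strong_eq heq =>
      obtain ⟨-, h2⟩ := H₂ a |ω| _ F _ _ _ _ _ _ _ _ (a * ‖η‖ + F) hN ha1.le
        (by linarith) hS (by linarith)
      obtain ⟨-, h3⟩ := h2 |ω ^ 2 - p.k₁ * ξ ^ 2| (by rw [heq.1, heq.2]; exact hθ) hv.2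
      have hobs := h3 hv.1 (by rw [heq.1]; exact hy) (by linarith)
      refine le_of_observability (m := a) (n := 1) hC₂ hK0 hR0 hX hF zero_le_one
        (by simpa using hobs) hE ?_ (by simpa using hK21)
      simp only [damping, Dissipation.eps, hξ2]
      linarith [hKKk (a ^ 2) (by positivity)]
    | strong =>
      have hobs := (H₂ a |ω| _ F _ _ _ _ _ _ _ _ (a * ‖η‖ + F) hN ha1.le
        (by linarith) hS (by linarith)).1
      refine le_of_observability (m := a ^ 3) (n := a ^ 2) hC₂ hK0 hR0 hX hF (by positivity)
        (hobs.trans (le_of_eq (by ring))) hE ?_ ?_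
      · simp only [damping, Dissipation.eps, hξ2]
        linarith [hKKk (a ^ 6) (by positivity)]
      · nlinarith [pow_pos ha 2, pow_pos ha 4]
    | weak_eq heq =>
      obtain ⟨-, h2⟩ := H₂ a |ω| _ F _ _ _ _ _ _ _ _ (‖η‖ + F) hN ha1.le
        (by linarith) hW (by linarith)
      have hobs := (h2 |ω ^ 2 - p.k₁ * ξ ^ 2| (by rw [heq.1, heq.2]; exact hθ) hv.2).1
      refine le_of_observability (m := a) (n := a) hC₂ hK0 hR0 hX hF (by positivity)
        (hobs.trans (le_of_eq (by ring))) hE ?_ ?_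
      · simp only [damping, Dissipation.eps]
        linarith [hKKk (a ^ 2) (by positivity)]
      · nlinarith [pow_pos ha 2]
    | weak =>
      have hobs := (H₂ a |ω| _ F _ _ _ _ _ _ _ _ (‖η‖ + F) hN ha1.le
        (by linarith) hW (by linarith)).1
      refine le_of_observability (m := a ^ 2) (n := a ^ 2) hC₂ hK0 hR0 hX hF (by positivity)
        (hobs.trans (le_of_eq (by ring))) hE ?_ ?_
      · simp only [damping, Dissipation.eps]
        linarith [hKKk (a ^ 4) (by positivity)]
      · nlinarith [pow_pos ha 2, pow_pos ha 4]

end LaminatedBeam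

/-! ### A quantitative Gearhart–Prüss theorem -/

section GearhartPruess

/-- Smoothness makes an orbit multiplied by a smooth cutoff a Schwartz function of time, to which
Plancherel applies. -/
theorem contDiff_of_hasDerivAt_clm {H : Type*} [NormedAddCommGroup H] [InnerProductSpace ℂ H]
    {A : H →L[ℂ] H} {x : ℝ → H}
    (hx : ∀ t, HasDerivAt x (A (x t)) t) : ContDiff ℝ (⊤ : ℕ∞) x := by
  rw [contDiff_infty]
  intro n
  induction n with
  | zero => exact contDiff_zero.2 (continuous_iff_continuousAt.2 fun t => (hx t).continuousAt)
  | succ n ih =>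
    have : deriv x = fun t => A (x t) := funext fun t => (hx t).deriv
    push_cast
    rw [contDiff_succ_iff_deriv]
    refine ⟨fun t => (hx t).differentiableAt, by simp, ?_⟩
    rw [this]
    exact (A.restrictScalars ℝ).contDiff.comp ih

variable {H : Type*} [NormedAddCommGroup H] [InnerProductSpace ℂ H] [CompleteSpace H]

/-- A smooth cutoff, equal to `1` on `[1, L]` and supported in `[0, L + 1]`. -/
theorem exists_cutoff : ∃ B : ℝ, 0 < B ∧ ∀ L : ℝ, 1 ≤ L → ∃ χ : ℝ → ℝ, ContDiff ℝ (⊤ : ℕ∞) χ ∧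
    (∀ t, t ∈ Icc 1 L → χ t = 1) ∧ (∀ t, t ∉ Icc 0 (L + 1) → χ t = 0) ∧
    (∀ t, |deriv χ t| ≤ B) ∧ (∀ t, t ∉ Icc 0 1 ∪ Icc L (L + 1) → deriv χ t = 0) := by
  have hs : ContDiff ℝ (⊤ : ℕ∞) Real.smoothTransition := Real.smoothTransition.contDiff
  have hd : ∀ t, HasDerivAt Real.smoothTransition (deriv Real.smoothTransition t) t := fun t =>
    ((hs.differentiable (by simp)) t).hasDerivAt
  have hcont : Continuous (deriv Real.smoothTransition) :=
    (contDiff_infty_iff_deriv.1 hs).2.continuous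
  have h0 : ∀ t, t ∉ Icc (0 : ℝ) 1 → deriv Real.smoothTransition t = 0 := by
    intro t ht
    rw [mem_Icc, not_and_or, not_le, not_le] at ht
    rcases ht with ht | ht
    · have : Real.smoothTransition =ᶠ[nhds t] fun _ => 0 := by
        filter_upwards [Iio_mem_nhds ht] with r hr
        exact Real.smoothTransition.zero_of_nonpos (le_of_lt hr)
      rw [this.deriv_eq, deriv_const]
    · have : Real.smoothTransition =ᶠ[nhds t] fun _ => 1 := by
        filter_upwards [Ioi_mem_nhds ht] with r hr
        exact Real.smoothTransition.one_of_one_le (le_of_lt hr)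
      rw [this.deriv_eq, deriv_const]
  obtain ⟨B, hB⟩ := (isCompact_Icc (a := (0 : ℝ)) (b := 1)).exists_bound_of_continuousOn
    hcont.continuousOn
  have hB' : ∀ t, |deriv Real.smoothTransition t| ≤ |B| := fun t => by
    by_cases ht : t ∈ Icc (0 : ℝ) 1
    · exact (hB t ht).trans (le_abs_self B)
    · rw [h0 t ht, abs_zero]; exact abs_nonneg B
  refine ⟨2 * |B| + 1, by positivity, fun L hL =>
    ⟨fun t => Real.smoothTransition t * Real.smoothTransition (L + 1 - t), ?_, ?_, ?_, ?_⟩⟩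
  · exact hs.mul (hs.comp (contDiff_const.sub contDiff_id))
  · intro t ht
    simp only
    rw [Real.smoothTransition.one_of_one_le ht.1,
      Real.smoothTransition.one_of_one_le (by linarith [ht.2]), one_mul]
  · intro t ht
    rw [mem_Icc, not_and_or, not_le, not_le] at ht
    simp only
    rcases ht with ht | ht
    · rw [Real.smoothTransition.zero_of_nonpos ht.le, zero_mul]
    · rw [Real.smoothTransition.zero_of_nonpos (x := L + 1 - t) (by linarith), mul_zero]
  have hder : ∀ t, deriv (fun t => Real.smoothTransition t * Real.smoothTransition (L + 1 - t)) t
      = deriv Real.smoothTransition t * Real.smoothTransition (L + 1 - t)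
        - Real.smoothTransition t * deriv Real.smoothTransition (L + 1 - t) := fun t => by
    have h1 : HasDerivAt (fun t => Real.smoothTransition (L + 1 - t))
        (-deriv Real.smoothTransition (L + 1 - t)) t := by
      have := (hd (L + 1 - t)).comp t ((hasDerivAt_id t).const_sub (L + 1))
      simpa using! this
    exact (HasDerivAt.deriv ((hd t).mul h1)).trans (by ring_nf)
  have hle : ∀ t, |Real.smoothTransition t| ≤ 1 := fun t => by
    rw [abs_of_nonneg (Real.smoothTransition.nonneg t)]; exact Real.smoothTransition.le_one t
  constructor
  · intro t
    rw [hder]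
    have e1 := mul_le_mul (hB' t) (hle (L + 1 - t)) (abs_nonneg _) (abs_nonneg B)
    have e2 := mul_le_mul (hle t) (hB' (L + 1 - t)) (abs_nonneg _) zero_le_one
    rw [← abs_mul] at e1 e2
    linarith [abs_sub (deriv Real.smoothTransition t * Real.smoothTransition (L + 1 - t))
      (Real.smoothTransition t * deriv Real.smoothTransition (L + 1 - t))]
  · intro t ht
    rw [mem_union, not_or] at ht
    rw [hder, h0 t ht.1, h0 (L + 1 - t), zero_mul, mul_zero, sub_zero]
    intro h
    exact ht.2 ⟨by linarith [h.2], by linarith [h.1]⟩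

/-- The Fourier transform in time turns `y' - A y` into `(2πiτ - A) ŷ(τ)`. The resolvent bound holds
pointwise in `τ`, and Plancherel transfers it to `L²` in time. -/
theorem integral_norm_sq_le_of_resolvent {A : H →L[ℂ] H} {M : ℝ} 
    (hA : ∀ (ω : ℝ) (X : H), ‖X‖ ≤ M * ‖(Complex.I * ω) • X - A X‖)
    (y : ℝ → H) (hy : ContDiff ℝ (⊤ : ℕ∞) y) (hc : HasCompactSupport y) :
    ∫ t, ‖y t‖ ^ 2 ≤ M ^ 2 * ∫ t, ‖deriv y t - A (y t)‖ ^ 2 := by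
  set Y : 𝓢(ℝ, H) := hc.toSchwartzMap hy with hY
  have hz : ContDiff ℝ (⊤ : ℕ∞) (fun t => deriv y t - A (y t)) := by
    refine ContDiff.sub ?_ ((A.restrictScalars ℝ).contDiff.comp hy)
    exact (contDiff_infty_iff_deriv.1 hy).2
  have hcz : HasCompactSupport (fun t => deriv y t - A (y t)) :=
    hc.deriv.sub (hc.comp_left (g := A) (map_zero A))
  set Z : 𝓢(ℝ, H) := hcz.toSchwartzMap hz with hZ
  have hF : ∀ τ : ℝ, 𝓕 Z τ = (Complex.I * (2 * Real.pi * τ : ℝ)) • 𝓕 Y τ - A (𝓕 Y τ) := by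
    intro τ
    have hYi : Integrable y := Y.integrable
    have hdi : Integrable (deriv y) :=
      ((contDiff_infty_iff_deriv.1 hy).2.continuous).integrable_of_hasCompactSupport hc.deriv
    have hAi : Integrable (fun t => A (y t)) := A.integrable_comp hYi
    have e1 : 𝓕 Z τ = 𝓕 (deriv y) τ - 𝓕 (fun t => A (y t)) τ := by
      rw [SchwartzMap.fourier_coe, Real.fourier_eq, Real.fourier_eq, Real.fourier_eq,
        ← integral_sub]
      · refine integral_congr_ae (Filter.Eventually.of_forall fun t => ?_)
        simp [hZ, smul_sub]
      · exact (Real.fourierIntegral_convergent_iff τ).2 hdi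
      · exact (Real.fourierIntegral_convergent_iff τ).2 hAi
    have e2 : 𝓕 (fun t => A (y t)) τ = A (𝓕 y τ) := by
      rw [Real.fourier_eq, Real.fourier_eq, ← ContinuousLinearMap.integral_comp_comm]
      · refine integral_congr_ae (Filter.Eventually.of_forall fun t => ?_)
        simp only [Circle.smul_def, map_smul]
      · exact (Real.fourierIntegral_convergent_iff τ).2 hYi
    have e3 : 𝓕 Y τ = 𝓕 y τ := by rw [SchwartzMap.fourier_coe]; rfl
    rw [e1, e2, e3, Real.fourier_deriv hYi (hy.differentiable (by simp)) hdi]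
    congr 2
    push_cast
    ring_nf
  have h1 : ∫ t, ‖y t‖ ^ 2 = ∫ τ, ‖𝓕 Y τ‖ ^ 2 := (SchwartzMap.integral_norm_sq_fourier Y).symm
  have h2 : ∫ t, ‖deriv y t - A (y t)‖ ^ 2 = ∫ τ, ‖𝓕 Z τ‖ ^ 2 :=
    (SchwartzMap.integral_norm_sq_fourier Z).symm
  rw [h1, h2, ← integral_const_mul]
  have hint : ∀ f : 𝓢(ℝ, H), Integrable fun t => ‖f t‖ ^ 2 := fun f =>
    (f.memLp 2).integrable_norm_pow (by norm_num)
  refine integral_mono (hint _) ((hint _).const_mul _) fun τ => ?_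
  simp only
  rw [← mul_pow, hF]
  exact pow_le_pow_left₀ (norm_nonneg _) (hA _ _) 2

/-- One step of the decay. -/
theorem exists_contraction_time (κ : ℝ) (hκ : 1 ≤ κ) : ∃ T : ℝ, 0 < T ∧
    ∀ (A : H →L[ℂ] H) (M : ℝ), 0 < M →
      (∀ (ω : ℝ) (X : H), ‖X‖ ≤ M * ‖(Complex.I * ω) • X - A X‖) →
      ∀ x : ℝ → H, (∀ t, HasDerivAt x (A (x t)) t) →
        (∀ s t, 0 ≤ s → s ≤ t → ‖x t‖ ≤ κ * ‖x s‖) → ‖x (T * M)‖ ≤ 1 / 2 * ‖x 0‖ := by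
  obtain ⟨B, hB0, hB⟩ := exists_cutoff
  -- `L` is chosen so that the comparison of the two time integrals at the end reads `4 ‖x (L M)‖ ^
  -- 2 ≤ ‖x 0‖ ^ 2`. It depends on `κ` and the cutoff only, not on `A` or `M`.
  set L : ℝ := 1 + 8 * B ^ 2 * κ ^ 4 with hL
  have hL1 : 1 ≤ L := by have : 0 ≤ 8 * B ^ 2 * κ ^ 4 := by positivity
                         linarith
  obtain ⟨χ, hχ, h1, h0, hχB, hχ0⟩ := hB L hL1
  refine ⟨L, by linarith, fun A M hM hA x hx hmono => ?_⟩
  have hχd : ∀ t, HasDerivAt (fun t => χ (t / M)) (deriv χ (t / M) / M) t := fun t => by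
    have := ((hχ.differentiable (by simp)) (t / M)).hasDerivAt.comp t
      ((hasDerivAt_id t).div_const M)
    simpa [div_eq_mul_inv] using! this
  -- The cutoff acts on the time scale `M`, so `y' - A y` is only `χ'(t / M) / M • x`, supported in
  -- two intervals of length `M`. On the long plateau `[M, L M]` the orbit is bounded below by its
  -- value at the end.
  set y : ℝ → H := fun t => χ (t / M) • x t with hy
  have hyd : ∀ t, deriv y t = χ (t / M) • A (x t) + (deriv χ (t / M) / M) • x t := fun t =>
    ((hχd t).smul (hx t)).deriv
  have hy' : ∀ t, deriv y t - A (y t) = (deriv χ (t / M) / M) • x t := fun t => by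
    rw [hyd, hy]
    simp only [ContinuousLinearMap.map_smul_of_tower]
    abel
  have hysm : ContDiff ℝ (⊤ : ℕ∞) y :=
    (hχ.comp (contDiff_id.div_const M)).smul (contDiff_of_hasDerivAt_clm hx)
  have hyc : HasCompactSupport y := by
    refine HasCompactSupport.of_support_subset_isCompact
      (isCompact_Icc (a := 0) (b := (L + 1) * M)) fun t ht => ?_
    by_contra hcon
    apply ht
    simp only [hy]
    rw [h0, zero_smul]
    intro h
    exact hcon ⟨by have := mul_nonneg h.1 hM.le; rwa [div_mul_cancel₀ _ hM.ne'] at this,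
      (div_le_iff₀ hM).1 h.2⟩
  have key := integral_norm_sq_le_of_resolvent hA y hysm hyc
  simp only [hy'] at key
  have hxc : Continuous x := continuous_iff_continuousAt.2 fun t => (hx t).continuousAt
  have hχc : Continuous (deriv χ) := (contDiff_infty_iff_deriv.1 hχ).2.continuous
  have up : ∫ t, ‖(deriv χ (t / M) / M) • x t‖ ^ 2 ≤
      2 * M * ((B / M) ^ 2 * (κ * ‖x 0‖) ^ 2) := by
    set c := (B / M) ^ 2 * (κ * ‖x 0‖) ^ 2 with hc
    have hc0 : 0 ≤ c := by positivity
    have e : ∀ t, ‖(deriv χ (t / M) / M) • x t‖ ^ 2 ≤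
        (Icc 0 M).indicator (fun _ => c) t + (Icc (L * M) ((L + 1) * M)).indicator (fun _ => c) t := by
      intro t
      by_cases ht : t / M ∈ Icc (0 : ℝ) 1 ∪ Icc L (L + 1)
      · have ht0 : 0 ≤ t := by
          have : 0 ≤ t / M := by
            rcases ht with ht | ht
            · exact ht.1
            · linarith [ht.1]
          have := mul_nonneg this hM.le
          rwa [div_mul_cancel₀ _ hM.ne'] at this
        have b1 : ‖(deriv χ (t / M) / M) • x t‖ ^ 2 ≤ c := by
          rw [norm_smul, mul_pow, hc, Real.norm_eq_abs, abs_div, abs_of_pos hM]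
          gcongr
          · exact hχB _
          · exact hmono 0 t le_rfl ht0
        rcases ht with ht | ht
        · have : t ∈ Icc 0 M := ⟨ht0, by have := (div_le_iff₀ hM).1 ht.2; linarith⟩
          rw [indicator_of_mem this]
          have : 0 ≤ (Icc (L * M) ((L + 1) * M)).indicator (fun _ => c) t :=
            indicator_nonneg (fun _ _ => hc0) t
          linarith
        · have : t ∈ Icc (L * M) ((L + 1) * M) :=
            ⟨(le_div_iff₀ hM).1 ht.1, (div_le_iff₀ hM).1 ht.2⟩
          rw [indicator_of_mem this]
          have : 0 ≤ (Icc 0 M).indicator (fun _ => c) t :=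
            indicator_nonneg (fun _ _ => hc0) t
          linarith
      · rw [hχ0 _ ht, zero_div, zero_smul, norm_zero, zero_pow two_ne_zero]
        exact add_nonneg (indicator_nonneg (fun _ _ => hc0) t)
          (indicator_nonneg (fun _ _ => hc0) t)
    have i1 : ∀ a b : ℝ, Integrable ((Icc a b).indicator (fun _ => c)) := fun a b =>
      (integrable_indicator_iff measurableSet_Icc).2 (by simp)
    refine (integral_mono_of_nonneg (Filter.Eventually.of_forall fun t => by positivity)
      ((i1 _ _).add (i1 _ _)) (Filter.Eventually.of_forall e)).trans (le_of_eq ?_)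
    simp only [Pi.add_apply]
    rw [integral_add (i1 _ _) (i1 _ _), integral_indicator measurableSet_Icc,
      integral_indicator measurableSet_Icc, setIntegral_const, setIntegral_const,
      Real.volume_real_Icc_of_le hM.le, Real.volume_real_Icc_of_le (by nlinarith)]
    simp only [smul_eq_mul]
    ring
  have low : (L - 1) * M * (‖x (L * M)‖ / κ) ^ 2 ≤ ∫ t, ‖y t‖ ^ 2 := by
    have hκ0 : 0 < κ := by linarith
    have i1 : Integrable ((Icc M (L * M)).indicator (fun _ => (‖x (L * M)‖ / κ) ^ 2)) :=
      (integrable_indicator_iff measurableSet_Icc).2 (by simp)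
    have : ∫ t, (Icc M (L * M)).indicator (fun _ => (‖x (L * M)‖ / κ) ^ 2) t
        = (L - 1) * M * (‖x (L * M)‖ / κ) ^ 2 := by
      rw [integral_indicator measurableSet_Icc, setIntegral_const,
        Real.volume_real_Icc_of_le (by nlinarith), smul_eq_mul]
      ring
    rw [← this]
    have i2 : Integrable fun t => ‖y t‖ ^ 2 :=
      ((hyc.toSchwartzMap hysm).memLp 2 volume).integrable_norm_pow (by norm_num)
    refine integral_mono i1 i2 fun t => ?_
    by_cases ht : t ∈ Icc M (L * M)
    · rw [indicator_of_mem ht]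
      have : χ (t / M) = 1 := h1 _ ⟨(le_div_iff₀ hM).2 (by linarith [ht.1]),
        (div_le_iff₀ hM).2 ht.2⟩
      simp only [hy, this, one_smul]
      refine pow_le_pow_left₀ (by positivity) ?_ 2
      rw [div_le_iff₀ hκ0, mul_comm ‖x t‖]
      exact hmono t (L * M) (hM.le.trans ht.1) ht.2
    · rw [indicator_of_notMem ht]; positivity
  have fin : (L - 1) * M * (‖x (L * M)‖ / κ) ^ 2 ≤
      M ^ 2 * (2 * M * ((B / M) ^ 2 * (κ * ‖x 0‖) ^ 2)) :=
    low.trans (key.trans (mul_le_mul_of_nonneg_left up (by positivity)))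
  have hκ0 : 0 < κ := by linarith
  have e1 : (L - 1) * M * (‖x (L * M)‖ / κ) ^ 2
      = 2 * M * B ^ 2 * κ ^ 2 * (4 * ‖x (L * M)‖ ^ 2) := by
    rw [hL]; field_simp; ring
  have e2 : M ^ 2 * (2 * M * ((B / M) ^ 2 * (κ * ‖x 0‖) ^ 2))
      = 2 * M * B ^ 2 * κ ^ 2 * ‖x 0‖ ^ 2 := by
    field_simp
  rw [e1, e2] at fin
  have fin2 : 4 * ‖x (L * M)‖ ^ 2 ≤ ‖x 0‖ ^ 2 := le_of_mul_le_mul_left fin (by positivity)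
  refine le_of_sq_le_sq ?_ (by positivity)
  linarith [mul_pow (1 / 2) ‖x 0‖ 2]

/-- A uniform resolvent bound on the imaginary axis gives exponential decay of a bounded
semigroup, with a rate proportional to the inverse of the bound. -/
theorem exists_decay_of_resolvent (κ : ℝ) (hκ : 1 ≤ κ) : ∃ C c : ℝ, 0 < C ∧ 0 < c ∧
    ∀ (A : H →L[ℂ] H) (M : ℝ), 0 < M →
      (∀ (ω : ℝ) (X : H), ‖X‖ ≤ M * ‖(Complex.I * ω) • X - A X‖) →
      ∀ x : ℝ → H, (∀ t, HasDerivAt x (A (x t)) t) →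
        (∀ s t, 0 ≤ s → s ≤ t → ‖x t‖ ≤ κ * ‖x s‖) →
        ∀ t, 0 ≤ t → ‖x t‖ ≤ C * Real.exp (-(c * (t / M))) * ‖x 0‖ := by
  obtain ⟨T, hT, H1⟩ := exists_contraction_time (H := H) κ hκ
  have hκ0 : 0 < κ := by linarith
  -- The norm halves after each time `T * M`. The factor `2` pays for the incomplete last step and
  -- `κ` for the growth within it.
  refine ⟨2 * κ, Real.log 2 / T, by positivity, by positivity, fun A M hM hA x hx hm t ht => ?_⟩
  have hstep : ∀ n : ℕ, ‖x (n * (T * M))‖ ≤ (1 / 2) ^ n * ‖x 0‖ := by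
    intro n
    induction n with
    | zero => simp
    | succ n ih =>
      have := H1 A M hM hA (fun s => x (s + n * (T * M)))
        (fun s => (hx _).comp_add_const s _)
        (fun s r hs hr => hm _ _ (by positivity) (by linarith))
      simp only [zero_add] at this
      push_cast
      rw [show ((n : ℝ) + 1) * (T * M) = T * M + n * (T * M) by ring, pow_succ]
      linarith
  have hTM : 0 < T * M := by positivity
  set n := ⌊t / (T * M)⌋₊ with hn
  have hn1 : (n : ℝ) * (T * M) ≤ t := by
    rw [← le_div_iff₀ hTM]; exact Nat.floor_le (by positivity)
  have hn2 : t / (T * M) ≤ n + 1 := (Nat.lt_floor_add_one _).le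
  have h1 := hm (n * (T * M)) t (by positivity) hn1
  have h2 : ((1 : ℝ) / 2) ^ n ≤ 2 * Real.exp (-(Real.log 2 / T * (t / M))) := by
    have : (1 / 2 : ℝ) ^ n = Real.exp (-(n * Real.log 2)) := by
      rw [one_div, inv_pow, ← Real.exp_log (show (0 : ℝ) < 2 ^ n by positivity), ← Real.exp_neg,
        Real.log_pow]
    rw [this]
    nth_rewrite 2 [← Real.exp_log (show (0 : ℝ) < 2 by norm_num)]
    rw [← Real.exp_add]
    apply Real.exp_le_exp.2
    have hl : 0 < Real.log 2 := Real.log_pos (by norm_num)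
    have e : Real.log 2 / T * (t / M) = Real.log 2 * (t / (T * M)) := by field_simp
    rw [e]
    nlinarith [mul_le_mul_of_nonneg_left hn2 hl.le]
  calc ‖x t‖ ≤ κ * ‖x (n * (T * M))‖ := h1
    _ ≤ κ * ((1 / 2) ^ n * ‖x 0‖) := mul_le_mul_of_nonneg_left (hstep n) hκ0.le
    _ ≤ κ * ((2 * Real.exp (-(Real.log 2 / T * (t / M)))) * ‖x 0‖) := by gcongr
    _ = _ := by ring

end GearhartPruess

/-! ### The Fourier symbol and its flow -/

namespace LaminatedBeam

/-- `act A` as a continuous linear map. -/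
def actL (A : Matrix (Fin 8) (Fin 8) ℝ) : State →L[ℂ] State :=
  Matrix.toEuclideanCLM (𝕜 := ℂ) (A.map Complex.ofReal)

/-- The Fourier symbol of the system: `Û_t = symbol κ Û`, where `∂ₓ` becomes `iκ`. -/
def symbol (p : Coeffs) (d : Dissipation) (κ : ℝ) : State →L[ℂ] State :=
  -((Complex.I * κ) ^ 2 • actL (A₂ p d) + (Complex.I * κ) • actL (A₁ p ![0, 1, 0])
    + actL (A₀ p d))

theorem symbol_apply_coord (p : Coeffs) (d : Dissipation) (κ : ℝ) (x : State) (i : Fin 8) :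
    symbol p d κ x i = -((Complex.I * κ) ^ 2 * (∑ j, (A₂ p d i j : ℂ) * x j)
      + (Complex.I * κ) * (∑ j, (A₁ p ![0, 1, 0] i j : ℂ) * x j)
      + ∑ j, (A₀ p d i j : ℂ) * x j) := rfl

theorem resolventEq_symbol (p : Coeffs) (d : Dissipation) (κ ω : ℝ) (x f : State)
    (hf : f = (Complex.I * ω) • x - symbol p d κ x) :
    ResolventEq p (damping p d κ) κ ω (x 0) (x 1) (x 2) (x 3) (x 4) (x 5) (x 6) (x 7)
      (f 0) (f 1) (f 2) (f 3) (f 4) (f 5) (f 6) (f 7) := by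
  have hfi : ∀ i, f i = Complex.I * ω * x i - symbol p d κ x i := fun i => by rw [hf]; rfl
  have hI : (Complex.I * κ) ^ 2 = -(κ : ℂ) ^ 2 := by rw [mul_pow, Complex.I_sq]; ring
  constructor <;> rw [hfi, symbol_apply_coord] <;>
    simp only [Fin.sum_univ_eight, A₀, A₁, A₂, damping, hI] <;> simp <;> ring

theorem norm_sq_state (x : State) : ‖x‖ ^ 2 = ‖x 0‖ ^ 2 + ‖x 1‖ ^ 2 + ‖x 2‖ ^ 2 + ‖x 3‖ ^ 2
    + ‖x 4‖ ^ 2 + ‖x 5‖ ^ 2 + ‖x 6‖ ^ 2 + ‖x 7‖ ^ 2 := by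
  rw [EuclideanSpace.norm_sq_eq, Fin.sum_univ_eight]

theorem norm_state_le (x : State) :
    ‖x‖ ≤ ‖x 0‖ + ‖x 1‖ + ‖x 2‖ + ‖x 3‖ + ‖x 4‖ + ‖x 5‖ + ‖x 6‖ + ‖x 7‖ := by
  have h : x = ∑ i, EuclideanSpace.single i (x i) := by
    ext j; simp [Finset.sum_apply]
  calc ‖x‖ = ‖∑ i, EuclideanSpace.single i (x i)‖ := by rw [← h]
    _ ≤ ∑ i, ‖EuclideanSpace.single i (x i)‖ := norm_sum_le _ _
    _ = _ := by simp [Fin.sum_univ_eight]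

/-- The energy of a state. -/
def energy (p : Coeffs) (x : State) : ℝ :=
  p.k₁ * ‖x 0‖ ^ 2 + ‖x 1‖ ^ 2 + p.k₂ * ‖x 2‖ ^ 2 + ‖x 3‖ ^ 2
    + p.k₃ * ‖x 4‖ ^ 2 + ‖x 5‖ ^ 2 + p.k₄ * ‖x 6‖ ^ 2 + ‖x 7‖ ^ 2

theorem energy_le (p : Coeffs) (x : State) : energy p x ≤ p.bound * ‖x‖ ^ 2 := by
  obtain ⟨hK, ⟨a1, -⟩, ⟨a2, -⟩, ⟨a3, -⟩, ⟨a4, -⟩, -⟩ := p.bound_spec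
  have e : ∀ {k : ℝ} (i : Fin 8), k ≤ p.bound → k * ‖x i‖ ^ 2 ≤ p.bound * ‖x i‖ ^ 2 :=
    fun i h => mul_le_mul_of_nonneg_right h (by positivity)
  rw [norm_sq_state, energy]
  linarith [e 0 a1, e 1 hK, e 2 a2, e 3 hK, e 4 a3, e 5 hK, e 6 a4, e 7 hK]

theorem le_energy (p : Coeffs) (x : State) : ‖x‖ ^ 2 ≤ p.bound * energy p x := by
  obtain ⟨hK, ⟨-, a1⟩, ⟨-, a2⟩, ⟨-, a3⟩, ⟨-, a4⟩, -⟩ := p.bound_spec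
  have e : ∀ {k : ℝ} (i : Fin 8), 0 < k → 1 / k ≤ p.bound →
      ‖x i‖ ^ 2 ≤ p.bound * (k * ‖x i‖ ^ 2) :=
    fun i hk h => le_mul_of_mul_le hk h (by positivity) le_rfl
  have e' : ∀ i : Fin 8, ‖x i‖ ^ 2 ≤ p.bound * ‖x i‖ ^ 2 := fun i =>
    le_mul_of_one_le_left (by positivity) hK
  rw [norm_sq_state, energy]
  linarith [e 0 p.k₁_pos a1, e' 1, e 2 p.k₂_pos a2, e' 3, e 4 p.k₃_pos a3, e' 5,
    e 6 p.k₄_pos a4, e' 7]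

theorem damping_nonneg (p : Coeffs) (d : Dissipation) (κ : ℝ) : 0 ≤ damping p d κ := by
  have := p.k₅_pos
  cases d <;> simp [damping, Dissipation.eps] <;> positivity

theorem energy_antitone {p : Coeffs} {d : Dissipation} {κ : ℝ} {x : ℝ → State}
    (hx : ∀ t, HasDerivAt x (symbol p d κ (x t)) t) : Antitone fun t => energy p (x t) := by
  have hc : ∀ (i : Fin 8) (t : ℝ), HasDerivAt (fun t => ‖x t i‖ ^ 2)
      (2 * ((symbol p d κ (x t) i).re * (x t i).re + (symbol p d κ (x t) i).im * (x t i).im)) t := by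
    intro i t
    have h1 : HasDerivAt (fun t => x t i) (symbol p d κ (x t) i) t :=
      (((EuclideanSpace.proj (𝕜 := ℂ) i).restrictScalars ℝ).hasFDerivAt.comp_hasDerivAt t (hx t))
    have h2 := h1.norm_sq
    rw [Complex.inner] at h2
    convert h2 using 2
    simp
  have hE : ∀ t, HasDerivAt (fun t => energy p (x t)) (-(2 * (damping p d κ * ‖x t 7‖ ^ 2))) t := by
    intro t
    have h := ((((((((hc 0 t).const_mul p.k₁).add (hc 1 t)).add ((hc 2 t).const_mul p.k₂)).add
      (hc 3 t)).add ((hc 4 t).const_mul p.k₃)).add (hc 5 t)).add ((hc 6 t).const_mul p.k₄)).add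
      (hc 7 t)
    -- At `ω = 0` the right-hand side of the resolvent equation is minus the time derivative, so the
    -- static identity becomes the dissipation law.
    have hr := (resolventEq_symbol p d κ 0 (x t) (-symbol p d κ (x t)) (by simp)).energy_identity
    convert! h using 1
    rw [hr]
    simp only [PiLp.neg_apply, Complex.neg_re, Complex.neg_im]
    ring
  refine antitone_of_deriv_nonpos (fun t => (hE t).differentiableAt) fun t => ?_
  rw [(hE t).deriv]
  have := mul_nonneg (damping_nonneg p d κ) (sq_nonneg ‖x t 7‖)
  linarith

theorem norm_le_of_hasDerivAt_symbol {p : Coeffs} {d : Dissipation} {κ : ℝ} {x : ℝ → State}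
    (hx : ∀ t, HasDerivAt x (symbol p d κ (x t)) t) {s t : ℝ} (hst : s ≤ t) :
    ‖x t‖ ≤ p.bound * ‖x s‖ := by
  have hK := p.bound_spec.1
  refine le_of_sq_le_sq ?_ (by positivity)
  have h1 := le_energy p (x t)
  have h2 := energy_antitone hx hst
  have h3 := energy_le p (x s)
  have h4 := mul_le_mul_of_nonneg_left (h2.trans h3) (by linarith : 0 ≤ p.bound)
  simp only at h4
  rw [mul_pow]
  linarith

/-- The solution operator of the system on the Fourier side. -/
def flow (p : Coeffs) (d : Dissipation) (t κ : ℝ) : State →L[ℂ] State :=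
  NormedSpace.exp (t • symbol p d κ)

theorem flow_zero (p : Coeffs) (d : Dissipation) (κ : ℝ) : flow p d 0 κ = 1 := by
  let : NormedAlgebra ℚ (State →L[ℂ] State) := NormedAlgebra.restrictScalars ℚ ℂ _
  have h : (0 : ℝ) • symbol p d κ = 0 := zero_smul ℝ (symbol p d κ)
  rw [flow, h, NormedSpace.exp_zero]

theorem hasDerivAt_flow (p : Coeffs) (d : Dissipation) (κ : ℝ) (x₀ : State) (t : ℝ) :
    HasDerivAt (fun t => flow p d t κ x₀) (symbol p d κ (flow p d t κ x₀)) t := by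
  have h := hasDerivAt_exp_smul_const' (𝕂 := ℝ) (symbol p d κ) t
  exact ((ContinuousLinearMap.apply ℂ State x₀).restrictScalars ℝ).hasFDerivAt.comp_hasDerivAt t h

theorem continuous_symbol (p : Coeffs) (d : Dissipation) : Continuous (symbol p d) := by
  unfold symbol
  fun_prop

theorem continuous_flow (p : Coeffs) (d : Dissipation) (t : ℝ) : Continuous (flow p d t) :=
  let : NormedAlgebra ℚ (State →L[ℂ] State) := NormedAlgebra.restrictScalars ℚ ℂ _
  NormedSpace.exp_continuous.comp ((continuous_symbol p d).const_smul t)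

theorem norm_flow_le (p : Coeffs) (d : Dissipation) (κ : ℝ) (x₀ : State) {t : ℝ} (ht : 0 ≤ t) :
    ‖flow p d t κ x₀‖ ≤ p.bound * ‖x₀‖ := by
  simpa [flow_zero] using norm_le_of_hasDerivAt_symbol (hasDerivAt_flow p d κ x₀) ht

/-- Pointwise decay on the Fourier side. -/
theorem exists_flow_decay (p : Coeffs) {d : Dissipation} {m n : ℕ} (hr : RateExponents p d m n) :
    ∃ C c : ℝ, 0 < C ∧ 0 < c ∧ ∀ (κ t : ℝ) (x₀ : State), κ ≠ 0 → 0 ≤ t →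
      ‖flow p d t κ x₀‖ ≤ C * Real.exp (-(c * (rate m n |κ| * t))) * ‖x₀‖ := by
  obtain ⟨C₁, hC₁, H₁⟩ := exists_resolvent_bound p hr
  obtain ⟨C, c, hC, hc, H⟩ := exists_decay_of_resolvent (H := State) p.bound p.bound_spec.1
  refine ⟨C, c / C₁, hC, by positivity, fun κ t x₀ hκ ht => ?_⟩
  have hρ : 0 < rate m n |κ| := rate_pos m n (abs_pos.2 hκ)
  have := H (symbol p d κ) (C₁ / rate m n |κ|) (by positivity) (fun ω X => ?_) _
    (hasDerivAt_flow p d κ x₀) (fun s t _ hst =>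
      norm_le_of_hasDerivAt_symbol (hasDerivAt_flow p d κ x₀) hst) t ht
  · rw [flow_zero, one_apply_eq_self] at this
    have e : c / C₁ * (rate m n |κ| * t) = c * (t / (C₁ / rate m n |κ|)) := by field_simp
    rw [e]
    exact this
  · set f := (Complex.I * ω) • X - symbol p d κ X with hf
    have hfi : ∀ i, ‖f i‖ ≤ ‖f‖ := fun i => PiLp.norm_apply_le f i
    exact (norm_state_le X).trans (H₁ κ ω ‖f‖ _ _ _ _ _ _ _ _ _ _ _ _ _ _ _ _ hκ
      (resolventEq_symbol p d κ ω X f hf) (hfi 0) (hfi 1) (hfi 2) (hfi 3) (hfi 4) (hfi 5)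
      (hfi 6) (hfi 7))

/-! ### Weak solutions on the Fourier side and uniqueness -/

/-- Multiplication by `2πiξ` on test functions. -/
def mulFreq (g : 𝓢(ℝ, ℂ)) : 𝓢(ℝ, ℂ) :=
  (2 * Real.pi * Complex.I) • SchwartzMap.smulLeftCLM ℂ (fun x : ℝ => ((inner ℝ x 1 : ℝ) : ℂ)) g

theorem mulFreq_apply (g : 𝓢(ℝ, ℂ)) (ξ : ℝ) :
    mulFreq g ξ = Complex.I * (2 * Real.pi * ξ : ℝ) * g ξ := by
  rw [mulFreq, smul_apply, SchwartzMap.smulLeftCLM_apply_apply (by fun_prop)]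
  simp
  ring

theorem fourier_lineDeriv_apply (T : 𝓢'(ℝ, State)) (g : 𝓢(ℝ, ℂ)) :
    (𝓕 (∂_{(1 : ℝ)} T)) g = (𝓕 T) (mulFreq g) := by
  rw [fourier_lineDerivOp_eq, mulFreq]
  simp only [map_smul]
  rfl

theorem hasDerivAt_fourier_solution {p : Coeffs} {d : Dissipation} {U₀ : L2State}
    {U : ℝ → L2State} (hU : IsSolution p d ![0, 1, 0] U₀ U) (g : 𝓢(ℝ, ℂ)) {t : ℝ} (ht : 0 < t) :
    HasDerivAt (fun s => ((𝓕 (U s) : L2State) : 𝓢'(ℝ, State)) g)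
      (-(actL (A₂ p d) (((𝓕 (U t) : L2State) : 𝓢'(ℝ, State)) (mulFreq (mulFreq g)))
        + actL (A₁ p ![0, 1, 0]) (((𝓕 (U t) : L2State) : 𝓢'(ℝ, State)) (mulFreq g))
        + actL (A₀ p d) (((𝓕 (U t) : L2State) : 𝓢'(ℝ, State)) g))) t := by
  -- The Fourier transform of a tempered distribution tested with `g` is the distribution tested
  -- with `𝓕 g`.
  have h := hU.equation (𝓕 g) t ht
  have e : ∀ (T : 𝓢'(ℝ, State)), T (𝓕 g) = (𝓕 T) g := fun T => rfl
  simp only [e, fourier_lineDeriv_apply, Lp.fourier_toTemperedDistribution_eq] at h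
  exact h

theorem norm_toTemperedDistribution_apply_le (v : L2State) (g : 𝓢(ℝ, ℂ)) :
    ‖(v : 𝓢'(ℝ, State)) g‖ ≤ ‖g.toLp 2‖ * ‖v‖ := by
  rw [Lp.toTemperedDistribution_apply]
  have h1 := eLpNorm_smul_le_mul_eLpNorm (p := 2) (q := 2) (r := 1) (μ := volume)
    (Lp.aestronglyMeasurable v) (g.memLp 2 volume).1
  have h2 : ‖∫ x, g x • v x‖ₑ ≤ eLpNorm (⇑g • ⇑v) 1 volume := by
    rw [eLpNorm_one_eq_lintegral_enorm]
    exact enorm_integral_le_lintegral_enorm _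
  have h3 := ENNReal.toReal_mono
    (ENNReal.mul_ne_top (g.memLp 2 volume).eLpNorm_ne_top (Lp.eLpNorm_ne_top v)) (h2.trans h1)
  rw [ENNReal.toReal_mul] at h3
  rwa [SchwartzMap.norm_toLp, Lp.norm_def, ← toReal_enorm]

theorem integrable_smul_lp (v : L2State) (g : 𝓢(ℝ, ℂ)) : Integrable (fun x => g x • v x) :=
  memLp_one_iff_integrable.1 ((Lp.memLp v).smul (g.memLp 2 volume))

/-- The symbol acting under the pairing with a test function. -/
theorem integral_smul_symbol (p : Coeffs) (d : Dissipation) (v : L2State) (g : 𝓢(ℝ, ℂ)) :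
    ∫ ξ, g ξ • symbol p d (2 * Real.pi * ξ) (v ξ) =
      -(actL (A₂ p d) ((v : 𝓢'(ℝ, State)) (mulFreq (mulFreq g)))
        + actL (A₁ p ![0, 1, 0]) ((v : 𝓢'(ℝ, State)) (mulFreq g))
        + actL (A₀ p d) ((v : 𝓢'(ℝ, State)) g)) := by
  simp only [Lp.toTemperedDistribution_apply]
  have hi := integrable_smul_lp v
  rw [← ContinuousLinearMap.integral_comp_comm _ (hi _),
    ← ContinuousLinearMap.integral_comp_comm _ (hi _),
    ← ContinuousLinearMap.integral_comp_comm _ (hi _)]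
  have hA : ∀ (A : State →L[ℂ] State) (g : 𝓢(ℝ, ℂ)), Integrable fun ξ => A (g ξ • v ξ) :=
    fun A g => A.integrable_comp (hi g)
  have hA2 : ∀ (A B : State →L[ℂ] State) (g h : 𝓢(ℝ, ℂ)),
      Integrable fun ξ => A (g ξ • v ξ) + B (h ξ • v ξ) := fun A B g h => (hA A g).add (hA B h)
  rw [← integral_add (hA _ _) (hA _ _), ← integral_add (hA2 _ _ _ _) (hA _ _), ← integral_neg]
  refine integral_congr_ae (Filter.Eventually.of_forall fun ξ => ?_)
  simp only [symbol, mulFreq_apply, neg_apply,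
    add_apply, smul_apply, map_smul, smul_neg, smul_add,
    smul_smul]
  congr 3 <;> congr 1 <;> ring

/-- The symbol is unbounded in `ξ`, but its polynomial growth is absorbed into the Schwartz function
through `mulFreq`. -/
theorem integrable_smul_symbol (p : Coeffs) (d : Dissipation) (v : L2State) (g : 𝓢(ℝ, ℂ)) :
    Integrable fun ξ => g ξ • symbol p d (2 * Real.pi * ξ) (v ξ) := by
  have hi := integrable_smul_lp v
  have hA : ∀ (A : State →L[ℂ] State) (g : 𝓢(ℝ, ℂ)), Integrable fun ξ => A (g ξ • v ξ) :=
    fun A g => A.integrable_comp (hi g)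
  refine ((((hA (actL (A₂ p d)) (mulFreq (mulFreq g))).add
    (hA (actL (A₁ p ![0, 1, 0])) (mulFreq g))).add (hA (actL (A₀ p d)) g)).neg).congr
    (Filter.Eventually.of_forall fun ξ => ?_)
  simp only [symbol, mulFreq_apply, Pi.add_apply, Pi.neg_apply, neg_apply,
    add_apply, smul_apply, map_smul, smul_neg, smul_add,
    smul_smul]
  congr 3 <;> congr 1 <;> ring

theorem aestronglyMeasurable_flow (p : Coeffs) (d : Dissipation) (t : ℝ) (v : L2State) :
    AEStronglyMeasurable (fun ξ : ℝ => flow p d t (2 * Real.pi * ξ) (v ξ)) := by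
  have h : Continuous fun ξ : ℝ => flow p d t (2 * Real.pi * ξ) :=
    (continuous_flow p d t).comp (by fun_prop)
  exact isBoundedBilinearMap_apply.continuous.comp_aestronglyMeasurable
    ((h.aestronglyMeasurable (μ := volume)).prodMk (Lp.aestronglyMeasurable v))

theorem memLp_flow (p : Coeffs) (d : Dissipation) {t : ℝ} (ht : 0 ≤ t) (v : L2State) :
    MemLp (fun ξ : ℝ => flow p d t (2 * Real.pi * ξ) (v ξ)) 2 volume :=
  (Lp.memLp v).of_le_mul (aestronglyMeasurable_flow p d t v)
    (Filter.Eventually.of_forall fun _ => norm_flow_le p d _ _ ht)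

/-- The solution operator on the Fourier side, acting on `L²`. -/
def flowLp (p : Coeffs) (d : Dissipation) (v : L2State) (t : ℝ) : L2State :=
  if ht : 0 ≤ t then (memLp_flow p d ht v).toLp else 0

theorem coeFn_flowLp (p : Coeffs) (d : Dissipation) (v : L2State) {t : ℝ} (ht : 0 ≤ t) :
    flowLp p d v t =ᵐ[volume] fun ξ : ℝ => flow p d t (2 * Real.pi * ξ) (v ξ) := by
  rw [flowLp, dif_pos ht]
  exact MemLp.coeFn_toLp _

theorem norm_flowLp_le (p : Coeffs) (d : Dissipation) (v : L2State) {t : ℝ} (ht : 0 ≤ t) :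
    ‖flowLp p d v t‖ ≤ p.bound * ‖v‖ := by
  refine Lp.norm_le_mul_norm_of_ae_le_mul ?_
  filter_upwards [coeFn_flowLp p d v ht] with ξ hξ
  rw [hξ]
  exact norm_flow_le p d _ _ ht

theorem flowLp_apply (p : Coeffs) (d : Dissipation) (v : L2State) {t : ℝ} (ht : 0 ≤ t)
    (g : 𝓢(ℝ, ℂ)) : (flowLp p d v t : 𝓢'(ℝ, State)) g
      = ∫ ξ, g ξ • flow p d t (2 * Real.pi * ξ) (v ξ) := by
  rw [Lp.toTemperedDistribution_apply]
  refine integral_congr_ae ?_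
  filter_upwards [coeFn_flowLp p d v ht] with ξ hξ
  rw [hξ]

theorem continuousOn_flowLp_apply (p : Coeffs) (d : Dissipation) (v : L2State) (g : 𝓢(ℝ, ℂ)) :
    ContinuousOn (fun t => (flowLp p d v t : 𝓢'(ℝ, State)) g) (Ici 0) := by
  have h : ContinuousOn (fun t => ∫ ξ, g ξ • flow p d t (2 * Real.pi * ξ) (v ξ)) (Ici 0) := by
    refine continuousOn_of_dominated (bound := fun ξ => p.bound * ‖g ξ • v ξ‖)
      (fun t _ => (g.continuous.aestronglyMeasurable).smul (aestronglyMeasurable_flow p d t v))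
      (fun t ht => Filter.Eventually.of_forall fun ξ => ?_)
      ((integrable_smul_lp v g).norm.const_mul _) (Filter.Eventually.of_forall fun ξ => ?_)
    · rw [norm_smul, norm_smul]
      have := mul_le_mul_of_nonneg_left (norm_flow_le p d (2 * Real.pi * ξ) (v ξ) ht)
        (norm_nonneg (g ξ))
      linarith
    · have hc : Continuous fun t => flow p d t (2 * Real.pi * ξ) (v ξ) :=
        continuous_iff_continuousAt.2 fun t => (hasDerivAt_flow p d _ (v ξ) t).continuousAt
      exact (hc.const_smul (g ξ)).continuousOn
  exact h.congr fun t ht => flowLp_apply p d v ht g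

/-- Moving the symbol inside the flow lets the bound `norm_flow_le` yield a majorant of the time
derivative that does not depend on time, as differentiation under the integral requires. -/
theorem symbol_flow (p : Coeffs) (d : Dissipation) (t κ : ℝ) (x : State) :
    symbol p d κ (flow p d t κ x) = flow p d t κ (symbol p d κ x) := by
  have hc : Commute (symbol p d κ) (t • symbol p d κ) :=
    ContinuousLinearMap.ext fun x => (symbol p d κ).map_smul_of_tower t _
  have h : Commute (symbol p d κ) (flow p d t κ) := hc.exp_right
  exact congrArg (fun A : State →L[ℂ] State => A x) h.eq

theorem hasDerivAt_flowLp_apply (p : Coeffs) (d : Dissipation) (v : L2State) (g : 𝓢(ℝ, ℂ))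
    {t : ℝ} (ht : 0 < t) :
    HasDerivAt (fun t => (flowLp p d v t : 𝓢'(ℝ, State)) g)
      (-(actL (A₂ p d) ((flowLp p d v t : 𝓢'(ℝ, State)) (mulFreq (mulFreq g)))
        + actL (A₁ p ![0, 1, 0]) ((flowLp p d v t : 𝓢'(ℝ, State)) (mulFreq g))
        + actL (A₀ p d) ((flowLp p d v t : 𝓢'(ℝ, State)) g))) t := by
  rw [← integral_smul_symbol]
  have h := (hasDerivAt_integral_of_dominated_loc_of_deriv_le (μ := volume)
    (F := fun t ξ => g ξ • flow p d t (2 * Real.pi * ξ) (v ξ))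
    (F' := fun t ξ => g ξ • symbol p d (2 * Real.pi * ξ) (flow p d t (2 * Real.pi * ξ) (v ξ)))
    (bound := fun ξ => p.bound * ‖g ξ • symbol p d (2 * Real.pi * ξ) (v ξ)‖) (x₀ := t)
    (Ioi_mem_nhds ht)
    (Filter.Eventually.of_forall fun s =>
      (g.continuous.aestronglyMeasurable).smul (aestronglyMeasurable_flow p d s v))
    ?_ ?_ (Filter.Eventually.of_forall fun ξ s hs => ?_)
    ((integrable_smul_symbol p d v g).norm.const_mul _)
    (Filter.Eventually.of_forall fun ξ s _ =>
      (hasDerivAt_flow p d (2 * Real.pi * ξ) (v ξ) s).fun_const_smul (g ξ))).2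
  · have e : ∫ ξ, g ξ • symbol p d (2 * Real.pi * ξ) (flow p d t (2 * Real.pi * ξ) (v ξ))
        = ∫ ξ, g ξ • symbol p d (2 * Real.pi * ξ) (flowLp p d v t ξ) := by
      refine integral_congr_ae ?_
      filter_upwards [coeFn_flowLp p d v ht.le] with ξ hξ
      rw [hξ]
    rw [← e]
    refine h.congr_of_eventuallyEq ?_
    filter_upwards [Ioi_mem_nhds ht] with s hs
    exact flowLp_apply p d v (le_of_lt hs) g
  · refine (integrable_smul_lp (flowLp p d v t) g).congr ?_
    filter_upwards [coeFn_flowLp p d v ht.le] with ξ hξ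
    rw [hξ]
  · refine (integrable_smul_symbol p d (flowLp p d v t) g).1.congr ?_
    filter_upwards [coeFn_flowLp p d v ht.le] with ξ hξ
    rw [hξ]
  · rw [symbol_flow, norm_smul, norm_smul]
    have := mul_le_mul_of_nonneg_left (norm_flow_le p d (2 * Real.pi * ξ)
      (symbol p d (2 * Real.pi * ξ) (v ξ)) (le_of_lt hs)) (norm_nonneg (g ξ))
    linarith

theorem norm_toLp_mulFreq_le {R : ℝ} (g : 𝓢(ℝ, ℂ)) (hg : ∀ x, R < |x| → g x = 0) :
    ‖(mulFreq g).toLp 2‖ ≤ (2 * Real.pi * R) * ‖g.toLp 2‖ := by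
  refine Lp.norm_le_mul_norm_of_ae_le_mul ?_
  filter_upwards [(mulFreq g).coeFn_toLp 2 volume, g.coeFn_toLp 2 volume] with x h1 h2
  rw [h1, h2, mulFreq_apply, norm_mul, norm_mul, Complex.norm_I, one_mul, Complex.norm_real,
    Real.norm_eq_abs, abs_mul, abs_of_pos Real.two_pi_pos]
  rcases le_or_gt |x| R with h | h
  · gcongr
  · rw [hg x h]; simp

theorem mulFreq_eq_zero {g : 𝓢(ℝ, ℂ)} {x : ℝ} (hg : g x = 0) : mulFreq g x = 0 := by
  rw [mulFreq_apply, hg, mul_zero]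

/-- A weak solution of `D_t = symbol D` with vanishing initial value vanishes. -/
theorem weak_solution_eq_zero {p : Coeffs} {d : Dissipation} {D : ℝ → L2State} {T S : ℝ}
    (hT : 0 ≤ T) (hS : ∀ t ∈ Icc 0 T, ‖D t‖ ≤ S) (h0 : D 0 = 0)
    (hc : ∀ g : 𝓢(ℝ, ℂ), ContinuousOn (fun t => (D t : 𝓢'(ℝ, State)) g) (Icc 0 T))
    (hd : ∀ (g : 𝓢(ℝ, ℂ)) (t : ℝ), 0 < t →
      HasDerivAt (fun t => (D t : 𝓢'(ℝ, State)) g)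
      (-(actL (A₂ p d) ((D t : 𝓢'(ℝ, State)) (mulFreq (mulFreq g)))
        + actL (A₁ p ![0, 1, 0]) ((D t : 𝓢'(ℝ, State)) (mulFreq g))
        + actL (A₀ p d) ((D t : 𝓢'(ℝ, State)) g))) t)
    {R : ℝ} (hR : 0 ≤ R) (g : 𝓢(ℝ, ℂ)) (hg : ∀ x, R < |x| → g x = 0) :
    (D T : 𝓢'(ℝ, State)) g = 0 := by
  set B := 2 * Real.pi * R with hB
  have hB0 : 0 ≤ B := by positivity
  set C := ‖actL (A₂ p d)‖ * B ^ 2 + ‖actL (A₁ p ![0, 1, 0])‖ * B + ‖actL (A₀ p d)‖ with hC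
  have hC0 : 0 ≤ C := by positivity
  have hS0 : 0 ≤ S := (norm_nonneg _).trans (hS 0 ⟨le_rfl, hT⟩)
  -- The right-hand side of the equation tests `D` with other functions than `g`, so the integrated
  -- equation is iterated over all `g` supported in `[-R, R]` simultaneously. On these, `mulFreq` is
  -- bounded in `L²` by `B`, and each integration in time gains a factor `C t / (m + 1)`. The limit
  -- `m → ∞` gives zero.
  have key : ∀ (m : ℕ) (g : 𝓢(ℝ, ℂ)), (∀ x, R < |x| → g x = 0) → ∀ t ∈ Icc 0 T,
      ‖(D t : 𝓢'(ℝ, State)) g‖ ≤ S * ‖g.toLp 2‖ * (C ^ m * t ^ m / m.factorial) := by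
    intro m
    induction m with
    | zero =>
      intro g hg t ht
      have h1 := norm_toTemperedDistribution_apply_le (D t) g
      have h2 := mul_le_mul_of_nonneg_left (hS t ht) (norm_nonneg (g.toLp 2))
      simp only [pow_zero, Nat.factorial_zero, Nat.cast_one, mul_one, div_one]
      linarith
    | succ m ih =>
      intro g hg t ht
      have hg1 : ∀ x, R < |x| → mulFreq g x = 0 := fun x hx => mulFreq_eq_zero (hg x hx)
      have hg2 : ∀ x, R < |x| → mulFreq (mulFreq g) x = 0 := fun x hx =>
        mulFreq_eq_zero (hg1 x hx)
      set q' : ℝ → State := fun t => -(actL (A₂ p d) ((D t : 𝓢'(ℝ, State)) (mulFreq (mulFreq g)))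
        + actL (A₁ p ![0, 1, 0]) ((D t : 𝓢'(ℝ, State)) (mulFreq g))
        + actL (A₀ p d) ((D t : 𝓢'(ℝ, State)) g)) with hq'
      have hsub : Icc 0 t ⊆ Icc 0 T := Icc_subset_Icc_right ht.2
      have hq'c : ContinuousOn q' (Icc 0 t) := by
        refine ((((actL _).continuous.comp_continuousOn (hc _)).add
          ((actL _).continuous.comp_continuousOn (hc _))).add
          ((actL _).continuous.comp_continuousOn (hc _))).neg.mono hsub
      have hint : IntervalIntegrable q' volume 0 t :=
        (hq'c.mono (by rw [uIcc_of_le ht.1])).intervalIntegrable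
      have hftc := intervalIntegral.integral_eq_sub_of_hasDerivAt_of_le ht.1 ((hc g).mono hsub)
        (fun s hs => hd g s hs.1) hint
      have h00 : (D 0 : 𝓢'(ℝ, State)) g = 0 := by
        have := norm_toTemperedDistribution_apply_le (D 0) g
        rw [h0, norm_zero, mul_zero] at this
        rw [h0]
        exact norm_le_zero_iff.1 this
      rw [h00, sub_zero] at hftc
      rw [← hftc]
      have hb1 := norm_toLp_mulFreq_le g hg
      have hb2 := norm_toLp_mulFreq_le (mulFreq g) hg1
      rw [← hB] at hb1 hb2
      have hbound : ∀ s ∈ Ioc 0 t, ‖q' s‖ ≤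
          S * ‖g.toLp 2‖ * (C ^ (m + 1) / m.factorial) * s ^ m := by
        intro s hs
        have hsT : s ∈ Icc 0 T := hsub ⟨hs.1.le, hs.2⟩
        set E := C ^ m * s ^ m / m.factorial with hE
        have hE0 : 0 ≤ E := by have := hs.1.le; positivity
        have i0 := ih g hg s hsT
        have i1 := (ih (mulFreq g) hg1 s hsT).trans
          (mul_le_mul_of_nonneg_right (mul_le_mul_of_nonneg_left hb1 hS0) hE0)
        have i2 := (ih (mulFreq (mulFreq g)) hg2 s hsT).trans
          (mul_le_mul_of_nonneg_right (mul_le_mul_of_nonneg_left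
            (hb2.trans (mul_le_mul_of_nonneg_left hb1 hB0)) hS0) hE0)
        have j0 := (actL (A₀ p d)).le_opNorm_of_le i0
        have j1 := (actL (A₁ p ![0, 1, 0])).le_opNorm_of_le i1
        have j2 := (actL (A₂ p d)).le_opNorm_of_le i2
        have j3 : ‖q' s‖ ≤ ‖actL (A₂ p d)‖ * (S * (B * (B * ‖g.toLp 2‖)) * E)
            + ‖actL (A₁ p ![0, 1, 0])‖ * (S * (B * ‖g.toLp 2‖) * E)
            + ‖actL (A₀ p d)‖ * (S * ‖g.toLp 2‖ * E) := by
          rw [hq', norm_neg]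
          exact norm_add₃_le.trans (add_le_add (add_le_add j2 j1) j0)
        refine j3.trans (le_of_eq ?_)
        calc _ = S * ‖g.toLp 2‖ * (C * E) := by rw [hC]; ring
          _ = _ := by rw [hE]; ring
      calc ‖∫ s in (0 : ℝ)..t, q' s‖
          ≤ ∫ s in (0 : ℝ)..t, S * ‖g.toLp 2‖ * (C ^ (m + 1) / m.factorial) * s ^ m := by
            refine intervalIntegral.norm_integral_le_of_norm_le ht.1 ?_ ?_
            · exact Filter.Eventually.of_forall hbound
            · exact (Continuous.intervalIntegrable (by fun_prop) _ _)
        _ = _ := by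
            rw [intervalIntegral.integral_const_mul, integral_pow, Nat.factorial_succ]
            push_cast
            field_simp
            simp
  have hlim : Filter.Tendsto (fun m : ℕ => S * ‖g.toLp 2‖ * (C ^ m * T ^ m / m.factorial))
      Filter.atTop (nhds (S * ‖g.toLp 2‖ * 0)) := by
    refine Filter.Tendsto.const_mul _ ?_
    simp only [← mul_pow]
    exact FloorSemiring.tendsto_pow_div_factorial_atTop (C * T)
  rw [mul_zero] at hlim
  have := ge_of_tendsto' hlim fun m => key m g hg T ⟨hT, le_rfl⟩
  exact norm_le_zero_iff.1 this

/-- The Fourier representation of the solution. -/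
theorem fourier_solution {p : Coeffs} {d : Dissipation} {U₀ : L2State} {U : ℝ → L2State}
    (hU : IsSolution p d ![0, 1, 0] U₀ U) {T : ℝ} (hT : 0 ≤ T) :
    (𝓕 (U T) : L2State) =ᵐ[volume] fun ξ : ℝ => flow p d T (2 * Real.pi * ξ) ((𝓕 U₀ : L2State) ξ) := by
  set v : L2State := 𝓕 U₀ with hv
  -- The difference solves the weak equation with zero initial value. It vanishes against every
  -- compactly supported test function, hence almost everywhere.
  set D : ℝ → L2State := fun t => 𝓕 (U t) - flowLp p d v t with hD
  have hDg : ∀ (t : ℝ) (g : 𝓢(ℝ, ℂ)), (D t : 𝓢'(ℝ, State)) g =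
      ((𝓕 (U t) : L2State) : 𝓢'(ℝ, State)) g - (flowLp p d v t : 𝓢'(ℝ, State)) g := by
    intro t g
    rw [← Lp.toTemperedDistributionCLM_apply, hD]
    simp only [map_sub]
    rfl
  have hcF : ContinuousOn (fun t => (𝓕 (U t) : L2State)) (Ici 0) :=
    (FourierTransform.continuous_fourier (E := L2State)).comp_continuousOn hU.continuousOn
  obtain ⟨S, hS⟩ := isCompact_Icc.exists_bound_of_continuousOn
    (hcF.mono (Icc_subset_Ici_self : Icc 0 T ⊆ Ici 0))
  have hD0 : D 0 = 0 := by
    rw [hD]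
    simp only
    rw [sub_eq_zero, hU.initial]
    refine Lp.ext ?_
    filter_upwards [coeFn_flowLp p d v le_rfl] with ξ hξ
    rw [hξ, flow_zero, one_apply_eq_self]
  have hcD : ∀ g : 𝓢(ℝ, ℂ), ContinuousOn (fun t => (D t : 𝓢'(ℝ, State)) g) (Icc 0 T) := by
    intro g
    simp only [hDg]
    refine ContinuousOn.sub ?_ ((continuousOn_flowLp_apply p d v g).mono Icc_subset_Ici_self)
    have hL : Continuous fun w : L2State => (w : 𝓢'(ℝ, State)) g := by
      have h1 : Continuous fun w : L2State => Lp.toTemperedDistributionCLM State volume 2 w :=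
        ContinuousLinearMap.continuous _
      exact (PointwiseConvergenceCLM.evalCLM (RingHom.id ℂ) State g).continuous.comp h1
    exact hL.comp_continuousOn (hcF.mono Icc_subset_Ici_self)
  have hdD : ∀ (g : 𝓢(ℝ, ℂ)) (t : ℝ), 0 < t → HasDerivAt (fun t => (D t : 𝓢'(ℝ, State)) g)
      (-(actL (A₂ p d) ((D t : 𝓢'(ℝ, State)) (mulFreq (mulFreq g)))
        + actL (A₁ p ![0, 1, 0]) ((D t : 𝓢'(ℝ, State)) (mulFreq g))
        + actL (A₀ p d) ((D t : 𝓢'(ℝ, State)) g))) t := by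
    intro g t ht
    simp only [hDg]
    convert! (hasDerivAt_fourier_solution hU g ht).sub (hasDerivAt_flowLp_apply p d v g ht) using 1
    simp only [map_sub]
    abel
  have hz : ∀ (R : ℝ), 0 ≤ R → ∀ g : 𝓢(ℝ, ℂ), (∀ x, R < |x| → g x = 0) →
      (D T : 𝓢'(ℝ, State)) g = 0 := fun R hR g hg =>
    weak_solution_eq_zero (S := S + p.bound * ‖v‖) hT
      (fun t ht => (norm_sub_le _ _).trans (add_le_add (hS t ht) (norm_flowLp_le p d v ht.1)))
      hD0 hcD hdD hR g hg
  have hDT : ∀ᵐ ξ, D T ξ = 0 := by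
    refine ae_eq_zero_of_integral_contDiff_smul_eq_zero
      ((Lp.memLp (D T)).locallyIntegrable (by norm_num)) fun g hg hgc => ?_
    have hgc' : HasCompactSupport fun x => (g x : ℂ) := hgc.comp_left Complex.ofReal_zero
    have hg' : ContDiff ℝ (⊤ : ℕ∞) fun x => (g x : ℂ) := Complex.ofRealCLM.contDiff.comp hg
    obtain ⟨R, hR⟩ := hgc.isCompact.isBounded.exists_norm_le
    have := hz |R| (abs_nonneg R) (hgc'.toSchwartzMap hg') fun x hx => by
      have : x ∉ tsupport g := fun h =>
        absurd (hR x h) (not_le.2 ((le_abs_self R).trans_lt hx))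
      simp [image_eq_zero_of_notMem_tsupport this]
    rw [Lp.toTemperedDistribution_apply] at this
    simpa using this
  filter_upwards [hDT, coeFn_flowLp p d v hT, Lp.coeFn_sub (𝓕 (U T)) (flowLp p d v T)]
    with ξ h1 h2 h3
  rw [← h2]
  rw [hD] at h1
  simp only at h1
  rw [h3, Pi.sub_apply, sub_eq_zero] at h1
  exact h1

/-! ### Fourier transforms of integrable and Sobolev data, and derivatives -/

theorem ae_eq_of_forall_schwartz {f f' : ℝ → State} (hf : LocallyIntegrable f)
    (hf' : LocallyIntegrable f') (h : ∀ g : 𝓢(ℝ, ℂ), HasCompactSupport g →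
      ∫ x, g x • f x = ∫ x, g x • f' x) :
    f =ᵐ[volume] f' := by
  refine ae_eq_of_integral_contDiff_smul_eq hf hf' fun g hg hgc => ?_
  have hgc' : HasCompactSupport fun x => (g x : ℂ) := hgc.comp_left Complex.ofReal_zero
  have hg' : ContDiff ℝ (⊤ : ℕ∞) fun x => (g x : ℂ) := Complex.ofRealCLM.contDiff.comp hg
  simpa using h (hgc'.toSchwartzMap hg') hgc'

/-- The `L²` Fourier transform is identified with the integral formula by testing both against
Schwartz functions. The integral is bounded by the `L¹` norm. -/
theorem norm_fourier_le_integral (U₀ : L2State) (hU : Integrable U₀) :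
    ∀ᵐ ξ, ‖(𝓕 U₀ : L2State) ξ‖ ≤ ∫ x, ‖U₀ x‖ := by
  have hcont : Continuous (𝓕 (U₀ : ℝ → State)) :=
    VectorFourier.fourierIntegral_continuous Real.continuous_fourierChar
      (by exact (innerSL ℝ).continuous₂) hU
  have h : (𝓕 U₀ : L2State) =ᵐ[volume] 𝓕 (U₀ : ℝ → State) := by
    refine ae_eq_of_forall_schwartz ((Lp.memLp _).locallyIntegrable (by norm_num))
      hcont.locallyIntegrable fun g _ => ?_
    have h1 : ((𝓕 U₀ : L2State) : 𝓢'(ℝ, State)) g = (U₀ : 𝓢'(ℝ, State)) (𝓕 g) := by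
      rw [← Lp.fourier_toTemperedDistribution_eq]; rfl
    rw [Lp.toTemperedDistribution_apply, Lp.toTemperedDistribution_apply] at h1
    rw [h1]
    have := VectorFourier.integral_fourierIntegral_smul_eq_flip (μ := volume) (ν := volume)
      (e := Real.fourierChar) (L := innerₗ ℝ) (f := g) (g := U₀) Real.continuous_fourierChar
      (by exact (innerSL ℝ).continuous₂) g.integrable hU
    rw [flip_innerₗ] at this
    exact this
  filter_upwards [h] with ξ hξ
  rw [hξ]
  exact VectorFourier.norm_fourierIntegral_le_integral_norm _ _ _ _ _

theorem mulFreq_iterate_apply (j : ℕ) (g : 𝓢(ℝ, ℂ)) (ξ : ℝ) :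
    (mulFreq^[j] g) ξ = (Complex.I * (2 * Real.pi * ξ : ℝ)) ^ j * g ξ := by
  induction j with
  | zero => simp
  | succ j ih => rw [Function.iterate_succ_apply', mulFreq_apply, ih, pow_succ]; ring

theorem fourier_iteratedLineDeriv_apply (j : ℕ) (T : 𝓢'(ℝ, State)) (g : 𝓢(ℝ, ℂ)) :
    (𝓕 (∂^{fun _ : Fin j => (1 : ℝ)} T)) g = (𝓕 T) (mulFreq^[j] g) := by
  induction j generalizing g with
  | zero => simp
  | succ j ih =>
    rw [iteratedLineDerivOp_succ_left, fourier_lineDeriv_apply, Function.iterate_succ_apply]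
    exact ih _

/-- Derivatives of `L²` functions through the Fourier transform. -/
theorem isDeriv_fourierInv {j : ℕ} {v w : L2State}
    (hw : w =ᵐ[volume] fun ξ : ℝ =>
      (Complex.I * (2 * Real.pi * ξ : ℝ)) ^ j • (𝓕 v : L2State) ξ) :
    IsDeriv j v (𝓕⁻ w) := by
  have h : 𝓕 (∂^{fun _ : Fin j => (1 : ℝ)} (v : 𝓢'(ℝ, State))) = (w : 𝓢'(ℝ, State)) := by
    ext1 g
    rw [fourier_iteratedLineDeriv_apply, Lp.fourier_toTemperedDistribution_eq,
      Lp.toTemperedDistribution_apply, Lp.toTemperedDistribution_apply]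
    refine integral_congr_ae ?_
    filter_upwards [hw] with ξ hξ
    rw [hξ, mulFreq_iterate_apply, smul_smul, mul_comm]
  rw [IsDeriv, ← Lp.fourierInv_toTemperedDistribution_eq, ← h, FourierTransform.fourierInv_fourier_eq]

/-- The Fourier transform of `H^N` functions. -/
theorem memLp_pow_smul_fourier {N i : ℕ} {U₀ : L2State} (hi : i ≤ N)
    (hU : MemSobolev (N : ℝ) 2 (U₀ : 𝓢'(ℝ, State))) :
    MemLp (fun ξ : ℝ => (Complex.I * (2 * Real.pi * ξ : ℝ)) ^ i • (𝓕 U₀ : L2State) ξ) 2 volume := by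
  obtain ⟨f, hf⟩ := memSobolev_iff_exists_smulLeftCLM_fourier.1 hU
  have hl : LocallyIntegrable (𝓕 U₀ : L2State) := (Lp.memLp _).locallyIntegrable (by norm_num)
  have hcont : Continuous fun x : ℝ => (((1 + ‖x‖ ^ 2) ^ ((N : ℝ) / 2) : ℝ) : ℂ) := by
    refine Complex.continuous_ofReal.comp ?_
    exact (by fun_prop : Continuous fun x : ℝ => 1 + ‖x‖ ^ 2).rpow_const
      fun x => Or.inl (by positivity)
  have hae : f =ᵐ[volume] fun x : ℝ =>
      (((1 + ‖x‖ ^ 2) ^ ((N : ℝ) / 2) : ℝ) : ℂ) • (𝓕 U₀ : L2State) x := by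
    refine ae_eq_of_forall_schwartz ((Lp.memLp _).locallyIntegrable (by norm_num)) ?_ fun g _ => ?_
    · exact hl.continuous_smul hcont
    · have h1 := congrArg (fun T : 𝓢'(ℝ, State) => T g) hf
      simp only [smulLeftCLM_apply_apply, Lp.fourier_toTemperedDistribution_eq,
        Lp.toTemperedDistribution_apply] at h1
      rw [← h1]
      refine integral_congr_ae (Filter.Eventually.of_forall fun x => ?_)
      simp only
      rw [SchwartzMap.smulLeftCLM_apply_apply (by fun_prop), smul_smul, smul_eq_mul, mul_comm]
  have hmeas : AEStronglyMeasurable (fun ξ : ℝ =>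
      (Complex.I * (2 * Real.pi * ξ : ℝ)) ^ i • (𝓕 U₀ : L2State) ξ) :=
    (by fun_prop : Continuous fun ξ : ℝ =>
      (Complex.I * (2 * Real.pi * ξ : ℝ)) ^ i).aestronglyMeasurable.smul (Lp.aestronglyMeasurable _)
  -- The Bessel weight is a function of `ξ` while derivatives multiply by `2πiξ`, whence the
  -- constant.
  refine (Lp.memLp f).of_le_mul (c := (2 * Real.pi) ^ i) hmeas ?_
  filter_upwards [hae] with x hx
  rw [hx, norm_smul, norm_smul, ← mul_assoc]
  refine mul_le_mul_of_nonneg_right ?_ (norm_nonneg _)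
  have h1 : 1 ≤ 1 + ‖x‖ ^ 2 := by have := sq_nonneg ‖x‖; linarith
  have h2 : |x| ^ i ≤ (1 + ‖x‖ ^ 2) ^ ((N : ℝ) / 2) := by
    have e1 : |x| ^ i ≤ (1 + ‖x‖ ^ 2) ^ ((i : ℝ) / 2) := by
      have : |x| = (‖x‖ ^ 2) ^ (1 / 2 : ℝ) := by
        rw [← Real.sqrt_eq_rpow, Real.sqrt_sq (norm_nonneg x), Real.norm_eq_abs]
      rw [this, ← Real.rpow_natCast, ← Real.rpow_mul (by positivity)]
      rw [show (1 / 2 : ℝ) * i = i / 2 by ring]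
      exact Real.rpow_le_rpow (by positivity) (by linarith) (by positivity)
    exact e1.trans (Real.rpow_le_rpow_of_exponent_le h1 (by gcongr))
  rw [norm_pow, norm_mul, Complex.norm_I, one_mul, Complex.norm_real, Real.norm_eq_abs, abs_mul,
    abs_of_pos Real.two_pi_pos, mul_pow, Complex.norm_real, Real.norm_eq_abs,
    abs_of_nonneg (by positivity : 0 ≤ (1 + ‖x‖ ^ 2) ^ ((N : ℝ) / 2))]
  gcongr

/-! ### Time decay of the low and high frequency parts -/

theorem integrable_pow_mul_exp (j m : ℕ) (hm : 2 ≤ m) {c : ℝ} (hc : 0 < c) :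
    Integrable fun x : ℝ => (|x| ^ j * Real.exp (-(c * |x| ^ m))) ^ 2 := by
  have h1 : Integrable ((Icc (-1 : ℝ) 1).indicator fun _ => (1 : ℝ)) :=
    (integrable_indicator_iff measurableSet_Icc).2 (by simp)
  have h2 : Integrable fun x : ℝ => |x| ^ (2 * j) * Real.exp (-(2 * c) * x ^ 2) := by
    have := (integrable_rpow_mul_exp_neg_mul_sq (b := 2 * c) (by positivity) (s := (2 * j : ℕ))
      (by have : (0 : ℝ) ≤ (2 * j : ℕ) := Nat.cast_nonneg _
          linarith)).norm
    refine this.congr (Filter.Eventually.of_forall fun x => ?_)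
    simp only [Real.rpow_natCast, norm_mul, norm_pow, Real.norm_eq_abs, Real.abs_exp]
  have hcont : Continuous fun x : ℝ => (|x| ^ j * Real.exp (-(c * |x| ^ m))) ^ 2 := by fun_prop
  refine (h1.add h2).mono' hcont.aestronglyMeasurable (Filter.Eventually.of_forall fun x => ?_)
  rw [Real.norm_eq_abs, abs_of_nonneg (by positivity), Pi.add_apply]
  have e : (|x| ^ j * Real.exp (-(c * |x| ^ m))) ^ 2
      = |x| ^ (2 * j) * Real.exp (-(2 * c) * |x| ^ m) := by
    rw [mul_pow, ← pow_mul, mul_comm j, ← Real.exp_nat_mul]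
    congr 2
    push_cast; ring
  rw [e]
  have hpos : 0 ≤ |x| ^ (2 * j) * Real.exp (-(2 * c) * x ^ 2) := by positivity
  rcases le_total |x| 1 with h | h
  · have hx : x ∈ Icc (-1 : ℝ) 1 := abs_le.1 h
    rw [indicator_of_mem hx]
    have : |x| ^ (2 * j) * Real.exp (-(2 * c) * |x| ^ m) ≤ 1 * 1 := by
      refine mul_le_mul (pow_le_one₀ (abs_nonneg x) h) ?_ (Real.exp_pos _).le zero_le_one
      rw [Real.exp_le_one_iff, neg_mul, neg_nonpos]
      positivity
    linarith
  · have : |x| ^ (2 * j) * Real.exp (-(2 * c) * |x| ^ m) ≤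
        |x| ^ (2 * j) * Real.exp (-(2 * c) * x ^ 2) := by
      gcongr ?_ * Real.exp ?_
      rw [← sq_abs x]
      have := mul_le_mul_of_nonneg_left (pow_le_pow_right₀ h hm) (by positivity : 0 ≤ 2 * c)
      linarith
    have := indicator_nonneg (fun _ _ => zero_le_one) x (s := Icc (-1 : ℝ) 1) (f := fun _ => (1 : ℝ))
    linarith

/-- The `L²` norm of the low frequency part. -/
theorem exists_low_frequency_bound (j m : ℕ) (hm : 2 ≤ m) {c : ℝ} (hc : 0 < c) :
    ∃ Q : ℝ, 0 < Q ∧ ∀ t : ℝ, 0 ≤ t →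
      eLpNorm (fun ξ : ℝ => {κ : ℝ | |κ| ≤ 1}.indicator
        (fun κ => |κ| ^ j * Real.exp (-(c * (|κ| ^ m * t)))) (2 * Real.pi * ξ)) 2 volume ≤
      ENNReal.ofReal (Q * (1 + t) ^ (-((2 * j + 1 : ℝ) / (2 * m)))) := by
  set φ : ℝ → ℝ := fun x => |x| ^ j * Real.exp (-(c * |x| ^ m)) with hφ
  have hφi : Integrable fun x => φ x ^ 2 := integrable_pow_mul_exp j m hm hc
  set J := ∫ x, φ x ^ 2 with hJ
  have hJ0 : 0 ≤ J := integral_nonneg fun x => sq_nonneg _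
  refine ⟨Real.exp c * (Real.sqrt J + 1), by positivity, fun t ht => ?_⟩
  have hm0 : (m : ℝ) ≠ 0 := by positivity
  have ht1 : 0 < 1 + t := by linarith
  -- Rescaling the frequency by `s` makes the exponential independent of time. The factor `|κ| ^ j`
  -- then yields `s ^ (-j)` and the `L²` norm `s ^ (-1/2)`. Replacing `t` by `1 + t` costs at most
  -- `exp c`, since `|κ| ≤ 1`.
  obtain ⟨s, hs⟩ : ∃ s, s = (1 + t) ^ (1 / (m : ℝ)) := ⟨_, rfl⟩
  have hs0 : 0 < s := by rw [hs]; positivity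
  have hsm : s ^ m = 1 + t := by
    rw [hs, ← Real.rpow_natCast, ← Real.rpow_mul ht1.le, one_div, inv_mul_cancel₀ hm0,
      Real.rpow_one]
  have hle : ∀ ξ : ℝ, ‖{κ : ℝ | |κ| ≤ 1}.indicator
      (fun κ => |κ| ^ j * Real.exp (-(c * (|κ| ^ m * t)))) (2 * Real.pi * ξ)‖ ≤
      Real.exp c * (s ^ j)⁻¹ * φ (s * (2 * Real.pi) * ξ) := by
    intro ξ
    by_cases h : |2 * Real.pi * ξ| ≤ 1
    · rw [indicator_of_mem (by exact h), Real.norm_eq_abs, abs_of_nonneg (by positivity)]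
      set κ := 2 * Real.pi * ξ with hκ
      have e1 : φ (s * (2 * Real.pi) * ξ) = s ^ j * |κ| ^ j * Real.exp (-(c * (|κ| ^ m * (1 + t)))) := by
        rw [hφ, ← hsm]
        simp only
        rw [show s * (2 * Real.pi) * ξ = s * κ by rw [hκ]; ring, abs_mul, abs_of_pos hs0, mul_pow,
          mul_pow, mul_comm (s ^ m)]
      rw [e1]
      have e2 : Real.exp c * (s ^ j)⁻¹ * (s ^ j * |κ| ^ j * Real.exp (-(c * (|κ| ^ m * (1 + t)))))
          = |κ| ^ j * Real.exp (c + -(c * (|κ| ^ m * (1 + t)))) := by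
        rw [Real.exp_add]; field_simp
      rw [e2]
      gcongr
      have : c * |κ| ^ m ≤ c := mul_le_of_le_one_right hc.le (pow_le_one₀ (abs_nonneg _) h)
      linarith
    · rw [indicator_of_notMem (by exact h), norm_zero]
      positivity
  have hscale : 0 < s * (2 * Real.pi) := by positivity
  have hφm : MemLp (fun ξ => φ (s * (2 * Real.pi) * ξ)) 2 volume := by
    rw [memLp_two_iff_integrable_sq]
    · exact hφi.comp_mul_left' hscale.ne'
    · exact (by rw [hφ]; fun_prop : Continuous fun ξ => φ (s * (2 * Real.pi) * ξ)).aestronglyMeasurable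
  have hmem := hφm.const_mul (Real.exp c * (s ^ j)⁻¹)
  refine (eLpNorm_mono_real hle).trans ?_
  rw [hmem.eLpNorm_eq_integral_rpow_norm (by norm_num) (by norm_num)]
  apply ENNReal.ofReal_le_ofReal
  have hint : ∫ ξ, ‖Real.exp c * (s ^ j)⁻¹ * φ (s * (2 * Real.pi) * ξ)‖ ^ (2 : ENNReal).toReal
      = (Real.exp c * (s ^ j)⁻¹) ^ 2 * ((s * (2 * Real.pi))⁻¹ * J) := by
    have : ∀ ξ, ‖Real.exp c * (s ^ j)⁻¹ * φ (s * (2 * Real.pi) * ξ)‖ ^ (2 : ENNReal).toReal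
        = (Real.exp c * (s ^ j)⁻¹) ^ 2 * (fun x => φ x ^ 2) (s * (2 * Real.pi) * ξ) := fun ξ => by
      rw [ENNReal.toReal_ofNat, Real.rpow_ofNat, Real.norm_eq_abs, sq_abs, mul_pow]
    simp only [this]
    rw [integral_const_mul, Measure.integral_comp_mul_left (fun x => φ x ^ 2), smul_eq_mul,
      abs_of_pos (by positivity)]
  rw [hint, ENNReal.toReal_ofNat, show ((2 : ℝ))⁻¹ = 1 / 2 by norm_num, ← Real.sqrt_eq_rpow]
  have hfin : (1 + t) ^ (-((2 * j + 1 : ℝ) / (2 * m))) = (s ^ j)⁻¹ * Real.sqrt (s⁻¹) := by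
    have e1 : s ^ j = (1 + t) ^ ((j : ℝ) / m) := by
      rw [hs, ← Real.rpow_natCast, ← Real.rpow_mul ht1.le]; congr 1; ring
    have e2 : Real.sqrt (s⁻¹) = (1 + t) ^ (-(1 / (2 * (m : ℝ)))) := by
      rw [Real.sqrt_eq_rpow, hs, ← Real.rpow_neg ht1.le, ← Real.rpow_mul ht1.le]
      congr 1; field_simp
    rw [e1, e2, ← Real.rpow_neg ht1.le, ← Real.rpow_add ht1]
    congr 1
    field_simp
    ring
  rw [hfin, Real.sqrt_mul (by positivity), Real.sqrt_sq (by positivity), mul_inv, mul_assoc s⁻¹,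
    Real.sqrt_mul (by positivity)]
  have h2π : Real.sqrt ((2 * Real.pi)⁻¹ * J) ≤ Real.sqrt J + 1 := by
    have : (2 * Real.pi)⁻¹ * J ≤ J := by
      refine mul_le_of_le_one_left hJ0 (inv_le_one_of_one_le₀ ?_)
      linarith [Real.pi_gt_three]
    linarith [Real.sqrt_le_sqrt this]
  calc _ = Real.exp c * Real.sqrt ((2 * Real.pi)⁻¹ * J) * ((s ^ j)⁻¹ * Real.sqrt s⁻¹) := by ring
    _ ≤ _ := by gcongr

/-- The high frequency factor for the rate `a ^ (-n)`, `n > 0`. -/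
theorem exists_high_frequency_bound (ℓ n : ℕ) (hn : 0 < n) {c : ℝ} (hc : 0 < c) :
    ∃ B : ℝ, 0 < B ∧ ∀ a t : ℝ, 1 ≤ a → 0 ≤ t →
      Real.exp (-(c * ((a ^ n)⁻¹ * t))) ≤ B * (1 + t) ^ (-(ℓ : ℝ) / n) * a ^ ℓ := by
  refine ⟨Real.exp c * (1 + ℓ.factorial / c ^ ℓ), by positivity, fun a t ha ht => ?_⟩
  have ha0 : 0 < a := by linarith
  have hn0 : (n : ℝ) ≠ 0 := by positivity
  have ht1 : 0 < 1 + t := by linarith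
  -- In this variable the claim is that `y ^ (ℓ / n) * exp (-c y)` is bounded. The powers of `a`
  -- left over are the `ℓ` derivatives lost.
  obtain ⟨y, hy⟩ : ∃ y, y = (a ^ n)⁻¹ * (1 + t) := ⟨_, rfl⟩
  have hy0 : 0 < y := by rw [hy]; positivity
  have h1 : Real.exp (-(c * ((a ^ n)⁻¹ * t))) ≤ Real.exp c * Real.exp (-(c * y)) := by
    rw [← Real.exp_add, hy]
    apply Real.exp_le_exp.2
    have : c * (a ^ n)⁻¹ ≤ c := mul_le_of_le_one_right hc.le (inv_le_one_of_one_le₀ (one_le_pow₀ ha))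
    linarith
  have h2 : y ^ ((ℓ : ℝ) / n) * Real.exp (-(c * y)) ≤ 1 + ℓ.factorial / c ^ ℓ := by
    have e1 : y ^ ((ℓ : ℝ) / n) ≤ 1 + y ^ ℓ := by
      rcases le_total y 1 with h | h
      · have := Real.rpow_le_one hy0.le h (by positivity : (0 : ℝ) ≤ ℓ / n)
        have : 0 ≤ y ^ ℓ := by positivity
        linarith
      · have : y ^ ((ℓ : ℝ) / n) ≤ y ^ (ℓ : ℝ) := by
          apply Real.rpow_le_rpow_of_exponent_le h
          apply div_le_self (Nat.cast_nonneg _)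
          exact_mod_cast hn
        rw [Real.rpow_natCast] at this
        linarith
    have e2 : y ^ ℓ ≤ ℓ.factorial / c ^ ℓ * Real.exp (c * y) := by
      have := Real.pow_div_factorial_le_exp (c * y) (by positivity) ℓ
      rw [div_le_iff₀ (by positivity), mul_pow] at this
      rw [div_mul_eq_mul_div, le_div_iff₀ (by positivity)]
      linarith
    have e3 : 1 ≤ Real.exp (c * y) := Real.one_le_exp (by positivity)
    rw [Real.exp_neg, ← div_eq_mul_inv, div_le_iff₀ (Real.exp_pos _)]
    linarith
  have h3 : (1 + t) ^ (-(ℓ : ℝ) / n) * a ^ ℓ * y ^ ((ℓ : ℝ) / n) = 1 := by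
    have e : y ^ ((ℓ : ℝ) / n) = (a ^ ℓ)⁻¹ * (1 + t) ^ ((ℓ : ℝ) / n) := by
      rw [hy, Real.mul_rpow (by positivity) ht1.le, Real.inv_rpow (by positivity),
        ← Real.rpow_natCast a n, ← Real.rpow_mul ha0.le, mul_div_cancel₀ _ hn0, Real.rpow_natCast]
    rw [e, neg_div, Real.rpow_neg ht1.le]
    have : (1 + t) ^ ((ℓ : ℝ) / n) ≠ 0 := by positivity
    field_simp
  calc Real.exp (-(c * ((a ^ n)⁻¹ * t))) ≤ Real.exp c * Real.exp (-(c * y)) := h1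
    _ = Real.exp c * ((1 + t) ^ (-(ℓ : ℝ) / n) * a ^ ℓ) *
        (y ^ ((ℓ : ℝ) / n) * Real.exp (-(c * y))) := by
      linear_combination (-(Real.exp c * Real.exp (-(c * y)))) * h3
    _ ≤ Real.exp c * ((1 + t) ^ (-(ℓ : ℝ) / n) * a ^ ℓ) * (1 + ℓ.factorial / c ^ ℓ) := by gcongr
    _ = _ := by ring

/-- By Plancherel only the pointwise decay of the flow matters. The frequency is split at `|κ| = 1`:
below, the data enter through the sup norm of their Fourier transform; above, `hb` exchanges decay
in time for the factor `|κ| ^ ℓ`. -/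
theorem decayEstimate_of_flow_decay {p : Coeffs} {d : Dissipation} {N ℓ j m n : ℕ} {C c B : ℝ}
    (hm : 2 ≤ m) (hj : j + ℓ ≤ N) (hC : 0 < C) (hc : 0 < c) (hB : 0 < B) {b : ℝ → ℝ}
    (hflow : ∀ (κ t : ℝ) (x₀ : State), κ ≠ 0 → 0 ≤ t →
      ‖flow p d t κ x₀‖ ≤ C * Real.exp (-(c * (rate m n |κ| * t))) * ‖x₀‖)
    (hb : ∀ a t : ℝ, 1 ≤ a → 0 ≤ t → Real.exp (-(c * ((a ^ n)⁻¹ * t))) ≤ B * b t * a ^ ℓ) :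
    ∃ c₀ : ℝ, 0 < c₀ ∧ DecayEstimate p d ![0, 1, 0] N ℓ j c₀
      (fun t => (1 + t) ^ (-((2 * j + 1 : ℝ) / (2 * m)))) b := by
  obtain ⟨Q, hQ0, hQ⟩ := exists_low_frequency_bound j m hm hc
  refine ⟨C * Q + C * B, by positivity, fun U₀ hU₀ hU₁ U hU => ?_⟩
  have hb0 : ∀ t, 0 ≤ t → 0 ≤ b t := fun t ht => by
    have := (Real.exp_pos _).trans_le (hb 1 t le_rfl ht)
    rw [one_pow, mul_one] at this
    exact (pos_of_mul_pos_right this hB.le).le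
  have hW : ∀ i, i ≤ N → MemLp (fun ξ : ℝ =>
      (Complex.I * (2 * Real.pi * ξ : ℝ)) ^ i • (𝓕 U₀ : L2State) ξ) 2 volume := fun i hi =>
    memLp_pow_smul_fourier hi hU₀
  set M := ∫ x, ‖U₀ x‖ with hM
  have hM0 : 0 ≤ M := integral_nonneg fun x => norm_nonneg _
  set W₀ : L2State := (hW (j + ℓ) hj).toLp with hW₀
  refine ⟨𝓕⁻ W₀, isDeriv_fourierInv (MemLp.coeFn_toLp _), fun t ht => ?_⟩
  have hfs := fourier_solution hU ht
  have nI : ∀ (ξ : ℝ) (i : ℕ), ‖(Complex.I * (2 * Real.pi * ξ : ℝ)) ^ i‖ = |2 * Real.pi * ξ| ^ i :=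
    fun ξ i => by
      rw [norm_pow, norm_mul, Complex.norm_I, one_mul, Complex.norm_real, Real.norm_eq_abs]
  have hmem : MemLp (fun ξ : ℝ => (Complex.I * (2 * Real.pi * ξ : ℝ)) ^ j • (𝓕 (U t) : L2State) ξ)
      2 volume := by
    -- Existence of the derivative in `L²` needs only the boundedness of the flow and `j ≤ N`; decay
    -- plays no part here.
    refine (hW j (by omega)).of_le_mul (c := p.bound) ?_ ?_
    · exact (by fun_prop : Continuous fun ξ : ℝ =>
        (Complex.I * (2 * Real.pi * ξ : ℝ)) ^ j).aestronglyMeasurable.smul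
          (Lp.aestronglyMeasurable _)
    · filter_upwards [hfs] with ξ hξ
      rw [hξ, norm_smul, norm_smul]
      have := mul_le_mul_of_nonneg_left (norm_flow_le p d (2 * Real.pi * ξ)
        ((𝓕 U₀ : L2State) ξ) ht) (norm_nonneg ((Complex.I * (2 * Real.pi * ξ : ℝ)) ^ j))
      linarith
  set W : L2State := hmem.toLp with hWdef
  refine ⟨𝓕⁻ W, isDeriv_fourierInv (MemLp.coeFn_toLp _), ?_⟩
  have hn1 : ‖(𝓕⁻ W : L2State)‖ = ‖W‖ := by
    rw [← Lp.norm_fourier_eq, FourierTransform.fourier_fourierInv_eq]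
  have hn2 : ‖(𝓕⁻ W₀ : L2State)‖ = ‖W₀‖ := by
    rw [← Lp.norm_fourier_eq, FourierTransform.fourier_fourierInv_eq]
  rw [hn1, hn2]
  set h : ℝ → ℝ := fun ξ => {κ : ℝ | |κ| ≤ 1}.indicator
    (fun κ => |κ| ^ j * Real.exp (-(c * (|κ| ^ m * t)))) (2 * Real.pi * ξ) with hh
  have hh0 : ∀ ξ, 0 ≤ h ξ := fun ξ => indicator_nonneg (fun κ _ => by positivity) _
  have hmain : ∀ᵐ ξ, ‖W ξ‖ ≤ C * M * h ξ + C * (B * b t) * ‖W₀ ξ‖ := by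
    -- The flow decay is stated only at nonzero frequencies; the origin is a null set.
    have hne : ∀ᵐ ξ : ℝ, ξ ≠ 0 := by
      rw [ae_iff]; simp
    filter_upwards [hne, hfs, norm_fourier_le_integral U₀ hU₁, hmem.coeFn_toLp,
      (hW (j + ℓ) hj).coeFn_toLp] with ξ h0 h1 h2 h3 h4
    rw [hWdef, hW₀, h3, h4, h1, norm_smul, norm_smul, nI, nI]
    have hκ : 2 * Real.pi * ξ ≠ 0 := mul_ne_zero Real.two_pi_pos.ne' h0
    set κ := 2 * Real.pi * ξ with hκdef
    have hf := hflow κ t ((𝓕 U₀ : L2State) ξ) hκ ht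
    have hf' := mul_le_mul_of_nonneg_left hf (pow_nonneg (abs_nonneg κ) j)
    refine hf'.trans ?_
    have hbt := hb0 t ht
    rcases le_or_gt |κ| 1 with hle | hlt
    · have e1 : h ξ = |κ| ^ j * Real.exp (-(c * (|κ| ^ m * t))) := by
        rw [hh]; exact indicator_of_mem (by exact hle) _
      rw [e1, rate, if_pos hle]
      have e2 : |κ| ^ j * (C * Real.exp (-(c * (|κ| ^ m * t))) * ‖(𝓕 U₀ : L2State) ξ‖) ≤
          |κ| ^ j * (C * Real.exp (-(c * (|κ| ^ m * t))) * M) := by gcongr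
      have e3 : 0 ≤ C * (B * b t) * (|κ| ^ (j + ℓ) * ‖(𝓕 U₀ : L2State) ξ‖) := by positivity
      linarith
    · have e1 : 0 ≤ C * M * h ξ := mul_nonneg (by positivity) (hh0 ξ)
      rw [rate, if_neg hlt.not_ge]
      have e2 : |κ| ^ j * (C * Real.exp (-(c * ((|κ| ^ n)⁻¹ * t))) * ‖(𝓕 U₀ : L2State) ξ‖) ≤
          |κ| ^ j * (C * (B * b t * |κ| ^ ℓ) * ‖(𝓕 U₀ : L2State) ξ‖) := by
        gcongr
        exact hb _ t hlt.le ht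
      rw [pow_add]
      linarith
  have hhm : AEStronglyMeasurable h := by
    have hset : MeasurableSet {κ : ℝ | |κ| ≤ 1} := measurableSet_le (by fun_prop) (by fun_prop)
    have : Measurable fun κ : ℝ => {κ : ℝ | |κ| ≤ 1}.indicator
        (fun κ => |κ| ^ j * Real.exp (-(c * (|κ| ^ m * t)))) κ :=
      Measurable.indicator (by fun_prop) hset
    exact (this.comp (measurable_const_mul (2 * Real.pi))).aestronglyMeasurable
  have hE : eLpNorm W 2 volume ≤ ENNReal.ofReal (C * M) * ENNReal.ofReal
      (Q * (1 + t) ^ (-((2 * j + 1 : ℝ) / (2 * m)))) +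
      ENNReal.ofReal (C * (B * b t)) * ENNReal.ofReal ‖W₀‖ := by
    have e1 : eLpNorm (fun ξ => C * M * h ξ) 2 volume ≤ ENNReal.ofReal (C * M) *
        ENNReal.ofReal (Q * (1 + t) ^ (-((2 * j + 1 : ℝ) / (2 * m)))) := by
      have := eLpNorm_const_smul (C * M) h 2 (volume : Measure ℝ)
      rw [show (fun ξ => C * M * h ξ) = (C * M) • h from rfl, this, Real.enorm_eq_ofReal (by positivity)]
      gcongr
      exact hQ t ht
    have e2 : eLpNorm (fun ξ => C * (B * b t) * ‖W₀ ξ‖) 2 volume =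
        ENNReal.ofReal (C * (B * b t)) * ENNReal.ofReal ‖W₀‖ := by
      have := eLpNorm_const_smul (C * (B * b t)) (fun ξ => ‖W₀ ξ‖) 2 (volume : Measure ℝ)
      rw [show (fun ξ => C * (B * b t) * ‖W₀ ξ‖) = (C * (B * b t)) • fun ξ => ‖W₀ ξ‖ from rfl, this,
        Real.enorm_eq_ofReal (by have := hb0 t ht; positivity), eLpNorm_norm, Lp.norm_def,
        ENNReal.ofReal_toReal (Lp.eLpNorm_ne_top W₀)]
    refine (eLpNorm_mono_ae_real hmain).trans ?_
    refine (eLpNorm_add_le (hhm.const_mul _) ((Lp.aestronglyMeasurable W₀).norm.const_mul _)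
      (by norm_num)).trans ?_
    rw [e2]
    gcongr
  have hbt := hb0 t ht
  have ha0 : 0 ≤ (1 + t) ^ (-((2 * j + 1 : ℝ) / (2 * m))) := by positivity
  rw [← ENNReal.ofReal_mul (by positivity), ← ENNReal.ofReal_mul (by positivity),
    ← ENNReal.ofReal_add (by positivity) (by positivity)] at hE
  rw [Lp.norm_def]
  refine (ENNReal.toReal_le_of_le_ofReal (by positivity) hE).trans ?_
  set A := (1 + t) ^ (-((2 * j + 1 : ℝ) / (2 * m))) with hA
  have q1 : 0 ≤ C * B * A * M := by positivity
  have q2 : 0 ≤ C * Q * b t * ‖W₀‖ := by positivity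
  linarith

end LaminatedBeam

end

theorem mainTheorem3 (p : LaminatedBeam.Coeffs) (N ℓ j : ℕ) (hℓ : 1 ≤ ℓ) (hN : ℓ ≤ N)
    (hj : j ≤ N - ℓ) :
    ((p.k₁ = p.k₂ ∧ p.k₂ = p.k₃) →
      ∃ c₀ c₁ : ℝ, 0 < c₀ ∧ 0 < c₁ ∧
        LaminatedBeam.DecayEstimate p .strong ![0, 1, 0] N ℓ j c₀
          (fun t => (1 + t) ^ (-(1 / 12 : ℝ) - (j : ℝ) / 6))
          (fun t => Real.exp (-(c₁ * t)))) ∧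
    (¬(p.k₁ = p.k₂ ∧ p.k₂ = p.k₃) →
      ∃ c₀ : ℝ, 0 < c₀ ∧
        LaminatedBeam.DecayEstimate p .strong ![0, 1, 0] N ℓ j c₀
          (fun t => (1 + t) ^ (-(1 / 12 : ℝ) - (j : ℝ) / 6))
          (fun t => (1 + t) ^ (-(ℓ : ℝ) / 4))) ∧
    ((p.k₁ = p.k₂ ∧ p.k₂ = p.k₃) →
      ∃ c₀ : ℝ, 0 < c₀ ∧
        LaminatedBeam.DecayEstimate p .weak ![0, 1, 0] N ℓ j c₀
          (fun t => (1 + t) ^ (-(1 / 8 : ℝ) - (j : ℝ) / 4))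
          (fun t => (1 + t) ^ (-(ℓ : ℝ) / 2))) ∧
    (¬(p.k₁ = p.k₂ ∧ p.k₂ = p.k₃) →
      ∃ c₀ : ℝ, 0 < c₀ ∧
        LaminatedBeam.DecayEstimate p .weak ![0, 1, 0] N ℓ j c₀
          (fun t => (1 + t) ^ (-(1 / 8 : ℝ) - (j : ℝ) / 4))
          (fun t => (1 + t) ^ (-(ℓ : ℝ) / 4))) := by
  have hjN : j + ℓ ≤ N := by omega
  -- The exponents are `(2j + 1) / (2m)` with `m = 6` for System I and `m = 4` for System II.
  have e6 : (-(1 / 12 : ℝ) - (j : ℝ) / 6) = -((2 * j + 1 : ℝ) / (2 * (6 : ℕ))) := by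
    push_cast; ring
  have e4 : (-(1 / 8 : ℝ) - (j : ℝ) / 4) = -((2 * j + 1 : ℝ) / (2 * (4 : ℕ))) := by
    push_cast; ring
  rw [e6, e4]
  refine ⟨fun h => ?_, fun _ => ?_, fun h => ?_, fun _ => ?_⟩
  · obtain ⟨C, c, hC, hc, H⟩ := LaminatedBeam.exists_flow_decay p (.strong_eq h)
    obtain ⟨c₀, hc₀, hD⟩ := LaminatedBeam.decayEstimate_of_flow_decay (ℓ := ℓ) (B := 1)
      (b := fun t => Real.exp (-(c * t))) (by norm_num) hjN hC hc one_pos H fun a t ha ht => by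
        -- With `n = 0` the high-frequency rate is constant, so the decay is exponential and the
        -- factor `a ^ ℓ ≥ 1` is simply given away.
        rw [pow_zero, inv_one, one_mul, one_mul]
        exact le_mul_of_one_le_right (Real.exp_pos _).le (one_le_pow₀ ha)
    exact ⟨c₀, c, hc₀, hc, hD⟩
  · obtain ⟨C, c, hC, hc, H⟩ := LaminatedBeam.exists_flow_decay p (.strong (p := p))
    obtain ⟨B, hB, hb⟩ := LaminatedBeam.exists_high_frequency_bound ℓ 4 (by norm_num) hc
    exact LaminatedBeam.decayEstimate_of_flow_decay (by norm_num) hjN hC hc hB H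
      (by exact_mod_cast hb)
  · obtain ⟨C, c, hC, hc, H⟩ := LaminatedBeam.exists_flow_decay p (.weak_eq h)
    obtain ⟨B, hB, hb⟩ := LaminatedBeam.exists_high_frequency_bound ℓ 2 (by norm_num) hc
    exact LaminatedBeam.decayEstimate_of_flow_decay (by norm_num) hjN hC hc hB H
      (by exact_mod_cast hb)
  · obtain ⟨C, c, hC, hc, H⟩ := LaminatedBeam.exists_flow_decay p (.weak (p := p))
    obtain ⟨B, hB, hb⟩ := LaminatedBeam.exists_high_frequency_bound ℓ 4 (by norm_num) hc
    exact LaminatedBeam.decayEstimate_of_flow_decay (by norm_num) hjN hC hc hB H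
      (by exact_mod_cast hb)
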